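/- Conventions. Structures are countable, languages are countable, and formulas are finitary first-order with equality. A computable structure is a structure with domain $\omega$ in a computable language (symbols effectively coded, arities computable) whose functions and relations are uniformly computable, i.e. whose atomic diagram is computable. Let $R\subseteq A^m$ be an $m$-ary relation on a structure $\mathcal A$ ($R$ need not be in the language). If $F:\mathcal A\to\mathcal B$ is an isomorphism, $R^{\mathcal B}$ denotes the image $F(R)$, so that $(\mathcal B,R^{\mathcal B})$ is an isomorphic copy of $(\mathcal A,R)$. For tuples $\bar x,\bar y$ of the same length, "$R$ restricted to $\bar x$ is the same as $R$ restricted to $\bar y$" means that $(x_{i_1},\dots,x_{i_m})\in R\iff (y_{i_1},\dots,y_{i_m})\in R$ for all indices $i_1,\dots,i_m$. A tuple $\bar a$ is \emph{d-free} over a tuple $\bar c$ if for every tuple $\bar b$ and every existential formula $\varphi(\bar c,\bar u,\bar v)$ true of $\bar a,\bar b$ there are $\bar a',\bar b'$ satisfying $\varphi(\bar c,\bar u,\bar v)$ such that $R$ restricted to $\bar c\bar a'$ is not the same as $R$ restricted to $\bar c\bar a$, and such that for every existential formula $\psi(\bar c,\bar u,\bar v)$ true of $\bar a',\bar b'$ there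 are $\bar a'',\bar b''$ satisfying $\psi(\bar c,\bar u,\bar v)$ with $R$ restricted to $\bar c\bar a''\bar b''$ the same as $R$ restricted to $\bar c\bar a\bar b$. Proposition. (1) Let $\mathcal A$ be a computable structure and $R$ a computable relation on $\mathcal A$. Suppose that, given a tuple $\bar c$, one can effectively find a tuple $\bar a$ which is d-free over $\bar c$; that moreover, given $\bar c$, a tuple $\bar b$ and (the Gödel number of) an existential formula $\varphi(\bar c,\bar u,\bar v)$ true of $\bar a,\bar b$ (for the tuple $\bar a$ found for $\bar c$), one can effectively find $\bar a',\bar b'$ as in the definition of d-freeness; and that, given further an existential formula $\psi(\bar c,\bar u,\bar v)$ true of these $\bar a',\bar b'$, one can effectively find the $\bar a''$ of a pair $\bar a'',\bar b''$ as in that definition. Then there is a computable copy $\mathcal B$ of $\mathcal A$ such that $R^{\mathcal B}$ is not of c.e. degree, i.e. is not Turing equivalent to any c.e. set. (2) Let $\mathcal A$ be a countable structure and $R$ a relation on $\mathcal A$ such that over every tuple $\bar c$ from $\mathcal A$ some tuple $\bar a$ is d-free. Then the degree spectrum of $R$ on a cone strictly contains the c.e. degrees: there is a set $C_0\subseteq\omega$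 such that for every $C\ge_T C_0$ $$\{\deg(W\oplus C): W \text{ c.e. in } C\}\subsetneq\{\deg(R^{\mathcal B}\oplus C): (\mathcal B,R^{\mathcal B})\cong(\mathcal A,R),\ \mathcal B\text{ has domain }\omega,\ \mathcal B\le_T C\}.$$ -/

import Mathlib

universe u v w

namespace DegreeSpectra

open FirstOrder Computability

/-! ### Sets of natural numbers, c.e. sets, Turing degrees -/

section Degrees

open Classical in
/-- The characteristic function of a set of natural numbers, in the form used for oracles. -/
noncomputable def charFn (S : Set ℕ) : ℕ →. ℕ :=
  fun n => Part.some (if n ∈ S then 1 else 0)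

/-- `S` is Turing reducible to `T`. -/
def SetReducible (S T : Set ℕ) : Prop := charFn S ≤ᵀ charFn T

/-- The Turing degree of a set of natural numbers. -/
noncomputable def setDegree (S : Set ℕ) : TuringDegree :=
  toAntisymmetrization TuringReducible (charFn S)

/-- The join `S ⊕ T = {2n | n ∈ S} ∪ {2n + 1 | n ∈ T}`. -/
def setJoin (S T : Set ℕ) : Set ℕ :=
  {k | (∃ n ∈ S, k = 2 * n) ∨ (∃ n ∈ T, k = 2 * n + 1)}

/-- `W` is c.e. relative to the oracles in `O` (the relativization of `REPred`). -/
def CEIn (O : Set (ℕ →. ℕ)) (W : Set ℕ) : Prop :=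
  RecursiveIn O fun n : ℕ => Part.assert (n ∈ W) fun _ => Part.some ()

/-- A set of natural numbers is of c.e. degree if it is Turing equivalent to a c.e. set. -/
def OfCEDegree (S : Set ℕ) : Prop :=
  ∃ W : Set ℕ, REPred (fun n => n ∈ W) ∧ setDegree S = setDegree W

/-- The c.e. degrees relative to `C`: the degrees of the sets `W ⊕ C` with `W` c.e. in `C`. -/
def ceDegreesIn (C : Set ℕ) : Set TuringDegree :=
  {d | ∃ W : Set ℕ, CEIn {charFn C} W ∧ d = setDegree (setJoin W C)}

end Degrees

/-! ### Computable structures and degree spectra -/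

section Structures

variable (L : FirstOrder.Language.{u, v})
  [Primcodable (Σ n, L.Functions n)] [Primcodable (Σ n, L.Relations n)]

/-- The (coded) language `L` is a computable language: the arity of a symbol can be computed from
the symbol. -/
def ComputableLanguage : Prop :=
  Computable (fun f : Σ n, L.Functions n => f.1) ∧
    Computable (fun r : Σ n, L.Relations n => r.1)

open Classical in
/-- The structure `S` with domain `ℕ` is computable from the oracles in `O`: its functions and
relations are uniformly computable from `O`, that is, its atomic diagram is. The arguments of a
symbol are given as a list, of which as many entries are used as the arity demands (missing
entries are read as `0`). -/
def StructureComputableIn (O : Set (ℕ →. ℕ)) (S : L.Structure ℕ) : Prop :=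
  ComputableIn O (fun p : (Σ n, L.Functions n) × List ℕ =>
      S.funMap p.1.2 (fun i => p.2.getD i 0)) ∧
    ComputableIn O (fun p : (Σ n, L.Relations n) × List ℕ =>
      decide (S.RelMap p.1.2 (fun i => p.2.getD i 0)))

/-- A computable structure (with domain `ℕ`). -/
def ComputableStructure (S : L.Structure ℕ) : Prop := StructureComputableIn L ∅ S

variable {L}

/-- The image of a relation under a map between the underlying sets. -/
def imageRel {M : Type*} {N : Type*} {m : ℕ} (F : M → N) (R : Set (Fin m → M)) :
    Set (Fin m → N) :=
  (fun x => F ∘ x) '' R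

/-- An `m`-ary relation on `ℕ` as a set of natural numbers, through the standard coding of
`m`-tuples. -/
def relCode {m : ℕ} (R : Set (Fin m → ℕ)) : Set ℕ := Encodable.encode '' R

/-- The degree spectrum of `R` below (the degree of) `C`: the degrees of `R^B ⊕ C`, where
`(B, R^B)` is an isomorphic copy of `(M, R)` with domain `ℕ` and `B` is computable from `C`. -/
def degreeSpectrumBelow {M : Type w} [L.Structure M] {m : ℕ} (R : Set (Fin m → M))
    (C : Set ℕ) : Set TuringDegree :=
  {d | ∃ (B : L.Structure ℕ) (F : @FirstOrder.Language.Equiv L M ℕ _ B),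
    StructureComputableIn L {charFn C} B ∧
      d = setDegree (setJoin (relCode (imageRel F R)) C)}

/-- The degree spectrum of `R` on a cone strictly contains the c.e. degrees. -/
def SpectrumOnConeStrictlyContainsCE {M : Type w} [L.Structure M] {m : ℕ}
    (R : Set (Fin m → M)) : Prop :=
  ∃ C₀ : Set ℕ, ∀ C : Set ℕ, SetReducible C₀ C →
    ceDegreesIn C ⊂ degreeSpectrumBelow (L := L) R C

end Structures

/-! ### Difference-free tuples -/

section DFree

variable {L : FirstOrder.Language.{u, v}}

/-- `R` restricted to the tuples from `x` is the same as `R` restricted to the (corresponding)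
tuples from `y`. -/
def SameOn {M : Type*} {m : ℕ} {ι : Type*} (R : Set (Fin m → M)) (x y : ι → M) : Prop :=
  ∀ i : Fin m → ι, x ∘ i ∈ R ↔ y ∘ i ∈ R

/-- The concatenation `c̄ ā`. -/
def join₂ {M : Type*} {k r : ℕ} (c : Fin k → M) (a : Fin r → M) : Fin k ⊕ Fin r → M :=
  Sum.elim c a

/-- The concatenation `c̄ ā b̄`. -/
def join₃ {M : Type*} {k r n : ℕ} (c : Fin k → M) (a : Fin r → M) (b : Fin n → M) :
    Fin k ⊕ Fin r ⊕ Fin n → M :=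
  Sum.elim c (Sum.elim a b)

/-- Formulas `φ(x̄, ū, v̄)` of `L`, with `k`, `r` and `n` free variables in the three blocks. -/
abbrev Fml (L : FirstOrder.Language.{u, v}) (k r n : ℕ) := L.Formula (Fin k ⊕ Fin r ⊕ Fin n)

variable {M : Type w} [L.Structure M] {m : ℕ}

/-- `ā''`, `b̄''` answer the formula `ψ`: they satisfy `ψ(c̄, ū, v̄)`, and `R` restricted to
`c̄ ā'' b̄''` is the same as `R` restricted to `c̄ ā b̄`. -/
def Returns (R : Set (Fin m → M)) {k r n : ℕ} (c : Fin k → M) (a : Fin r → M) (b : Fin n → M)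
    (ψ : Fml L k r n) (a'' : Fin r → M) (b'' : Fin n → M) : Prop :=
  ψ.Realize (join₃ c a'' b'') ∧ SameOn R (join₃ c a'' b'') (join₃ c a b)

/-- `ā'`, `b̄'` answer the formula `φ`: they satisfy `φ(c̄, ū, v̄)`, `R` restricted to `c̄ ā'` is
not the same as `R` restricted to `c̄ ā`, and every existential formula `ψ(c̄, ū, v̄)` true of
`ā'`, `b̄'` has an answer `ā''`, `b̄''`. -/
def Moves (R : Set (Fin m → M)) {k r n : ℕ} (c : Fin k → M) (a : Fin r → M) (b : Fin n → M)
    (φ : Fml L k r n) (a' : Fin r → M) (b' : Fin n → M) : Prop :=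
  φ.Realize (join₃ c a' b') ∧ ¬ SameOn R (join₂ c a') (join₂ c a) ∧
    ∀ ψ : Fml L k r n, ψ.IsExistential → ψ.Realize (join₃ c a' b') →
      ∃ (a'' : Fin r → M) (b'' : Fin n → M), Returns R c a b ψ a'' b''

/-- The tuple `ā` is d-free (difference-free) over the tuple `c̄`. -/
def DFree (L : FirstOrder.Language.{u, v}) {M : Type w} [L.Structure M] {m : ℕ}
    (R : Set (Fin m → M)) {k r : ℕ} (c : Fin k → M) (a : Fin r → M) : Prop :=
  ∀ (n : ℕ) (b : Fin n → M) (φ : Fml L k r n), φ.IsExistential → φ.Realize (join₃ c a b) →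
    ∃ (a' : Fin r → M) (b' : Fin n → M), Moves R c a b φ a' b'

variable [Primcodable (Σ n, L.Functions n)] [Primcodable (Σ n, L.Relations n)]

/-- The Gödel number of a formula: the code of the list of its symbols. -/
def goedel {k r n : ℕ} (φ : Fml L k r n) : ℕ := Encodable.encode φ.listEncode

/-- Given `c̄` one can effectively find a tuple `ā` which is d-free over `c̄`; moreover, given also
`b̄` and an existential `φ` true of `ā`, `b̄`, one can effectively find `ā'`, `b̄'` as in the
definition of d-freeness, and, given furthermore an existential `ψ` true of `ā'`, `b̄'`, one can
effectively find `ā''` as in the definition. Tuples are given as lists and formulas by their Gödel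
numbers. The last two procedures are partial computable, and nothing is required of them on inputs
that do not meet these conditions. -/
def EffectivelyDFree (L : FirstOrder.Language.{u, v})
    [Primcodable (Σ n, L.Functions n)] [Primcodable (Σ n, L.Relations n)]
    [L.Structure ℕ] {m : ℕ} (R : Set (Fin m → ℕ)) : Prop :=
  ∃ (findA : List ℕ → List ℕ)
    (findMove : List ℕ × List ℕ × ℕ →. List ℕ × List ℕ)
    (findReturn : List ℕ × List ℕ × ℕ × ℕ →. List ℕ),
    Computable findA ∧ Partrec findMove ∧ Partrec findReturn ∧
    ∀ (k : ℕ) (c : Fin k → ℕ), ∃ (r : ℕ) (a : Fin r → ℕ),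
      findA (List.ofFn c) = List.ofFn a ∧ DFree L R c a ∧
      ∀ (n : ℕ) (b : Fin n → ℕ) (φ : Fml L k r n), φ.IsExistential →
        φ.Realize (join₃ c a b) →
        ∃ (a' : Fin r → ℕ) (b' : Fin n → ℕ),
          (List.ofFn a', List.ofFn b') ∈ findMove (List.ofFn c, List.ofFn b, goedel φ) ∧
          Moves R c a b φ a' b' ∧
          ∀ ψ : Fml L k r n, ψ.IsExistential → ψ.Realize (join₃ c a' b') →
            ∃ (a'' : Fin r → ℕ) (b'' : Fin n → ℕ),
              List.ofFn a'' ∈ findReturn (List.ofFn c, List.ofFn b, goedel φ, goedel ψ) ∧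
              Returns R c a b ψ a'' b''

end DFree

end DegreeSpectra

/-!
A copy of the structure is built by finite approximations. At each stage there is a list `x` of
distinct elements of `A`, read as a finite partial isomorphism from the copy, whose domain is `ℕ`.
The list may change, but only so that the atomic facts about positions with numbers below the stage
keep their truth values (`Strategy.fact_state_succ`). If the lists converge to a bijection, the
copy is therefore computable (`System.Presents.structureComputableIn`), while the relation `R` on
it is known only in the limit.

D-freeness supplies the changes. Let `c̄` be the first `k` entries of the list, let `b̄` be the
others, and let `ā` be the d-free tuple over `c̄`, whose entries occur in the list. Apply d-freeness
to the quantifier-free formula that describes the equality type of `c̄ b̄ ā` and the first `s` facts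
(`diagramFormula`). Replacing `b̄` by the resulting `b̄'` (`IsMove`, `System.move`) preserves the
facts and changes `R` on the part of the list that contains `ā`. At any later time, all that has
been decided meanwhile is an existential formula true of `ā'`, `b̄'`, so the change of `R` can be
undone without injury to the facts (`Moves.exists_return`).

Requirements are met by finite injury. Requirement `i` is given the number of initial entries that
it must respect, and a d-free tuple over these; whenever it acts, the later requirements start
again. As each requirement acts only finitely often between injuries, the lists converge and every
requirement reaches a final state (`Strategy.exists_limit`).

- Coding (`System.exists_coding`): for `W` c.e. in `C`, requirement `i` changes `R` for good when
  `i` enters `W`. From `W` and `C` one knows when the initial parts of the list are final; from `R`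
  and `C` one recognizes a stage at which the parts owned by the first requirements have their final
  bits, and after it none of these requirements acts.
- Avoidance (`System.exists_avoiding`): for an index of a set `W` and two functionals, the
  requirement waits until the functionals seem to compute `R` from `W` and `W` from `R`, on a part
  large enough for a bit of `R` that it can change and for the uses. It changes this bit, and `W`
  must respond by a new element below the use. Then it undoes the change. Now `R` has its old values
  and computes the old initial segment of `W`, but a c.e. set never returns to an earlier initial
  segment (`pre_wSet_ne`).

Functionals are handled through the use principle (`exists_index`): a function recursive in `X` is
given by a partial recursive function applied to the initial segments of `X`.

For an effectively d-free relation the moves are computable, because the Gödel numbers of the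
diagram formulas are (`goedel_diagramFormula`, `EffectivelyDFree.exists_move`), and avoidance with
the oracle `∅` gives a computable copy without c.e. degree. In general the structure is infinite
(`infinite_of_dFree`), so it may be taken to have domain `ℕ`. Above an oracle that encodes the
structure, the relation, the d-free tuples and the moves (`onCone_system`), coding realizes every
degree that is c.e. in the oracle, and avoidance shows the inclusion to be strict.
-/

namespace DegreeSpectra

open FirstOrder Computability Encodable Filter

/-! ### Relative computability of total functions -/

section RelativeComputability

variable {α β γ δ σ : Type*} [Primcodable α] [Primcodable β] [Primcodable γ] [Primcodable δ]
  [Primcodable σ]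
variable {O : Set (ℕ →. ℕ)}

attribute [fun_prop] ComputableIn

theorem computableIn_iff_nat {f : α → β} :
    ComputableIn O f ↔
      Nat.RecursiveIn O fun n =>
        Part.bind (decode (α := α) n) fun a => Part.some (encode (f a)) := by
  simp [ComputableIn, RecursiveIn]

theorem recursiveIn_comp {f : β →. σ} {g : α → β} (hf : RecursiveIn O f)
    (hg : ComputableIn O g) : RecursiveIn O fun a => f (g a) := by
  rw [computableIn_iff_nat] at hg
  refine (Nat.RecursiveIn.comp hf hg).of_eq fun n => ?_
  cases decode (α := α) n <;> simp

@[fun_prop]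
theorem computableIn_comp {f : β → σ} {g : α → β} (hf : ComputableIn O f)
    (hg : ComputableIn O g) : ComputableIn O fun a => f (g a) :=
  recursiveIn_comp (f := fun b => Part.some (f b)) hf hg

@[fun_prop]
theorem computableIn_id : ComputableIn O fun a : α => a := ComputableIn.id

@[fun_prop]
theorem computableIn_const (s : σ) : ComputableIn O fun _ : α => s := ComputableIn.const s

@[fun_prop]
theorem computableIn_fst : ComputableIn O (Prod.fst : α × β → α) := ComputableIn.fst

@[fun_prop]
theorem computableIn_snd : ComputableIn O (Prod.snd : α × β → β) := ComputableIn.snd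

@[fun_prop]
theorem computableIn_pair {f : α → β} {g : α → γ} (hf : ComputableIn O f)
    (hg : ComputableIn O g) : ComputableIn O fun a => (f a, g a) := by
  rw [computableIn_iff_nat] at *
  refine (Nat.RecursiveIn.pair hf hg).of_eq fun n => ?_
  cases decode (α := α) n <;> simp [Seq.seq]

theorem computableIn_of_primrec₂ {f : α → β → σ} (hf : Primrec₂ f)
    {g : δ → α} {h : δ → β} (hg : ComputableIn O g) (hh : ComputableIn O h) :
    ComputableIn O fun d => f (g d) (h d) :=
  computableIn_comp (f := fun p : α × β => f p.1 p.2) hf.computableIn₂ (computableIn_pair hg hh)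

theorem computableIn_of_primrec {f : α → σ} (hf : Primrec f)
    {g : δ → α} (hg : ComputableIn O g) : ComputableIn O fun d => f (g d) :=
  computableIn_comp hf.computableIn hg

theorem computableIn_nat_rec {f : α → β} {g : α → ℕ → β → β} {n : α → ℕ} (hf : ComputableIn O f)
    (hg : ComputableIn O fun p : α × ℕ × β => g p.1 p.2.1 p.2.2) (hn : ComputableIn O n) :
    ComputableIn O fun a => Nat.rec (motive := fun _ => β) (f a) (g a) (n a) := by
  rw [computableIn_iff_nat] at *
  have h0 : Nat.RecursiveIn O fun n : ℕ => Part.some n := by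
    simpa [computableIn_iff_nat] using (computableIn_id (O := O) (α := ℕ))
  refine ((Nat.RecursiveIn.prec hf hg).comp (Nat.RecursiveIn.pair h0 hn)).of_eq fun m => ?_
  rcases hm : decode (α := α) m with _ | a
  · simp [Seq.seq]
  · simp only [Seq.seq, hm, Part.coe_some, Part.bind_some, Part.map_eq_map, Part.map_some,
      Part.bind_eq_bind, Nat.unpair_pair]
    rw [show encode (n a) = n a from rfl]
    induction n a with
    | zero => simp [hm]
    | succ k ih =>
      simp only at ih ⊢
      rw [ih]
      simp [hm]

theorem computableIn_of_rfind {p : α → ℕ → Bool} {f : α → ℕ}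
    (hp : ComputableIn O fun q : α × ℕ => p q.1 q.2) (h : ∀ a, p a (f a) = true)
    (h' : ∀ a, ∀ m < f a, p a m = false) : ComputableIn O f := by
  have hp' : ComputableIn O fun q : α × ℕ => bif p q.1 q.2 then 0 else 1 :=
    computableIn_of_primrec (f := fun b : Bool => bif b then 0 else 1) (Primrec.dom_bool _) hp
  rw [computableIn_iff_nat] at *
  have hs : Nat.RecursiveIn O fun n =>
      (decode (α := α) n : Part α).bind fun a => Part.some (encode a) :=
    computableIn_iff_nat.1 computableIn_id
  refine ((Nat.RecursiveIn.rfind hp').comp hs).of_eq fun n => ?_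
  rcases hn : decode (α := α) n with _ | a
  · simp
  · simp only [Part.coe_some, Part.bind_some, Part.bind_eq_bind]
    refine Part.eq_some_iff.2 (Nat.mem_rfind.2 ⟨?_, fun {m} hm => ?_⟩)
    · simp [h]
    · simp [h' a m hm]

/-! Predicates decided by a function computable from the oracles. -/

/-- The predicate `P` is decidable relative to the oracles in `O`. -/
def DecidableIn (O : Set (ℕ →. ℕ)) (P : α → Prop) : Prop :=
  ∃ b : α → Bool, ComputableIn O b ∧ ∀ a, P a ↔ b a = true

theorem DecidableIn.of_iff {P Q : α → Prop} (hP : DecidableIn O P) (h : ∀ a, Q a ↔ P a) :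
    DecidableIn O Q :=
  let ⟨b, hb, hb'⟩ := hP
  ⟨b, hb, fun a => (h a).trans (hb' a)⟩

theorem DecidableIn.comp {P : β → Prop} {f : α → β} (hP : DecidableIn O P)
    (hf : ComputableIn O f) : DecidableIn O fun a => P (f a) :=
  let ⟨b, hb, hb'⟩ := hP
  ⟨fun a => b (f a), by fun_prop, fun a => hb' (f a)⟩

theorem DecidableIn.decide {P : α → Prop} [DecidablePred P] (hP : DecidableIn O P) :
    ComputableIn O fun a => decide (P a) := by
  obtain ⟨b, hb, hb'⟩ := hP
  convert hb using 2 with a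
  simp [hb']

theorem decidableIn_eq_true {f : α → Bool} (hf : ComputableIn O f) :
    DecidableIn O fun a => f a = true := ⟨f, hf, fun _ => Iff.rfl⟩

theorem DecidableIn.of_decide {P : α → Prop} [DecidablePred P]
    (h : ComputableIn O fun a => Decidable.decide (P a)) : DecidableIn O P :=
  ⟨_, h, fun a => by simp⟩

theorem DecidableIn.and {P Q : α → Prop} (hP : DecidableIn O P) (hQ : DecidableIn O Q) :
    DecidableIn O fun a => P a ∧ Q a :=
  let ⟨b, hb, hb'⟩ := hP
  let ⟨c, hc, hc'⟩ := hQ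
  ⟨fun a => b a && c a, computableIn_of_primrec₂ Primrec.and hb hc, fun a => by simp [hb', hc']⟩

theorem DecidableIn.or {P Q : α → Prop} (hP : DecidableIn O P) (hQ : DecidableIn O Q) :
    DecidableIn O fun a => P a ∨ Q a :=
  let ⟨b, hb, hb'⟩ := hP
  let ⟨c, hc, hc'⟩ := hQ
  ⟨fun a => b a || c a, computableIn_of_primrec₂ Primrec.or hb hc, fun a => by simp [hb', hc']⟩

theorem DecidableIn.not {P : α → Prop} (hP : DecidableIn O P) : DecidableIn O fun a => ¬ P a :=
  let ⟨b, hb, hb'⟩ := hP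
  ⟨fun a => !b a, computableIn_of_primrec Primrec.not hb, fun a => by simp [hb']⟩

theorem DecidableIn.imp {P Q : α → Prop} (hP : DecidableIn O P) (hQ : DecidableIn O Q) :
    DecidableIn O fun a => P a → Q a :=
  (hP.not.or hQ).of_iff fun _ => imp_iff_not_or

theorem decidableIn_eq {f g : α → β} (hf : ComputableIn O f) (hg : ComputableIn O g) :
    DecidableIn O fun a => f a = g a := by
  classical
  exact ⟨fun a => Decidable.decide (f a = g a),
    computableIn_of_primrec₂ (Primrec.eq (α := β)).decide hf hg, by simp⟩

theorem decidableIn_lt {f g : α → ℕ} (hf : ComputableIn O f) (hg : ComputableIn O g) :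
    DecidableIn O fun a => f a < g a :=
  ⟨fun a => Decidable.decide (f a < g a), computableIn_of_primrec₂ Primrec.nat_lt.decide hf hg,
    by simp⟩

theorem decidableIn_le {f g : α → ℕ} (hf : ComputableIn O f) (hg : ComputableIn O g) :
    DecidableIn O fun a => f a ≤ g a :=
  ⟨fun a => Decidable.decide (f a ≤ g a), computableIn_of_primrec₂ Primrec.nat_le.decide hf hg,
    by simp⟩

@[fun_prop]
theorem computableIn_cond {c : α → Bool} {f g : α → β} (hc : ComputableIn O c)
    (hf : ComputableIn O f) (hg : ComputableIn O g) :
    ComputableIn O fun a => bif c a then f a else g a :=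
  computableIn_comp (f := fun p : Bool × β × β => bif p.1 then p.2.1 else p.2.2)
    (Primrec.cond Primrec.fst (Primrec.fst.comp Primrec.snd)
      (Primrec.snd.comp Primrec.snd)).computableIn (computableIn_pair hc (computableIn_pair hf hg))

theorem computableIn_ite {P : α → Prop} [∀ a, Decidable (P a)] {f g : α → β}
    (hP : DecidableIn O P) (hf : ComputableIn O f) (hg : ComputableIn O g) :
    ComputableIn O fun a => if P a then f a else g a := by
  obtain ⟨b, hb, hb'⟩ := hP
  convert computableIn_cond hb hf hg using 2 with a
  by_cases h : P a
  · simp [h, (hb' a).1 h]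
  · have : b a = false := by simpa [hb'] using h
    simp [h, this]

theorem DecidableIn.exists_lt {P : α → ℕ → Prop} {f : α → ℕ}
    (hP : DecidableIn O fun p : α × ℕ => P p.1 p.2) (hf : ComputableIn O f) :
    DecidableIn O fun a => ∃ n < f a, P a n := by
  obtain ⟨b, hb, hb'⟩ := hP
  refine ⟨fun a => Nat.rec (motive := fun _ => Bool) false (fun n r => r || b (a, n)) (f a), ?_, ?_⟩
  · exact computableIn_nat_rec (g := fun a n r => r || b (a, n)) (computableIn_const _)
      (computableIn_of_primrec₂ Primrec.or (by fun_prop) (by fun_prop)) hf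
  · intro a
    have key : ∀ k, (∃ n < k, P a n) ↔
        Nat.rec (motive := fun _ => Bool) false (fun n r => r || b (a, n)) k = true := by
      intro k
      induction k with
      | zero => simp
      | succ k ih =>
        simp only [Bool.or_eq_true, ← ih, ← hb' (a, k), Nat.lt_succ_iff_lt_or_eq, or_and_right,
          exists_or, exists_eq_left]
    exact key _

theorem DecidableIn.forall_lt {P : α → ℕ → Prop} {f : α → ℕ}
    (hP : DecidableIn O fun p : α × ℕ => P p.1 p.2) (hf : ComputableIn O f) :
    DecidableIn O fun a => ∀ n < f a, P a n :=
  (DecidableIn.exists_lt (P := fun a n => ¬ P a n) hP.not hf).not.of_iff fun a => by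
    push Not; rfl

/-- Unbounded search: a total function returning the least solution of a decidable predicate. -/
theorem DecidableIn.find {P : α → ℕ → Prop} [∀ a n, Decidable (P a n)]
    (hP : DecidableIn O fun p : α × ℕ => P p.1 p.2) (h : ∀ a, ∃ n, P a n) :
    ComputableIn O fun a => Nat.find (h a) := by
  obtain ⟨b, hb, hb'⟩ := hP
  refine computableIn_of_rfind (p := fun a n => b (a, n)) hb (fun a => ?_) fun a m hm => ?_
  · exact (hb' (a, _)).1 (Nat.find_spec (h a))
  · exact Bool.eq_false_iff.2 fun hc => Nat.find_min (h a) hm ((hb' (a, m)).2 hc)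

/-- Uniform search: a decidable relation, total on the inputs that pass a decidable test, has a
selector computable from the same oracles. -/
theorem DecidableIn.exists_selector [Inhabited β] {G : α → Prop} {P : α → β → Prop}
    (hG : DecidableIn O G) (hP : DecidableIn O fun p : α × β => P p.1 p.2)
    (h : ∀ a, G a → ∃ b, P a b) :
    ∃ f : α → β, ComputableIn O f ∧ ∀ a, G a → P a (f a) := by
  classical
  let Q : α → ℕ → Prop := fun a n => G a → ∃ b, decode (α := β) n = some b ∧ P a b
  have hQ : DecidableIn O fun p : α × ℕ => Q p.1 p.2 := by
    refine (hG.comp computableIn_fst).imp ?_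
    refine (((decidableIn_eq (f := fun p : α × ℕ => (decode (α := β) p.2).isSome)
      (computableIn_of_primrec (Primrec.option_isSome.comp Primrec.decode) computableIn_snd)
      (computableIn_const true)).and
      (hP.comp (f := fun p : α × ℕ => (p.1, (decode (α := β) p.2).getD default))
      (computableIn_pair computableIn_fst
        (computableIn_of_primrec (Primrec.option_getD_default.comp Primrec.decode)
          computableIn_snd)))).of_iff ?_)
    intro p
    cases decode (α := β) p.2 <;> simp
  have hex : ∀ a, ∃ n, Q a n := fun a => by
    by_cases hg : G a
    · obtain ⟨b, hb⟩ := h a hg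
      exact ⟨encode b, fun _ => ⟨b, by simp, hb⟩⟩
    · exact ⟨0, fun h => absurd h hg⟩
  refine ⟨fun a => (decode (α := β) (Nat.find (hex a))).getD default,
    computableIn_of_primrec (Primrec.option_getD_default.comp Primrec.decode) (hQ.find hex), ?_⟩
  intro a hg
  obtain ⟨b, hb, hb'⟩ := Nat.find_spec (hex a) hg
  simpa only [hb, Option.getD_some] using hb'

/-! Instances of closure under composition with primitive recursive functions. -/

@[fun_prop]
theorem computableIn_listLength {f : α → List β} (hf : ComputableIn O f) :
    ComputableIn O fun a => (f a).length := computableIn_of_primrec Primrec.list_length hf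

@[fun_prop]
theorem computableIn_append {f g : α → List β} (hf : ComputableIn O f) (hg : ComputableIn O g) :
    ComputableIn O fun a => f a ++ g a := computableIn_of_primrec₂ Primrec.list_append hf hg

@[fun_prop]
theorem computableIn_cons {f : α → β} {g : α → List β} (hf : ComputableIn O f)
    (hg : ComputableIn O g) :
    ComputableIn O fun a => f a :: g a := computableIn_of_primrec₂ Primrec.list_cons hf hg

@[fun_prop]
theorem computableIn_take {f : α → ℕ} {g : α → List β} (hf : ComputableIn O f)
    (hg : ComputableIn O g) :
    ComputableIn O fun a => (g a).take (f a) := computableIn_of_primrec₂ Primrec.list_take hf hg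

@[fun_prop]
theorem computableIn_drop {f : α → ℕ} {g : α → List β} (hf : ComputableIn O f)
    (hg : ComputableIn O g) :
    ComputableIn O fun a => (g a).drop (f a) := computableIn_of_primrec₂ Primrec.list_drop hf hg

@[fun_prop]
theorem computableIn_getElem? {f : α → ℕ} {g : α → List β} (hf : ComputableIn O f)
    (hg : ComputableIn O g) :
    ComputableIn O fun a => (g a)[f a]? := computableIn_of_primrec₂ Primrec.list_getElem? hg hf

@[fun_prop]
theorem computableIn_some {f : α → β} (hf : ComputableIn O f) :
    ComputableIn O fun a => some (f a) := computableIn_of_primrec Primrec.option_some hf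

@[fun_prop]
theorem computableIn_isSome {f : α → Option β} (hf : ComputableIn O f) :
    ComputableIn O fun a => (f a).isSome := computableIn_of_primrec Primrec.option_isSome hf

@[fun_prop]
theorem computableIn_getD {f : α → Option β} {g : α → β} (hf : ComputableIn O f)
    (hg : ComputableIn O g) :
    ComputableIn O fun a => (f a).getD (g a) := computableIn_of_primrec₂ Primrec.option_getD hf hg

@[fun_prop]
theorem computableIn_encode {f : α → β} (hf : ComputableIn O f) :
    ComputableIn O fun a => encode (f a) := computableIn_of_primrec Primrec.encode hf

@[fun_prop]
theorem computableIn_natPair {f g : α → ℕ} (hf : ComputableIn O f) (hg : ComputableIn O g) :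
    ComputableIn O fun a => Nat.pair (f a) (g a) := computableIn_of_primrec₂ Primrec₂.natPair hf hg

@[fun_prop]
theorem computableIn_unpair {f : α → ℕ} (hf : ComputableIn O f) :
    ComputableIn O fun a => Nat.unpair (f a) := computableIn_of_primrec Primrec.unpair hf

@[fun_prop]
theorem computableIn_add {f g : α → ℕ} (hf : ComputableIn O f) (hg : ComputableIn O g) :
    ComputableIn O fun a => f a + g a := computableIn_of_primrec₂ Primrec.nat_add hf hg

@[fun_prop]
theorem computableIn_sub {f g : α → ℕ} (hf : ComputableIn O f) (hg : ComputableIn O g) :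
    ComputableIn O fun a => f a - g a := computableIn_of_primrec₂ Primrec.nat_sub hf hg

@[fun_prop]
theorem computableIn_mul {f g : α → ℕ} (hf : ComputableIn O f) (hg : ComputableIn O g) :
    ComputableIn O fun a => f a * g a := computableIn_of_primrec₂ Primrec.nat_mul hf hg

@[fun_prop]
theorem computableIn_div2 {f : α → ℕ} (hf : ComputableIn O f) :
    ComputableIn O fun a => f a / 2 :=
  computableIn_of_primrec₂ Primrec.nat_div hf (computableIn_const 2)

@[fun_prop]
theorem computableIn_mod2 {f : α → ℕ} (hf : ComputableIn O f) :
    ComputableIn O fun a => f a % 2 :=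
  computableIn_of_primrec₂ Primrec.nat_mod hf (computableIn_const 2)

theorem computableIn_optionElim {o : α → Option β} {f : α → σ} {g : α → β → σ}
    (ho : ComputableIn O o) (hf : ComputableIn O f)
    (hg : ComputableIn O fun p : α × β => g p.1 p.2) :
    ComputableIn O fun a => (o a).elim (f a) (g a) := by
  by_cases hβ : Nonempty β
  · obtain ⟨b₀⟩ := hβ
    have : (fun a => (o a).elim (f a) (g a)) =
        fun a => bif (o a).isSome then g a ((o a).getD b₀) else f a := by
      funext a
      cases o a <;> simp
    rw [this]
    have h2 : ComputableIn O fun a => g a ((o a).getD b₀) :=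
      computableIn_comp (f := fun p : α × β => g p.1 p.2) (g := fun a => (a, (o a).getD b₀)) hg
        (by fun_prop)
    fun_prop
  · have : (fun a => (o a).elim (f a) (g a)) = f := by
      funext a
      cases h : o a with
      | none => rfl
      | some b => exact absurd ⟨b⟩ hβ
    rwa [this]

theorem computableIn_listMap {f : α → List β} {g : α → β → γ} (hf : ComputableIn O f)
    (hg : ComputableIn O fun p : α × β => g p.1 p.2) :
    ComputableIn O fun a => (f a).map (g a) := by
  have key : ComputableIn O fun a => Nat.rec (motive := fun _ => List γ) []
      (fun n r => r ++ (((f a)[n]?).elim [] fun b => [g a b])) (f a).length := by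
    refine computableIn_nat_rec (g := fun a n r => r ++ (((f a)[n]?).elim [] fun b => [g a b]))
      (computableIn_const _) (computableIn_append (by fun_prop) ?_) (by fun_prop)
    have h2 : ComputableIn O fun q : (α × ℕ × List γ) × β => g q.1.1 q.2 :=
      computableIn_comp (f := fun p : α × β => g p.1 p.2)
        (g := fun q : (α × ℕ × List γ) × β => (q.1.1, q.2)) hg (by fun_prop)
    exact computableIn_optionElim (g := fun (p : α × ℕ × List γ) b => [g p.1 b])
      (by fun_prop) (computableIn_const _) (by fun_prop)
  convert key using 2 with a
  have aux : ∀ n, Nat.rec (motive := fun _ => List γ) []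
      (fun n r => r ++ (((f a)[n]?).elim [] fun b => [g a b])) n =
        ((f a).take n).map (g a) := by
    intro n
    induction n with
    | zero => simp
    | succ n ih => simp only [ih, List.take_add_one, List.map_append]; cases (f a)[n]? <;> simp
  rw [aux, List.take_length]

@[fun_prop]
theorem computableIn_range {f : α → ℕ} (hf : ComputableIn O f) :
    ComputableIn O fun a => List.range (f a) := computableIn_of_primrec Primrec.list_range hf

theorem DecidableIn.listMem {f : α → β} {g : α → List β} (hf : ComputableIn O f)
    (hg : ComputableIn O g) : DecidableIn O fun a => f a ∈ g a := by
  refine (DecidableIn.exists_lt (P := fun a n => (g a)[n]? = some (f a))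
    (f := fun a => (g a).length)
    (decidableIn_eq (by fun_prop) (by fun_prop)) (by fun_prop)).of_iff fun a => ?_
  rw [List.mem_iff_getElem?]
  exact ⟨fun ⟨n, hn⟩ => ⟨n, (List.getElem?_eq_some_iff.1 hn).1, hn⟩, fun ⟨n, _, hn⟩ => ⟨n, hn⟩⟩

theorem DecidableIn.listForall {P : α → β → Prop} {g : α → List β}
    (hP : DecidableIn O fun p : α × β => P p.1 p.2) (hg : ComputableIn O g) :
    DecidableIn O fun a => ∀ b ∈ g a, P a b := by
  classical
  refine (decidableIn_eq (f := fun a => (g a).map fun b => Decidable.decide (P a b))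
    (g := fun a => (g a).map fun _ => true) (computableIn_listMap hg hP.decide)
    (computableIn_listMap hg (computableIn_const _))).of_iff fun a => ?_
  simp only [List.map_inj_left, decide_eq_true_eq]

end RelativeComputability

/-! ### The use principle -/

section Use

open Classical in
/-- The characteristic function of a set, as a total function. -/
noncomputable def chi (X : Set ℕ) (n : ℕ) : ℕ := if n ∈ X then 1 else 0

theorem charFn_eq (X : Set ℕ) : charFn X = fun n => Part.some (chi X n) := rfl

theorem chi_eq_one {X : Set ℕ} {n : ℕ} : chi X n = 1 ↔ n ∈ X := by
  unfold chi; split_ifs <;> simp_all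

theorem chi_eq_chi {X Y : Set ℕ} {n m : ℕ} : chi X n = chi Y m ↔ (n ∈ X ↔ m ∈ Y) := by
  unfold chi; split_ifs <;> simp_all

/-- The first `n` bits of the characteristic function of `X`. -/
noncomputable def pre (X : Set ℕ) (n : ℕ) : List ℕ := (List.range n).map (chi X)

theorem pre_getElem? (X : Set ℕ) (n i : ℕ) :
    (pre X n)[i]? = if i < n then some (chi X i) else none := by
  unfold pre
  split_ifs with h <;> simp [h]

theorem pre_congr {X Y : Set ℕ} {n : ℕ} (h : ∀ i < n, (i ∈ X ↔ i ∈ Y)) : pre X n = pre Y n := by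
  unfold pre
  refine List.map_congr_left fun i hi => ?_
  exact chi_eq_chi.2 (h i (List.mem_range.1 hi))

theorem mem_iff_of_pre_eq {X Y : Set ℕ} {n : ℕ} (h : pre X n = pre Y n) {i : ℕ} (hi : i < n) :
    i ∈ X ↔ i ∈ Y := by
  have := congrArg (·[i]?) h
  simpa only [pre_getElem?, if_pos hi, Option.some.injEq, chi_eq_chi] using this

/-- The functional `F`, which has only a finite part of its oracle at its disposal, computes `f`
from `X`. -/
def Computes (F : List ℕ × ℕ →. ℕ) (X : Set ℕ) (f : ℕ →. ℕ) : Prop :=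
  (∀ n x y, y ∈ F (pre X n, x) → y ∈ f x) ∧
    ∀ x y, y ∈ f x → ∃ n₀, ∀ n ≥ n₀, y ∈ F (pre X n, x)

theorem computes_of_partrec {X : Set ℕ} {f : ℕ →. ℕ} (hf : Nat.Partrec f) :
    ∃ F, Partrec F ∧ Computes F X f :=
  ⟨fun p => f p.2, (Partrec.nat_iff.2 hf).comp Computable.snd, fun _ _ _ h => h,
    fun _ _ h => ⟨0, fun _ _ => h⟩⟩

/-- A function recursive in `X` is computed from `X` by a partial recursive functional. -/
theorem exists_computes {X : Set ℕ} {f : ℕ →. ℕ} (hf : Nat.RecursiveIn {charFn X} f) :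
    ∃ F : List ℕ × ℕ →. ℕ, Partrec F ∧ Computes F X f := by
  induction hf with
  | zero => exact computes_of_partrec Nat.Partrec.zero
  | succ => exact computes_of_partrec Nat.Partrec.succ
  | left => exact computes_of_partrec Nat.Partrec.left
  | right => exact computes_of_partrec Nat.Partrec.right
  | oracle g hg =>
    obtain rfl : g = charFn X := hg
    refine ⟨fun p => (p.1[p.2]? : Part ℕ),
      Computable.ofOption (Computable.list_getElem?.comp Computable.fst Computable.snd),
      fun n x y h => ?_, fun x y h => ⟨x + 1, fun n hn => ?_⟩⟩
    · simp only [Part.mem_ofOption, pre_getElem?, Option.mem_def] at h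
      split_ifs at h
      rw [charFn_eq]
      simpa using h.symm
    · rw [charFn_eq, Part.mem_some_iff] at h
      simp only [Part.mem_ofOption, pre_getElem?, Option.mem_def]
      rw [if_pos (by omega), h]
  | @pair f h _ _ ihf ihh =>
    obtain ⟨F, hF, hF1, hF2⟩ := ihf
    obtain ⟨H, hH, hH1, hH2⟩ := ihh
    refine ⟨fun p => (F p).bind fun a => (H p).map fun b => Nat.pair a b, ?_, ?_, ?_⟩
    · exact hF.bind (hH.comp Computable.fst |>.map
        ((Primrec₂.natPair.comp (Primrec.snd.comp Primrec.fst) Primrec.snd).to_comp.to₂))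
    · intro n x y hy
      simp only [Part.mem_bind_iff, Part.mem_map_iff] at hy
      obtain ⟨a, ha, b, hb, rfl⟩ := hy
      simp only [Seq.seq, Part.map_eq_map, Part.mem_bind_iff, Part.mem_map_iff]
      exact ⟨_, ⟨a, hF1 _ _ _ ha, rfl⟩, b, hH1 _ _ _ hb, rfl⟩
    · intro x y hy
      simp only [Seq.seq, Part.map_eq_map, Part.mem_bind_iff, Part.mem_map_iff] at hy
      obtain ⟨_, ⟨a, ha, rfl⟩, b, hb, rfl⟩ := hy
      obtain ⟨n₁, h₁⟩ := hF2 _ _ ha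
      obtain ⟨n₂, h₂⟩ := hH2 _ _ hb
      refine ⟨max n₁ n₂, fun n hn => ?_⟩
      simp only [Part.mem_bind_iff, Part.mem_map_iff]
      exact ⟨a, h₁ n (le_of_max_le_left hn), b, h₂ n (le_of_max_le_right hn), rfl⟩
  | @comp f h _ _ ihf ihh =>
    obtain ⟨F, hF, hF1, hF2⟩ := ihf
    obtain ⟨H, hH, hH1, hH2⟩ := ihh
    refine ⟨fun p => (H p).bind fun b => F (p.1, b), ?_, ?_, ?_⟩
    · exact hH.bind (hF.comp ((Computable.fst.comp Computable.fst).pair Computable.snd))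
    · intro n x y hy
      simp only [Part.mem_bind_iff] at hy
      obtain ⟨b, hb, ha⟩ := hy
      exact Part.mem_bind_iff.2 ⟨b, hH1 _ _ _ hb, hF1 _ _ _ ha⟩
    · intro x y hy
      obtain ⟨b, hb, ha⟩ := Part.mem_bind_iff.1 hy
      obtain ⟨n₁, h₁⟩ := hF2 _ _ ha
      obtain ⟨n₂, h₂⟩ := hH2 _ _ hb
      refine ⟨max n₁ n₂, fun n hn => ?_⟩
      exact Part.mem_bind_iff.2 ⟨b, h₂ n (le_of_max_le_right hn), h₁ n (le_of_max_le_left hn)⟩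
  | @prec f h _ _ ihf ihh =>
    obtain ⟨F, hF, hF1, hF2⟩ := ihf
    obtain ⟨H, hH, hH1, hH2⟩ := ihh
    refine ⟨fun p => Nat.rec (F (p.1, p.2.unpair.1))
      (fun y IH => IH.bind fun i => H (p.1, Nat.pair p.2.unpair.1 (Nat.pair y i))) p.2.unpair.2,
      ?_, ?_, ?_⟩
    · refine Partrec.nat_rec (f := fun p : List ℕ × ℕ => p.2.unpair.2)
        (h := fun p q => H (p.1, Nat.pair p.2.unpair.1 (Nat.pair q.1 q.2))) ?_ ?_ ?_
      · exact (Primrec.snd.comp (Primrec.unpair.comp Primrec.snd)).to_comp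
      · exact hF.comp
          (Primrec.fst.pair (Primrec.fst.comp (Primrec.unpair.comp Primrec.snd))).to_comp
      · refine hH.comp (Primrec.to_comp ?_)
        exact (Primrec.fst.comp Primrec.fst).pair (Primrec₂.natPair.comp
          (Primrec.fst.comp (Primrec.unpair.comp (Primrec.snd.comp Primrec.fst)))
          (Primrec₂.natPair.comp (Primrec.fst.comp Primrec.snd) (Primrec.snd.comp Primrec.snd)))
    · intro n x y hy
      simp only at hy ⊢
      generalize x.unpair.2 = k at hy ⊢
      induction k generalizing y with
      | zero => exact hF1 _ _ _ hy
      | succ k ih =>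
        obtain ⟨i, hi, hy⟩ := Part.mem_bind_iff.1 hy
        exact Part.mem_bind_iff.2 ⟨i, ih _ hi, hH1 _ _ _ hy⟩
    · intro x y hy
      simp only at hy ⊢
      generalize x.unpair.2 = k at hy ⊢
      induction k generalizing y with
      | zero => exact hF2 _ _ hy
      | succ k ih =>
        obtain ⟨i, hi, hy⟩ := Part.mem_bind_iff.1 hy
        obtain ⟨n₁, h₁⟩ := ih _ hi
        obtain ⟨n₂, h₂⟩ := hH2 _ _ hy
        refine ⟨max n₁ n₂, fun n hn => ?_⟩
        exact Part.mem_bind_iff.2 ⟨i, h₁ n (le_of_max_le_left hn), h₂ n (le_of_max_le_right hn)⟩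
  -- The values below the least zero are finitely many, so one length of oracle serves them all.
  | @rfind f _ ih =>
    obtain ⟨F, hF, hF1, hF2⟩ := ih
    refine ⟨fun p => Nat.rfind fun n => (F (p.1, Nat.pair p.2 n)).map fun m => decide (m = 0),
      ?_, ?_, ?_⟩
    · refine Partrec.rfind (p := fun (p : List ℕ × ℕ) n =>
        (F (p.1, Nat.pair p.2 n)).map fun m => decide (m = 0)) ?_
      refine Partrec.map (hF.comp (Primrec.to_comp ?_)) (Primrec.to_comp ?_)
      · exact (Primrec.fst.comp Primrec.fst).pair
          (Primrec₂.natPair.comp (Primrec.snd.comp Primrec.fst) Primrec.snd)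
      · exact Primrec.eq.decide.comp Primrec.snd (Primrec.const 0)
    · intro n x y hy
      obtain ⟨h1, h2⟩ := Nat.mem_rfind.1 hy
      refine Nat.mem_rfind.2 ⟨?_, fun {m} hm => ?_⟩
      · obtain ⟨a, ha, ha'⟩ := (Part.mem_map_iff _).1 h1
        exact (Part.mem_map_iff _).2 ⟨a, hF1 _ _ _ ha, ha'⟩
      · obtain ⟨a, ha, ha'⟩ := (Part.mem_map_iff _).1 (h2 hm)
        exact (Part.mem_map_iff _).2 ⟨a, hF1 _ _ _ ha, ha'⟩
    · intro x y hy
      obtain ⟨h1, h2⟩ := Nat.mem_rfind.1 hy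
      have key : ∀ k b, b ∈ (fun m => decide (m = 0)) <$> f (Nat.pair x k) →
          ∃ n₀, ∀ n ≥ n₀, b ∈ (F (pre X n, Nat.pair x k)).map fun m => decide (m = 0) := by
        intro k b hb
        obtain ⟨a, ha, ha'⟩ := (Part.mem_map_iff _).1 hb
        obtain ⟨n₀, h₀⟩ := hF2 _ _ ha
        exact ⟨n₀, fun n hn => (Part.mem_map_iff _).2 ⟨a, h₀ n hn, ha'⟩⟩
      obtain ⟨n₁, h₁⟩ := key _ _ h1
      have : ∀ m, ∃ n₀, m < y → ∀ n ≥ n₀,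
          false ∈ (F (pre X n, Nat.pair x m)).map fun m => decide (m = 0) := fun m => by
        by_cases hm : m < y
        · obtain ⟨n₀, h₀⟩ := key _ _ (h2 hm)
          exact ⟨n₀, fun _ => h₀⟩
        · exact ⟨0, fun h => absurd h hm⟩
      choose N hN using this
      refine ⟨max n₁ ((Finset.range y).sup N), fun n hn => Nat.mem_rfind.2 ⟨?_, fun {m} hm => ?_⟩⟩
      · exact h₁ n (le_of_max_le_left hn)
      · exact hN m hm n ((Finset.le_sup (f := N) (Finset.mem_range.2 hm)).trans
          (le_of_max_le_right hn))

/-- Bounded evaluation, with `s` steps, of the functional with index `e` at `x`, with the finite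
part `σ` of an oracle. -/
def ev (s e : ℕ) (σ : List ℕ) (x : ℕ) : Option ℕ :=
  Nat.Partrec.Code.evaln s (Denumerable.ofNat Nat.Partrec.Code e) (encode (σ, x))

theorem ev_mono {s t e : ℕ} {σ : List ℕ} {x y : ℕ} (h : s ≤ t) (hy : ev s e σ x = some y) :
    ev t e σ x = some y :=
  Nat.Partrec.Code.evaln_mono h hy

@[fun_prop]
theorem computableIn_ev {α : Type*} [Primcodable α] {O : Set (ℕ →. ℕ)} {s e x : α → ℕ}
    {σ : α → List ℕ} (hs : ComputableIn O s) (he : ComputableIn O e) (hσ : ComputableIn O σ)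
    (hx : ComputableIn O x) : ComputableIn O fun a => ev (s a) (e a) (σ a) (x a) := by
  have h := Nat.Partrec.Code.primrec_evaln
  refine computableIn_of_primrec (f := fun p : (ℕ × Nat.Partrec.Code) × ℕ =>
    Nat.Partrec.Code.evaln p.1.1 p.1.2 p.2) h (g := fun a => ((s a,
      Denumerable.ofNat Nat.Partrec.Code (e a)), encode (σ a, x a))) ?_
  refine computableIn_pair (computableIn_pair hs ?_) (by fun_prop)
  exact computableIn_of_primrec (Primrec.ofNat Nat.Partrec.Code) he

/-- Every function recursive in `X` has an index, correct on every initial segment of `X` and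
convergent on all long ones. -/
theorem exists_index {X : Set ℕ} {f : ℕ →. ℕ} (hf : Nat.RecursiveIn {charFn X} f) :
    ∃ e, (∀ n s x y, ev s e (pre X n) x = some y → y ∈ f x) ∧
      ∀ x y, y ∈ f x → ∃ n₀, ∀ n ≥ n₀, ∃ s₀, ∀ s ≥ s₀, ev s e (pre X n) x = some y := by
  obtain ⟨F, hF, hF1, hF2⟩ := exists_computes hf
  obtain ⟨c, hc⟩ := Nat.Partrec.Code.exists_code.1 hF
  have hc' : ∀ σ x, Nat.Partrec.Code.eval c (encode (σ, x)) = F (σ, x) := fun σ x => by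
    rw [hc]; simp [Part.map_id']
  refine ⟨encode c, fun n s x y h => ?_, fun x y h => ?_⟩
  · rw [ev, Denumerable.ofNat_encode] at h
    have := Nat.Partrec.Code.evaln_sound h
    rw [hc'] at this
    exact hF1 _ _ _ this
  · obtain ⟨n₀, h₀⟩ := hF2 _ _ h
    refine ⟨n₀, fun n hn => ?_⟩
    have := h₀ n hn
    rw [← hc', Nat.Partrec.Code.evaln_complete] at this
    obtain ⟨k, hk⟩ := this
    refine ⟨k, fun s hs => ev_mono hs ?_⟩
    rw [ev, Denumerable.ofNat_encode]
    exact hk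

theorem exists_index_of_setReducible {X Y : Set ℕ} (h : SetReducible Y X) :
    ∃ e, (∀ n s x y, ev s e (pre X n) x = some y → y = chi Y x) ∧
      ∀ x, ∃ n₀, ∀ n ≥ n₀, ∃ s₀, ∀ s ≥ s₀, ev s e (pre X n) x = some (chi Y x) := by
  obtain ⟨e, h1, h2⟩ := exists_index (RecursiveIn.iff_nat.1 h)
  refine ⟨e, fun n s x y hy => ?_, fun x => h2 x _ ?_⟩
  · simpa [charFn_eq] using h1 n s x y hy
  · simp [charFn_eq]

@[fun_prop]
theorem computableIn_chi {α : Type*} [Primcodable α] {C : Set ℕ} {f : α → ℕ}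
    (hf : ComputableIn {charFn C} f) : ComputableIn {charFn C} fun a => chi C (f a) :=
  computableIn_comp (f := chi C) (RecursiveIn.oracle (charFn C) rfl) hf

theorem setReducible_iff {X C : Set ℕ} :
    SetReducible X C ↔ DecidableIn {charFn C} fun n => n ∈ X := by
  constructor
  · intro h
    refine (decidableIn_eq (f := chi X) (g := fun _ => 1) h (computableIn_const _)).of_iff
      fun n => chi_eq_one.symm
  · intro h
    classical
    have := computableIn_ite h (computableIn_const 1) (computableIn_const 0)
    change ComputableIn _ (chi X)
    convert this using 2
    simp only [chi]

/-- The approximation at stage `s` to the set of those `x` at which the functional with index `e`,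
with oracle `C`, converges. -/
def WStage (C : Set ℕ) (e s : ℕ) : Set ℕ := {x | ∃ n < s, (ev s e (pre C n) x).isSome}

/-- The set with index `e` among the sets that are c.e. in `C`. -/
def WSet (C : Set ℕ) (e : ℕ) : Set ℕ := ⋃ s, WStage C e s

theorem wStage_mono {C : Set ℕ} {e s t : ℕ} (h : s ≤ t) : WStage C e s ⊆ WStage C e t := by
  rintro x ⟨n, hn, hx⟩
  obtain ⟨y, hy⟩ := Option.isSome_iff_exists.1 hx
  exact ⟨n, hn.trans_le h, by rw [ev_mono h hy]; rfl⟩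

theorem wStage_subset {C : Set ℕ} {e s : ℕ} : WStage C e s ⊆ WSet C e := Set.subset_iUnion _ s

theorem exists_wSet_eq {C W : Set ℕ} (h : CEIn {charFn C} W) : ∃ e, W = WSet C e := by
  obtain ⟨e, h1, h2⟩ := exists_index h
  refine ⟨e, Set.ext fun x => ?_⟩
  simp only [WSet, Set.mem_iUnion]
  constructor
  · intro hx
    have : (0 : ℕ) ∈ ((decode (α := ℕ) x : Part ℕ).bind fun a =>
        (Part.assert (a ∈ W) fun _ => Part.some ()).map encode) := by
      simp [Part.assert_pos hx]
    obtain ⟨n₀, h₀⟩ := h2 x 0 this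
    obtain ⟨s₀, h₀'⟩ := h₀ n₀ le_rfl
    exact ⟨max s₀ (n₀ + 1), n₀, by omega, by rw [h₀' _ (le_max_left _ _)]; rfl⟩
  · rintro ⟨s, n, _, hx⟩
    obtain ⟨y, hy⟩ := Option.isSome_iff_exists.1 hx
    have := h1 _ _ _ _ hy
    by_contra hx
    simp [Part.assert_neg hx] at this

/-- An initial segment of a c.e. set is eventually enumerated. -/
theorem exists_pre_wStage_eq (C : Set ℕ) (e n : ℕ) :
    ∃ s₀, ∀ s ≥ s₀, pre (WStage C e s) n = pre (WSet C e) n := by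
  have : ∀ i, ∃ s₀, ∀ s ≥ s₀, (i ∈ WStage C e s ↔ i ∈ WSet C e) := fun i => by
    by_cases hi : i ∈ WSet C e
    · obtain ⟨s, hs⟩ := Set.mem_iUnion.1 hi
      exact ⟨s, fun t ht => ⟨fun h => wStage_subset h, fun _ => wStage_mono ht hs⟩⟩
    · exact ⟨0, fun s _ => ⟨fun h => wStage_subset h, fun h => absurd h hi⟩⟩
  choose N hN using this
  refine ⟨(Finset.range n).sup N, fun s hs => pre_congr fun i hi => hN i s ?_⟩
  exact (Finset.le_sup (f := N) (Finset.mem_range.2 hi)).trans hs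

/-- The set enumerated by stage `s` never returns to an initial segment it has left. -/
theorem pre_wSet_ne {C : Set ℕ} {e s t n : ℕ} (hst : s ≤ t)
    (h : pre (WStage C e t) n ≠ pre (WStage C e s) n) :
    pre (WSet C e) n ≠ pre (WStage C e s) n := by
  intro h'
  refine h (pre_congr fun i hi => ⟨fun hx => ?_, fun hx => wStage_mono hst hx⟩)
  exact (mem_iff_of_pre_eq h' hi).1 (wStage_subset hx)

theorem decidableIn_wStage {α : Type*} [Primcodable α] {C : Set ℕ} {e s x : α → ℕ}
    (he : ComputableIn {charFn C} e) (hs : ComputableIn {charFn C} s)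
    (hx : ComputableIn {charFn C} x) :
    DecidableIn {charFn C} fun a => x a ∈ WStage C (e a) (s a) := by
  refine DecidableIn.exists_lt (P := fun a n => (ev (s a) (e a) (pre C n) (x a)).isSome)
    (decidableIn_eq_true (computableIn_isSome ?_)) hs
  have : ComputableIn {charFn C} fun p : α × ℕ => pre C p.2 :=
    computableIn_listMap (g := fun _ => chi C) (by fun_prop) (by fun_prop)
  fun_prop

@[fun_prop]
theorem computableIn_pre_wStage {α : Type*} [Primcodable α] {C : Set ℕ} {e s n : α → ℕ}
    (he : ComputableIn {charFn C} e) (hs : ComputableIn {charFn C} s)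
    (hn : ComputableIn {charFn C} n) :
    ComputableIn {charFn C} fun a => pre (WStage C (e a) (s a)) (n a) := by
  classical
  refine computableIn_listMap (g := fun a => chi (WStage C (e a) (s a))) (by fun_prop) ?_
  have := computableIn_ite (decidableIn_wStage (C := C) (e := fun p : α × ℕ => e p.1)
    (s := fun p => s p.1) (x := fun p => p.2) (by fun_prop) (by fun_prop) (by fun_prop))
    (computableIn_const 1) (computableIn_const 0)
  convert this using 2
  simp only [chi]

end Use

/-! ### Finite injury constructions -/

section Construction

/-- Append to `x` the entries of `l` that are not yet in it. -/
def addNew (x l : List ℕ) : List ℕ := l.foldl (fun x a => if a ∈ x then x else x ++ [a]) x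

theorem exists_addNew_eq (x l : List ℕ) : ∃ w, addNew x l = x ++ w := by
  induction l generalizing x with
  | nil => exact ⟨[], by simp [addNew]⟩
  | cons a l ih =>
    by_cases h : a ∈ x
    · simpa [addNew, h] using ih x
    · obtain ⟨w, hw⟩ := ih (x ++ [a])
      exact ⟨a :: w, by simpa [addNew, h] using hw⟩

theorem addNew_nodup {x : List ℕ} (hx : x.Nodup) (l : List ℕ) : (addNew x l).Nodup := by
  induction l generalizing x with
  | nil => simpa [addNew]
  | cons a l ih =>
    by_cases h : a ∈ x
    · simpa [addNew, h] using ih hx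
    · have : (x ++ [a]).Nodup := by
        rw [List.nodup_append]
        refine ⟨hx, by simp, fun b hb c hc => ?_⟩
        rintro rfl
        simp only [List.mem_singleton] at hc
        exact h (hc ▸ hb)
      simpa [addNew, h] using ih this

theorem mem_addNew {x l : List ℕ} {a : ℕ} (h : a ∈ l) : a ∈ addNew x l := by
  induction l generalizing x with
  | nil => simp at h
  | cons b l ih =>
    rcases List.mem_cons.1 h with rfl | h
    · by_cases h : a ∈ x
      · obtain ⟨w, hw⟩ := exists_addNew_eq x l
        simpa [addNew, h] using (show a ∈ addNew x l by rw [hw]; simp [h])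
      · obtain ⟨w, hw⟩ := exists_addNew_eq (x ++ [a]) l
        simpa [addNew, h] using (show a ∈ addNew (x ++ [a]) l by rw [hw]; simp)
    · by_cases hb : b ∈ x
      · simpa [addNew, hb] using ih (x := x) h
      · simpa [addNew, hb] using ih (x := x ++ [b]) h

@[fun_prop]
theorem computableIn_addNew {α : Type*} [Primcodable α] {O : Set (ℕ →. ℕ)} {f g : α → List ℕ}
    (hf : ComputableIn O f) (hg : ComputableIn O g) :
    ComputableIn O fun a => addNew (f a) (g a) := by
  refine computableIn_of_primrec₂ ?_ hf hg
  refine Primrec.list_foldl (f := fun p : List ℕ × List ℕ => p.2) (g := fun p => p.1)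
    (h := fun p q => if q.2 ∈ q.1 then q.1 else q.1 ++ [q.2]) Primrec.snd Primrec.fst ?_
  refine Primrec.ite ?_ (Primrec.fst.comp Primrec.snd)
    (Primrec.list_concat.comp (Primrec.fst.comp Primrec.snd) (Primrec.snd.comp Primrec.snd))
  refine (Primrec.nat_lt.comp (f := fun p : (List ℕ × List ℕ) × List ℕ × ℕ =>
    p.2.1.idxOf p.2.2) (g := fun p => p.2.1.length)
    (Primrec.list_idxOf.comp (Primrec.snd.comp Primrec.snd) (Primrec.fst.comp Primrec.snd))
    (Primrec.list_length.comp (Primrec.fst.comp Primrec.snd))).of_eq fun p => ?_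
  exact List.idxOf_lt_length_iff

/-- What a construction needs to know about a structure `A` on `ℕ` and a relation `R` on it.
A list `x` of distinct numbers stands for a finite partial map from the initial segment of `ℕ` of
that length to `A`. The formula with number `q` speaks of positions in such lists; `fact q x` is its
truth value at `x`, and `rbit q x` the truth value of `R` at the tuple of positions with number `q`;
both are undefined if a position does not occur in `x`. The function `findA` returns d-free tuples
over given tuples, and `move k x s` changes the entries of `x` from position `k` onwards so that
`R` changes, the first `s` facts do not, and the change can be undone at any later time
(`return_move`). A bit that is true at a list of length `N` has a number below `bound N`. -/
structure System (C : Set ℕ) where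
  fact : ℕ → List ℕ → Option Bool
  rbit : ℕ → List ℕ → Option Bool
  bound : ℕ → ℕ
  findA : List ℕ → List ℕ
  move : ℕ → List ℕ → ℕ → List ℕ
  fact_comp : ComputableIn {charFn C} fun p : ℕ × List ℕ => fact p.1 p.2
  rbit_comp : ComputableIn {charFn C} fun p : ℕ × List ℕ => rbit p.1 p.2
  bound_comp : ComputableIn {charFn C} bound
  findA_comp : ComputableIn {charFn C} findA
  move_comp : ComputableIn {charFn C} fun p : ℕ × List ℕ × ℕ => move p.1 p.2.1 p.2.2
  fact_append : ∀ {q x b} w, fact q x = some b → fact q (x ++ w) = some b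
  rbit_append : ∀ {q x b} w, rbit q x = some b → rbit q (x ++ w) = some b
  rbit_isSome : ∀ {q x y}, x.length = y.length → (rbit q x).isSome = (rbit q y).isSome
  rbit_total : ∀ q, ∃ N, ∀ x, N ≤ x.length → (rbit q x).isSome
  rbit_bound : ∀ {q x}, rbit q x = some true → q < bound x.length
  length_move : ∀ {k x s}, x.Nodup → k ≤ x.length → (∀ a ∈ findA (x.take k), a ∈ x) →
    (move k x s).length = x.length
  nodup_move : ∀ {k x s}, x.Nodup → k ≤ x.length → (∀ a ∈ findA (x.take k), a ∈ x) →
    (move k x s).Nodup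
  take_move : ∀ {k x s}, x.Nodup → k ≤ x.length → (∀ a ∈ findA (x.take k), a ∈ x) →
    (move k x s).take k = x.take k
  fact_move : ∀ {k x s}, x.Nodup → k ≤ x.length → (∀ a ∈ findA (x.take k), a ∈ x) →
    ∀ q < s, fact q (move k x s) = fact q x
  rbit_move : ∀ {k x s}, x.Nodup → k ≤ x.length → (∀ a ∈ findA (x.take k), a ∈ x) →
    ∀ l, k ≤ l → l ≤ x.length → (∀ a ∈ findA (x.take k), a ∈ x.take l) →
      ∃ q, rbit q (x.take l) ≠ rbit q ((move k x s).take l)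
  return_move : ∀ {k x s}, x.Nodup → k ≤ x.length → (∀ a ∈ findA (x.take k), a ∈ x) →
    ∀ w t, (move k x s ++ w).Nodup → ∃ y : List ℕ, y.length = (move k x s ++ w).length ∧
      y.Nodup ∧ y.take k = (move k x s ++ w).take k ∧
      (∀ q < t, fact q y = fact q (move k x s ++ w)) ∧ ∀ q, rbit q (y.take x.length) = rbit q x

namespace System

variable {C : Set ℕ} (S : System C)

/-- The list `x` contains the d-free tuple found over its first `k` entries. -/
def Adm (k : ℕ) (x : List ℕ) : Prop :=
  x.Nodup ∧ k ≤ x.length ∧ ∀ a ∈ S.findA (x.take k), a ∈ x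

/-- The list `y` may replace `x` at stage `s` if the first `k` entries are protected. -/
def Eqv (s k : ℕ) (x y : List ℕ) : Prop :=
  y.length = x.length ∧ y.Nodup ∧ y.take k = x.take k ∧ ∀ q < s, S.fact q y = S.fact q x

variable {S}

theorem Adm.eqv_move {k : ℕ} {x : List ℕ} (h : S.Adm k x) (s : ℕ) :
    S.Eqv s k x (S.move k x s) :=
  ⟨S.length_move h.1 h.2.1 h.2.2, S.nodup_move h.1 h.2.1 h.2.2, S.take_move h.1 h.2.1 h.2.2,
    S.fact_move h.1 h.2.1 h.2.2⟩

theorem rbit_of_take {q l : ℕ} {x : List ℕ} {b : Bool} (h : S.rbit q (x.take l) = some b) :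
    S.rbit q x = some b := by
  rw [← List.take_append_drop l x]
  exact S.rbit_append _ h

/-- Different bits of lists of the same length are different truth values. -/
theorem exists_of_rbit_ne {q : ℕ} {x y : List ℕ} (hl : x.length = y.length)
    (h : S.rbit q x ≠ S.rbit q y) : ∃ b, S.rbit q x = some b ∧ S.rbit q y = some (!b) := by
  have := S.rbit_isSome (q := q) hl
  cases hx : S.rbit q x with
  | none => cases hy : S.rbit q y <;> simp_all
  | some b =>
    cases hy : S.rbit q y with
    | none => simp_all
    | some c => cases b <;> cases c <;> simp_all

end System

/-- A strategy for the requirements of a finite injury construction. Requirement `i` owns a record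
`(k, len, d)`: the first `k` entries of the current list are protected from it, the first `len`
entries are protected from the requirements of lower priority, and `d` is its memory. It may act by
replacing the current list and its memory, and the rank of the memory bounds the number of its
further actions. `Inv i k z d` is an invariant of the memory and of the part `z` of the list that
the requirement protects. -/
structure Strategy {C : Set ℕ} (S : System C) (δ : Type) [Primcodable δ] where
  init : δ
  act : ℕ → ℕ → ℕ × ℕ × δ → List ℕ → Option (List ℕ × δ)
  act_comp : ComputableIn {charFn C}
    fun p : ℕ × ℕ × (ℕ × ℕ × δ) × List ℕ => act p.1 p.2.1 p.2.2.1 p.2.2.2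
  rank : δ → ℕ
  Inv : ℕ → ℕ → List ℕ → δ → Prop
  inv_init : ∀ {i k z}, S.Adm k z → Inv i k z init
  act_spec : ∀ {i s k len d x x' d'}, x.Nodup → k ≤ len → len ≤ x.length →
    Inv i k (x.take len) d → act i s (k, len, d) x = some (x', d') →
    S.Eqv s k x x' ∧ rank d' < rank d ∧ Inv i k x' d'

namespace Strategy

variable {C : Set ℕ} {S : System C} {δ : Type} [Primcodable δ] (T : Strategy S δ)

open Classical in
/-- The index of the requirement that acts at stage `s`, or the number of records if none does. -/
noncomputable def actIdx (s : ℕ) (σ : List ℕ × List (ℕ × ℕ × δ)) : ℕ :=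
  Nat.find (p := fun i => ∀ ρ, σ.2[i]? = some ρ → (T.act i s ρ σ.1).isSome)
    ⟨σ.2.length, fun ρ h => by simp at h⟩

/-- The next requirement `i` gets a record: the number `i` enters the part of the list that is
protected from it, which makes the limit surjective, and a d-free tuple over that part is
appended. -/
def extend (σ : List ℕ × List (ℕ × ℕ × δ)) : List ℕ × List (ℕ × ℕ × δ) :=
  (addNew (addNew σ.1 [σ.2.length]) (S.findA (addNew σ.1 [σ.2.length])),
    σ.2 ++ [((addNew σ.1 [σ.2.length]).length,
      (addNew (addNew σ.1 [σ.2.length]) (S.findA (addNew σ.1 [σ.2.length]))).length, T.init)])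

/-- Stage `s` of the construction: the first requirement that wants to act does so, and the records
of all later requirements are deleted; if there is none, a new record is set up. -/
noncomputable def step (s : ℕ) (σ : List ℕ × List (ℕ × ℕ × δ)) : List ℕ × List (ℕ × ℕ × δ) :=
  (σ.2[T.actIdx s σ]?).elim (T.extend σ) fun ρ =>
    (T.act (T.actIdx s σ) s ρ σ.1).elim σ fun r =>
      (r.1, σ.2.take (T.actIdx s σ) ++ [(ρ.1, r.1.length, r.2)])

/-- The state of the construction: the current list and the records. -/
noncomputable def state (s : ℕ) : List ℕ × List (ℕ × ℕ × δ) :=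
  Nat.rec ([], []) (fun s σ => T.step s σ) s

theorem state_succ (s : ℕ) : T.state (s + 1) = T.step s (T.state s) := rfl

@[fun_prop]
theorem computableIn_act {α : Type} [Primcodable α] {i s : α → ℕ} {ρ : α → ℕ × ℕ × δ}
    {x : α → List ℕ} (hi : ComputableIn {charFn C} i) (hs : ComputableIn {charFn C} s)
    (hρ : ComputableIn {charFn C} ρ) (hx : ComputableIn {charFn C} x) :
    ComputableIn {charFn C} fun a => T.act (i a) (s a) (ρ a) (x a) :=
  computableIn_comp (f := fun p : ℕ × ℕ × (ℕ × ℕ × δ) × List ℕ => T.act p.1 p.2.1 p.2.2.1 p.2.2.2)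
    T.act_comp (computableIn_pair hi (computableIn_pair hs (computableIn_pair hρ hx)))

@[fun_prop]
theorem computableIn_actIdx {α : Type} [Primcodable α] {s : α → ℕ}
    {σ : α → List ℕ × List (ℕ × ℕ × δ)} (hs : ComputableIn {charFn C} s)
    (hσ : ComputableIn {charFn C} σ) : ComputableIn {charFn C} fun a => T.actIdx (s a) (σ a) := by
  classical
  have := DecidableIn.find (O := {charFn C}) (α := α)
    (P := fun a i => ∀ ρ, (σ a).2[i]? = some ρ → (T.act i (s a) ρ (σ a).1).isSome) ?_
    (fun a => ⟨(σ a).2.length, fun ρ h => by simp at h⟩)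
  · convert this using 2
    unfold actIdx
    congr
  · refine (decidableIn_eq_true (f := fun p : α × ℕ =>
      ((σ p.1).2[p.2]?).elim true fun ρ => (T.act p.2 (s p.1) ρ (σ p.1).1).isSome) ?_).of_iff ?_
    · exact computableIn_optionElim
        (g := fun (p : α × ℕ) ρ => (T.act p.2 (s p.1) ρ (σ p.1).1).isSome)
        (by fun_prop) (by fun_prop) (by fun_prop)
    · intro p
      cases (σ p.1).2[p.2]? <;> simp

@[fun_prop]
theorem computableIn_extend {α : Type} [Primcodable α] {σ : α → List ℕ × List (ℕ × ℕ × δ)}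
    (hσ : ComputableIn {charFn C} σ) : ComputableIn {charFn C} fun a => T.extend (σ a) := by
  have := S.findA_comp
  unfold extend
  fun_prop

theorem computableIn_step {α : Type} [Primcodable α] {s : α → ℕ}
    {σ : α → List ℕ × List (ℕ × ℕ × δ)} (hs : ComputableIn {charFn C} s)
    (hσ : ComputableIn {charFn C} σ) : ComputableIn {charFn C} fun a => T.step (s a) (σ a) := by
  unfold step
  refine computableIn_optionElim (o := fun a => (σ a).2[T.actIdx (s a) (σ a)]?)
    (f := fun a => T.extend (σ a))
    (g := fun a ρ => (T.act (T.actIdx (s a) (σ a)) (s a) ρ (σ a).1).elim (σ a) fun r =>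
      (r.1, (σ a).2.take (T.actIdx (s a) (σ a)) ++ [(ρ.1, r.1.length, r.2)]))
    (by fun_prop) (by fun_prop) ?_
  refine computableIn_optionElim
    (o := fun p : α × ℕ × ℕ × δ => T.act (T.actIdx (s p.1) (σ p.1)) (s p.1) p.2 (σ p.1).1)
    (f := fun p => σ p.1)
    (g := fun p r => (r.1, (σ p.1).2.take (T.actIdx (s p.1) (σ p.1)) ++
      [(p.2.1, r.1.length, r.2)])) (by fun_prop) (by fun_prop) ?_
  fun_prop

theorem computableIn_state : ComputableIn {charFn C} T.state := by
  refine computableIn_nat_rec (f := fun _ : ℕ => (([], []) : List ℕ × List (ℕ × ℕ × δ)))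
    (g := fun _ s σ => T.step s σ) (n := fun s => s) (computableIn_const _) ?_ computableIn_id
  exact T.computableIn_step (by fun_prop) (by fun_prop)

end Strategy
end Construction

/-! ### Convergence of finite injury constructions -/

section Verification

namespace Strategy

variable {C : Set ℕ} {S : System C} {δ : Type} [Primcodable δ] (T : Strategy S δ)

/-- The invariant of the states. -/
def Good (σ : List ℕ × List (ℕ × ℕ × δ)) : Prop :=
  σ.1.Nodup ∧
    (∀ (i : ℕ) (ρ : ℕ × ℕ × δ), σ.2[i]? = some ρ →
      ρ.1 ≤ ρ.2.1 ∧ ρ.2.1 ≤ σ.1.length ∧ i ∈ σ.1.take ρ.1 ∧ T.Inv i ρ.1 (σ.1.take ρ.2.1) ρ.2.2) ∧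
    ∀ (i j : ℕ) (ρ τ : ℕ × ℕ × δ), i < j → σ.2[i]? = some ρ → σ.2[j]? = some τ → ρ.2.1 ≤ τ.1

theorem step_cases (s : ℕ) (σ : List ℕ × List (ℕ × ℕ × δ)) :
    (∃ i ρ r, σ.2[i]? = some ρ ∧ T.act i s ρ σ.1 = some r ∧
      (∀ j < i, ∀ τ, σ.2[j]? = some τ → T.act j s τ σ.1 = none) ∧
      T.step s σ = (r.1, σ.2.take i ++ [(ρ.1, r.1.length, r.2)])) ∨
    ((∀ j τ, σ.2[j]? = some τ → T.act j s τ σ.1 = none) ∧ T.step s σ = T.extend σ) := by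
  classical
  have hex : ∃ i, ∀ ρ, σ.2[i]? = some ρ → (T.act i s ρ σ.1).isSome :=
    ⟨σ.2.length, fun ρ h => by simp at h⟩
  have hidx : T.actIdx s σ = Nat.find hex := by unfold actIdx; congr
  have hspec := Nat.find_spec hex
  have hmin : ∀ j < Nat.find hex, ∀ τ, σ.2[j]? = some τ → T.act j s τ σ.1 = none := by
    intro j hj τ hτ
    have := Nat.find_min hex hj
    push Not at this
    obtain ⟨τ', hτ', h⟩ := this
    rw [hτ] at hτ'
    cases hτ'
    simpa using h
  rw [← hidx] at hspec hmin
  rcases hρ : σ.2[T.actIdx s σ]? with _ | ρ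
  · right
    refine ⟨fun j τ hτ => hmin j ?_ τ hτ, by simp [step, hρ]⟩
    have h1 := List.getElem?_eq_none_iff.1 hρ
    have h2 := (List.getElem?_eq_some_iff.1 hτ).1
    omega
  · left
    obtain ⟨r, hr⟩ := Option.isSome_iff_exists.1 (hspec ρ hρ)
    exact ⟨_, ρ, r, hρ, hr, hmin, by simp [step, hρ, hr]⟩

theorem step_of_act {s i : ℕ} {σ : List ℕ × List (ℕ × ℕ × δ)} {ρ : ℕ × ℕ × δ} {r : List ℕ × δ}
    (hρ : σ.2[i]? = some ρ) (hr : T.act i s ρ σ.1 = some r)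
    (hlt : ∀ j < i, ∀ τ, σ.2[j]? = some τ → T.act j s τ σ.1 = none) :
    T.step s σ = (r.1, σ.2.take i ++ [(ρ.1, r.1.length, r.2)]) := by
  rcases T.step_cases s σ with ⟨j, τ, r', hj, hr', hlt', heq⟩ | ⟨hall, -⟩
  · have hji : j = i := by
      rcases lt_trichotomy j i with h | h | h
      · rw [hlt j h τ hj] at hr'; cases hr'
      · exact h
      · rw [hlt' i h ρ hρ] at hr; cases hr
    subst hji
    rw [hρ] at hj
    cases hj
    rw [hr] at hr'
    cases hr'
    exact heq
  · rw [hall i ρ hρ] at hr; cases hr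

theorem getElem?_take_append {β : Type*} {l : List β} {i : ℕ} (hi : i < l.length) (b : β) (j : ℕ) :
    (l.take i ++ [b])[j]? = if j < i then l[j]? else if j = i then some b else none := by
  have hl : (l.take i).length = i := by simp; omega
  split_ifs with h1 h2
  · rw [List.getElem?_append_left (by omega), List.getElem?_take_of_lt h1]
  · subst h2
    rw [List.getElem?_append_right (by omega)]
    simp [hl]
  · rw [List.getElem?_append_right (by omega), hl]
    simp only [List.getElem?_singleton]
    rw [if_neg (by omega)]

theorem take_eq_take_of_le {β : Type*} {x y : List β} {k l : ℕ} (h : x.take l = y.take l)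
    (hk : k ≤ l) : x.take k = y.take k := by
  have := congrArg (List.take k) h
  simpa [List.take_take, hk] using this

variable {T}

theorem Good.act {σ : List ℕ × List (ℕ × ℕ × δ)} (h : T.Good σ) {i s : ℕ} {ρ : ℕ × ℕ × δ}
    {r : List ℕ × δ} (hi : σ.2[i]? = some ρ) (hr : T.act i s ρ σ.1 = some r) :
    S.Eqv s ρ.1 σ.1 r.1 ∧ T.rank r.2 < T.rank ρ.2.2 ∧ T.Inv i ρ.1 r.1 r.2 :=
  let ⟨h1, h2, _, h4⟩ := h.2.1 i ρ hi
  T.act_spec h.1 h1 h2 h4 hr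

theorem extend_fst_eq (σ : List ℕ × List (ℕ × ℕ × δ)) : ∃ w, (T.extend σ).1 = σ.1 ++ w := by
  obtain ⟨w, hw⟩ := exists_addNew_eq σ.1 [σ.2.length]
  obtain ⟨w', hw'⟩ := exists_addNew_eq (addNew σ.1 [σ.2.length])
    (S.findA (addNew σ.1 [σ.2.length]))
  exact ⟨w ++ w', by rw [extend, hw', hw, List.append_assoc]⟩

theorem Good.extend {σ : List ℕ × List (ℕ × ℕ × δ)} (h : T.Good σ) : T.Good (T.extend σ) := by
  obtain ⟨w, hw⟩ := exists_addNew_eq σ.1 [σ.2.length]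
  set x₁ := addNew σ.1 [σ.2.length] with hx₁
  obtain ⟨w', hw'⟩ := exists_addNew_eq x₁ (S.findA x₁)
  set x₂ := addNew x₁ (S.findA x₁) with hx₂
  have hext : T.extend σ = (x₂, σ.2 ++ [(x₁.length, x₂.length, T.init)]) := rfl
  have hnd₁ : x₁.Nodup := addNew_nodup h.1 _
  have hnd₂ : x₂.Nodup := addNew_nodup hnd₁ _
  have hle : x₁.length ≤ x₂.length := by rw [hw']; simp
  have hle' : σ.1.length ≤ x₁.length := by rw [hw]; simp
  have htake : x₂.take x₁.length = x₁ := by rw [hw']; simp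
  have htake' : ∀ l ≤ σ.1.length, x₂.take l = σ.1.take l := fun l hl => by
    rw [hw', hw, List.append_assoc, List.take_append_of_le_length hl]
  have hget : ∀ j, (T.extend σ).2[j]? = if j < σ.2.length then σ.2[j]? else
      if j = σ.2.length then some (x₁.length, x₂.length, T.init) else none := fun j => by
    rw [hext]
    simp only
    split_ifs with h1 h2
    · rw [List.getElem?_append_left h1]
    · subst h2; rw [List.getElem?_append_right le_rfl]; simp
    · rw [List.getElem?_append_right (by omega), List.getElem?_singleton, if_neg (by omega)]
  refine ⟨hnd₂, fun i ρ hρ => ?_, fun i j ρ τ hij hρ hτ => ?_⟩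
  · rw [hget] at hρ
    rw [hext]
    split_ifs at hρ with h1 h2
    · obtain ⟨g1, g2, g3, g4⟩ := h.2.1 i ρ hρ
      refine ⟨g1, by simp only; omega, ?_, ?_⟩
      · rw [htake' _ (by omega)]; exact g3
      · rw [htake' _ (by omega)]; exact g4
    · subst h2
      cases hρ
      refine ⟨hle, le_rfl, ?_, ?_⟩
      · simp only [htake]
        exact mem_addNew (by simp)
      · simp only [List.take_length]
        refine T.inv_init ⟨hnd₂, hle, fun a ha => ?_⟩
        rw [htake] at ha
        exact mem_addNew ha
  · rw [hget] at hρ hτ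
    split_ifs at hρ hτ with h1 h2 h3 h4 h5 h6
    · exact h.2.2 i j ρ τ hij hρ hτ
    · cases hτ
      have := (h.2.1 i ρ hρ).2.1
      simp only
      omega
    · omega
    · omega

theorem Good.step {σ : List ℕ × List (ℕ × ℕ × δ)} (h : T.Good σ) (s : ℕ) :
    T.Good (T.step s σ) := by
  rcases T.step_cases s σ with ⟨i, ρ, r, hi, hr, -, heq⟩ | ⟨-, heq⟩
  · rw [heq]
    obtain ⟨⟨hl, hnd, htake, hfact⟩, hrank, hinv⟩ := h.act hi hr
    obtain ⟨g1, g2, g3, g4⟩ := h.2.1 i ρ hi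
    have hil := (List.getElem?_eq_some_iff.1 hi).1
    refine ⟨hnd, fun j τ hτ => ?_, fun j j' τ τ' hjj hτ hτ' => ?_⟩
    · simp only [getElem?_take_append hil] at hτ
      split_ifs at hτ with h1 h2
      · obtain ⟨f1, f2, f3, f4⟩ := h.2.1 j τ hτ
        have hle := h.2.2 j i τ ρ h1 hτ hi
        refine ⟨f1, by simp only; omega, ?_, ?_⟩
        · simp only
          rw [take_eq_take_of_le htake (f1.trans hle)]; exact f3
        · simp only
          rw [take_eq_take_of_le htake hle]; exact f4
      · subst h2
        cases hτ
        refine ⟨by simp only; omega, le_rfl, ?_, ?_⟩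
        · simp only
          rw [htake]; exact g3
        · simpa using hinv
    · simp only [getElem?_take_append hil] at hτ hτ'
      split_ifs at hτ hτ' with h1 h2 h3 h4
      · exact h.2.2 j j' τ τ' hjj hτ hτ'
      · subst h3
        cases hτ'
        exact h.2.2 j j' τ ρ h1 hτ hi
      · omega
      · omega
  · rw [heq]; exact h.extend

variable (T)

theorem good_state (s : ℕ) : T.Good (T.state s) := by
  induction s with
  | zero => exact ⟨by simp [state], by simp [state], by simp [state]⟩
  | succ s ih => rw [state_succ]; exact ih.step s

/-- Facts once decided are never changed. -/
theorem fact_state_succ {s q : ℕ} {b : Bool} (hq : q < s)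
    (h : S.fact q (T.state s).1 = some b) : S.fact q (T.state (s + 1)).1 = some b := by
  rw [state_succ]
  rcases T.step_cases s (T.state s) with ⟨i, ρ, r, hi, hr, -, heq⟩ | ⟨-, heq⟩
  · obtain ⟨⟨hl, hnd, htake, hfact⟩, -⟩ := (T.good_state s).act hi hr
    rw [heq, ← h]
    exact hfact q hq
  · obtain ⟨w, hw⟩ := extend_fst_eq (T := T) (T.state s)
    rw [heq, hw]
    exact S.fact_append w h

/-- As long as no requirement up to `i` acts, the record of requirement `i` and the part of the
list it protects stay as they are. -/
theorem stable_succ {s i : ℕ} {ρ : ℕ × ℕ × δ} (hi : (T.state s).2[i]? = some ρ)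
    (h : ∀ j ≤ i, ∀ τ, (T.state s).2[j]? = some τ → T.act j s τ (T.state s).1 = none) :
    (T.state (s + 1)).2[i]? = some ρ ∧
      (T.state (s + 1)).1.take ρ.2.1 = (T.state s).1.take ρ.2.1 := by
  rw [state_succ]
  have hg := T.good_state s
  have hil := (List.getElem?_eq_some_iff.1 hi).1
  rcases T.step_cases s (T.state s) with ⟨j, τ, r, hj, hr, -, heq⟩ | ⟨-, heq⟩
  · have hij : i < j := by
      by_contra hij
      rw [h j (by omega) τ hj] at hr
      cases hr
    obtain ⟨⟨hl, hnd, htake, hfact⟩, -⟩ := hg.act hj hr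
    rw [heq]
    refine ⟨?_, take_eq_take_of_le htake (hg.2.2 i j ρ τ hij hi hj)⟩
    simp only [getElem?_take_append (List.getElem?_eq_some_iff.1 hj).1]
    rw [if_pos hij, hi]
  · rw [heq]
    obtain ⟨w, hw⟩ := extend_fst_eq (T := T) (T.state s)
    refine ⟨?_, ?_⟩
    · rw [extend, List.getElem?_append_left hil, hi]
    · rw [hw, List.take_append_of_le_length (hg.2.1 i ρ hi).2.1]

theorem stable {s t i : ℕ} {ρ : ℕ × ℕ × δ} (hst : s ≤ t) (hi : (T.state s).2[i]? = some ρ)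
    (h : ∀ u, s ≤ u → u < t → ∀ j ≤ i, ∀ τ, (T.state u).2[j]? = some τ →
      T.act j u τ (T.state u).1 = none) :
    (T.state t).2[i]? = some ρ ∧ (T.state t).1.take ρ.2.1 = (T.state s).1.take ρ.2.1 := by
  induction t, hst using Nat.le_induction with
  | base => exact ⟨hi, rfl⟩
  | succ t hst ih =>
    obtain ⟨h1, h2⟩ := ih fun u hu hut => h u hu (by omega)
    obtain ⟨h3, h4⟩ := T.stable_succ h1 (h t hst (by omega))
    exact ⟨h3, h4.trans h2⟩

/-- Every requirement acts only finitely often. -/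
theorem exists_stable_record (i : ℕ) :
    ∃ s₀ ρ, ∀ t ≥ s₀, (T.state t).2[i]? = some ρ ∧ T.act i t ρ (T.state t).1 = none := by
  induction i using Nat.strong_induction_on with
  | _ i ih =>
    have : ∃ s₁, ∀ t ≥ s₁, ∀ j < i, ∃ τ, (T.state t).2[j]? = some τ ∧
        T.act j t τ (T.state t).1 = none := by
      have : Nonempty δ := ⟨T.init⟩
      choose! N τ hN using ih
      refine ⟨(Finset.range i).sup N, fun t ht j hj => ⟨τ j, hN j hj t ?_⟩⟩
      exact (Finset.le_sup (f := N) (Finset.mem_range.2 hj)).trans ht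
    obtain ⟨s₁, hs₁⟩ := this
    have hnone : ∀ t ≥ s₁, ∀ j < i, ∀ τ, (T.state t).2[j]? = some τ →
        T.act j t τ (T.state t).1 = none := by
      intro t ht j hj τ hτ
      obtain ⟨τ', h1, h2⟩ := hs₁ t ht j hj
      rw [hτ] at h1
      cases h1
      exact h2
    -- from stage `s₁` on, requirement `i` cannot lose its record, and each action lowers the rank
    have key : ∀ n, ∀ t ≥ s₁, ∀ ρ, (T.state t).2[i]? = some ρ → T.rank ρ.2.2 = n →
        ∃ s₀ ρ, ∀ t ≥ s₀, (T.state t).2[i]? = some ρ ∧ T.act i t ρ (T.state t).1 = none := by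
      intro n
      induction n using Nat.strong_induction_on with
      | _ n ihn =>
        intro t ht ρ hρ hn
        by_cases hact : ∃ u, t ≤ u ∧ (T.act i u ρ (T.state u).1).isSome
        · classical
          obtain ⟨htu, hu⟩ := Nat.find_spec hact
          have hmin := fun m (hm : m < Nat.find hact) => Nat.find_min hact hm
          set u := Nat.find hact
          have hquiet : ∀ v, t ≤ v → v < u → ∀ j ≤ i, ∀ τ, (T.state v).2[j]? = some τ →
              T.act j v τ (T.state v).1 = none := by
            intro v
            induction v using Nat.strong_induction_on with
            | _ v ihv =>
              intro htv hvu j hj τ hτ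
              rcases hj.lt_or_eq with hj | rfl
              · exact hnone v (by omega) j hj τ hτ
              · have := (T.stable htv hρ fun w h1 h2 => ihv w h2 h1 (by omega)).1
                rw [this] at hτ
                cases hτ
                have := hmin v hvu
                simpa [htv] using this
          have hρu := (T.stable htu hρ hquiet).1
          obtain ⟨r, hr⟩ := Option.isSome_iff_exists.1 hu
          have heq := T.step_of_act hρu hr fun j hj => hnone u (by omega) j hj
          obtain ⟨-, hrank, -⟩ := (T.good_state u).act hρu hr
          refine ihn (T.rank r.2) (by omega) (u + 1) (by omega) (ρ.1, r.1.length, r.2) ?_ rfl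
          rw [state_succ, heq]
          simp [getElem?_take_append (List.getElem?_eq_some_iff.1 hρu).1]
        · push Not at hact
          refine ⟨t, ρ, fun u hu => ?_⟩
          have hquiet : ∀ v, t ≤ v → v < u → ∀ j ≤ i, ∀ τ, (T.state v).2[j]? = some τ →
              T.act j v τ (T.state v).1 = none := by
            intro v
            induction v using Nat.strong_induction_on with
            | _ v ihv =>
              intro htv hvu j hj τ hτ
              rcases hj.lt_or_eq with hj | rfl
              · exact hnone v (by omega) j hj τ hτ
              · have := (T.stable htv hρ fun w h1 h2 => ihv w h2 h1 (by omega)).1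
                rw [this] at hτ
                cases hτ
                simpa using hact v htv
          exact ⟨(T.stable hu hρ hquiet).1, by simpa using hact u hu⟩
    rcases hi : (T.state s₁).2[i]? with _ | ρ
    · have hlen : (T.state s₁).2.length = i := by
        have h1 := List.getElem?_eq_none_iff.1 hi
        by_contra hne
        obtain ⟨τ, h2, -⟩ := hs₁ s₁ le_rfl (T.state s₁).2.length (by omega)
        simp at h2
      rcases T.step_cases s₁ (T.state s₁) with ⟨j, τ, r', hj, hr', hlt, heq⟩ | ⟨-, heq⟩
      · have hji := (List.getElem?_eq_some_iff.1 hj).1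
        rw [hnone s₁ le_rfl j (by omega) τ hj] at hr'
        cases hr'
      · have hlt : i < (T.state (s₁ + 1)).2.length := by
          rw [state_succ, heq, extend]
          simp [hlen]
        exact key _ (s₁ + 1) (by omega) _ (List.getElem?_eq_getElem hlt) rfl
    · exact key _ s₁ le_rfl ρ hi rfl

/-- The lists `x s` converge to the graph of a bijection `G`. -/
def Converges (x : ℕ → List ℕ) (G : ℕ → ℕ) : Prop :=
  Function.Bijective G ∧ ∀ N, ∃ s₀, ∀ t ≥ s₀, ∃ w, x t = (List.range N).map G ++ w

theorem length_of_good {σ : List ℕ × List (ℕ × ℕ × δ)} (h : T.Good σ) {i : ℕ} {ρ : ℕ × ℕ × δ}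
    (hρ : σ.2[i]? = some ρ) : i < ρ.2.1 := by
  have hsub : ∀ j ≤ i, j ∈ σ.1.take ρ.2.1 := by
    intro j hj
    have hil := (List.getElem?_eq_some_iff.1 hρ).1
    obtain ⟨τ, hτ⟩ : ∃ τ, σ.2[j]? = some τ :=
      ⟨_, List.getElem?_eq_getElem (lt_of_le_of_lt hj hil)⟩
    have h1 := (h.2.1 j τ hτ)
    have hle : τ.1 ≤ ρ.2.1 := by
      rcases hj.lt_or_eq with hj | rfl
      · exact h1.1.trans ((h.2.2 j i τ ρ hj hτ hρ).trans (h.2.1 i ρ hρ).1)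
      · rw [hρ] at hτ; cases hτ; exact h1.1
    exact List.take_subset_take_left σ.1 hle h1.2.2.1
  have hsub' : List.range (i + 1) ⊆ σ.1.take ρ.2.1 := fun j hj => hsub j (by
    have := List.mem_range.1 hj; omega)
  have := (List.nodup_range.subperm hsub').length_le
  simp only [List.length_range, List.length_take] at this
  omega

/-- The verification of finite injury constructions: the lists converge to a bijection, and every
requirement ends with a record for which it does not want to act any more. -/
theorem exists_limit : ∃ G : ℕ → ℕ, Converges (fun s => (T.state s).1) G ∧
    ∀ i, ∃ s₀ ρ, ρ.1 ≤ ρ.2.1 ∧ T.Inv i ρ.1 ((List.range ρ.2.1).map G) ρ.2.2 ∧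
      ∀ t ≥ s₀, (T.state t).2[i]? = some ρ ∧ T.act i t ρ (T.state t).1 = none ∧
        ∃ w, (T.state t).1 = (List.range ρ.2.1).map G ++ w := by
  have hstab : ∀ i, ∃ s₀ ρ, ∀ t ≥ s₀, (T.state t).2[i]? = some ρ ∧
      T.act i t ρ (T.state t).1 = none ∧
      (T.state t).1.take ρ.2.1 = (T.state s₀).1.take ρ.2.1 := by
    intro i
    choose N τ hN using T.exists_stable_record
    refine ⟨(Finset.range (i + 1)).sup N, τ i, fun t ht => ?_⟩
    have hle : ∀ j ≤ i, N j ≤ (Finset.range (i + 1)).sup N := fun j hj =>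
      Finset.le_sup (f := N) (Finset.mem_range.2 (by omega))
    obtain ⟨h1, h2⟩ := hN i t ((hle i le_rfl).trans ht)
    refine ⟨h1, h2, (T.stable ht (hN i _ (hle i le_rfl)).1 ?_).2⟩
    intro u hu _ j hj τ' hτ'
    obtain ⟨h3, h4⟩ := hN j u ((hle j hj).trans hu)
    rw [h3] at hτ'
    cases hτ'
    exact h4
  choose N ρ hN using hstab
  have hlen : ∀ i, i < (ρ i).2.1 := fun i =>
    T.length_of_good (T.good_state (N i)) (hN i _ le_rfl).1
  -- The part that requirement `i` protects in the end is longer than `i`, so entry `n` is final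
  -- once the record of requirement `n` is.
  let G : ℕ → ℕ := fun n => ((T.state (N n)).1[n]?).getD 0
  have hG : ∀ i, ∀ t ≥ N i, (T.state t).1.take (ρ i).2.1 = (List.range (ρ i).2.1).map G := by
    intro i t ht
    have hl := ((T.good_state t).2.1 i _ (hN i t ht).1).2.1
    refine List.ext_getElem? fun n => ?_
    by_cases hn : n < (ρ i).2.1
    · rw [List.getElem?_take_of_lt hn, List.getElem?_map, List.getElem?_range hn, Option.map_some]
      have h1 := (hN i t ht).2.2
      have h2 := (hN i (max t (N n)) (by omega)).2.2
      have h3 := (hN n (max t (N n)) (by omega)).2.2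
      have e1 : (T.state t).1[n]? = (T.state (max t (N n))).1[n]? := by
        have := congrArg (·[n]?) (h1.trans h2.symm)
        simpa [List.getElem?_take_of_lt hn] using this
      have e2 : (T.state (max t (N n))).1[n]? = (T.state (N n)).1[n]? := by
        have := congrArg (·[n]?) h3
        simpa [List.getElem?_take_of_lt (hlen n)] using this
      have e3 : ∃ a, (T.state t).1[n]? = some a := ⟨_, List.getElem?_eq_getElem (by omega)⟩
      obtain ⟨a, ha⟩ := e3
      simp only [G]
      rw [← e2, ← e1, ha, Option.getD_some]
    · rw [List.getElem?_eq_none, List.getElem?_eq_none] <;> simp <;> omega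
  have hconv : ∀ i, ∀ t ≥ N i, ∃ w, (T.state t).1 = (List.range (ρ i).2.1).map G ++ w :=
    fun i t ht => ⟨(T.state t).1.drop (ρ i).2.1, by rw [← hG i t ht, List.take_append_drop]⟩
  refine ⟨G, ⟨⟨fun a b hab => ?_, fun n => ?_⟩, fun n => ?_⟩, fun i => ?_⟩
  · obtain ⟨w, hw⟩ := hconv (max a b) _ le_rfl
    have hnd := (T.good_state (N (max a b))).1
    rw [hw] at hnd
    have hnd' := (List.nodup_append.1 hnd).1
    have := hlen (max a b)
    exact List.inj_on_of_nodup_map hnd' (List.mem_range.2 (by omega))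
      (List.mem_range.2 (by omega)) hab
  · have h1 := (T.good_state (N n)).2.1 n _ (hN n _ le_rfl).1
    have h2 := List.take_subset_take_left (T.state (N n)).1 h1.1 h1.2.2.1
    rw [hG n _ le_rfl] at h2
    obtain ⟨a, -, ha⟩ := List.mem_map.1 h2
    exact ⟨a, ha⟩
  · refine ⟨N n, fun t ht => ?_⟩
    obtain ⟨w, hw⟩ := hconv n t ht
    have hsplit : (List.range (ρ n).2.1).map G = (List.range n).map G ++
        ((List.range (ρ n).2.1).map G).drop n := by
      conv_lhs => rw [← List.take_append_drop n ((List.range (ρ n).2.1).map G)]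
      congr 1
      rw [← List.map_take, List.take_range, min_eq_left (hlen n).le]
    exact ⟨((List.range (ρ n).2.1).map G).drop n ++ w, by
      simp only [hw, ← List.append_assoc, ← hsplit]⟩
  · have h1 := (T.good_state (N i)).2.1 i _ (hN i _ le_rfl).1
    refine ⟨N i, ρ i, h1.1, ?_, fun t ht => ⟨(hN i t ht).1, (hN i t ht).2.1, hconv i t ht⟩⟩
    rw [← hG i _ le_rfl]
    exact h1.2.2.2

/-- A part of the list protected from all requirements that will ever act is final. -/
theorem take_eq_of_quiet {G : ℕ → ℕ} (hG : Converges (fun s => (T.state s).1) G) {s i : ℕ}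
    {ρ : ℕ × ℕ × δ} (hi : (T.state s).2[i]? = some ρ)
    (h : ∀ u, s ≤ u → ∀ j ≤ i, ∀ τ, (T.state u).2[j]? = some τ →
      T.act j u τ (T.state u).1 = none) :
    (T.state s).1.take ρ.2.1 = (List.range ρ.2.1).map G := by
  obtain ⟨s₀, hs₀⟩ := hG.2 ρ.2.1
  obtain ⟨w, hw⟩ := hs₀ (max s₀ s) (le_max_left _ _)
  have := (T.stable (le_max_right s₀ s) hi fun u hu _ => h u hu).2
  rw [← this]
  simp only at hw
  rw [hw]
  simp

end Strategy
end Verification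

/-! ### The limit relation -/

section Limit

theorem mem_setJoin {X Y : Set ℕ} {j : ℕ} :
    j ∈ setJoin X Y ↔ if j % 2 = 0 then j / 2 ∈ X else j / 2 ∈ Y := by
  constructor
  · rintro (⟨n, hn, rfl⟩ | ⟨n, hn, rfl⟩)
    · simpa using hn
    · rw [if_neg (by omega)]
      rwa [show (2 * n + 1) / 2 = n by omega]
  · split_ifs with h
    · exact fun hj => Or.inl ⟨_, hj, by omega⟩
    · exact fun hj => Or.inr ⟨_, hj, by omega⟩

theorem two_mul_mem_setJoin {X Y : Set ℕ} {n : ℕ} : 2 * n ∈ setJoin X Y ↔ n ∈ X := by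
  simp [mem_setJoin]

theorem two_mul_add_one_mem_setJoin {X Y : Set ℕ} {n : ℕ} : 2 * n + 1 ∈ setJoin X Y ↔ n ∈ Y := by
  rw [mem_setJoin, if_neg (by omega), show (2 * n + 1) / 2 = n by omega]

theorem decidableIn_setJoin {α : Type*} [Primcodable α] {O : Set (ℕ →. ℕ)} {X Y : α → Set ℕ}
    {j : α → ℕ} (hj : ComputableIn O j) (hX : DecidableIn O fun a => j a / 2 ∈ X a)
    (hY : DecidableIn O fun a => j a / 2 ∈ Y a) :
    DecidableIn O fun a => j a ∈ setJoin (X a) (Y a) := by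
  have h : DecidableIn O fun a => j a % 2 = 0 := decidableIn_eq (by fun_prop) (by fun_prop)
  refine ((h.and hX).or (h.not.and hY)).of_iff fun a => ?_
  rw [mem_setJoin]
  split_ifs <;> simp [*]

theorem exists_range_map_append {G : ℕ → ℕ} {N N' : ℕ} (h : N ≤ N') :
    ∃ w, (List.range N').map G = (List.range N).map G ++ w :=
  ⟨((List.range N').map G).drop N, by
    conv_lhs => rw [← List.take_append_drop N ((List.range N').map G)]
    congr 1
    rw [← List.map_take, List.take_range, min_eq_left h]⟩

namespace System

variable {C : Set ℕ} (S : System C)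

/-- The numbers of the tuples at which `R` is seen to hold through `x`. -/
def bits (x : List ℕ) : Set ℕ := {q | S.rbit q x = some true}

/-- The relation `R` pulled back along `G`, coded as a set of numbers of tuples. -/
def limitRel (G : ℕ → ℕ) : Set ℕ := {q | ∃ N, S.rbit q ((List.range N).map G) = some true}

variable {S}

theorem rbit_limit {G : ℕ → ℕ} {q N : ℕ} {b : Bool}
    (h : S.rbit q ((List.range N).map G) = some b) : b = true ↔ q ∈ S.limitRel G := by
  constructor
  · rintro rfl
    exact ⟨N, h⟩
  · rintro ⟨N', h'⟩
    obtain ⟨w, hw⟩ := exists_range_map_append (G := G) (le_max_left N N')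
    obtain ⟨w', hw'⟩ := exists_range_map_append (G := G) (le_max_right N N')
    have h1 := S.rbit_append w h
    have h2 := S.rbit_append w' h'
    rw [← hw] at h1
    rw [← hw', h1] at h2
    simpa using h2

theorem mem_bits_iff {x : List ℕ} {q : ℕ} {b : Bool} (h : S.rbit q x = some b) :
    q ∈ S.bits x ↔ b = true := by
  simp [bits, h]

theorem mem_bits_iff_limit {G : ℕ → ℕ} {q N : ℕ} {w : List ℕ}
    (h : (S.rbit q ((List.range N).map G)).isSome) :
    q ∈ S.bits ((List.range N).map G ++ w) ↔ q ∈ S.limitRel G := by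
  obtain ⟨b, hb⟩ := Option.isSome_iff_exists.1 h
  rw [mem_bits_iff (S.rbit_append w hb), rbit_limit hb]

@[fun_prop]
theorem computableIn_rbit {α : Type*} [Primcodable α] {q : α → ℕ} {x : α → List ℕ}
    (hq : ComputableIn {charFn C} q) (hx : ComputableIn {charFn C} x) :
    ComputableIn {charFn C} fun a => S.rbit (q a) (x a) :=
  computableIn_comp (f := fun p : ℕ × List ℕ => S.rbit p.1 p.2) S.rbit_comp
    (computableIn_pair hq hx)

@[fun_prop]
theorem computableIn_fact {α : Type*} [Primcodable α] {q : α → ℕ} {x : α → List ℕ}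
    (hq : ComputableIn {charFn C} q) (hx : ComputableIn {charFn C} x) :
    ComputableIn {charFn C} fun a => S.fact (q a) (x a) :=
  computableIn_comp (f := fun p : ℕ × List ℕ => S.fact p.1 p.2) S.fact_comp
    (computableIn_pair hq hx)

@[fun_prop]
theorem computableIn_move {α : Type*} [Primcodable α] {k s : α → ℕ} {x : α → List ℕ}
    (hk : ComputableIn {charFn C} k) (hx : ComputableIn {charFn C} x)
    (hs : ComputableIn {charFn C} s) :
    ComputableIn {charFn C} fun a => S.move (k a) (x a) (s a) :=
  computableIn_comp (f := fun p : ℕ × List ℕ × ℕ => S.move p.1 p.2.1 p.2.2) S.move_comp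
    (computableIn_pair hk (computableIn_pair hx hs))

theorem decidableIn_nodup {α : Type*} [Primcodable α] {O : Set (ℕ →. ℕ)} {x : α → List ℕ}
    (hx : ComputableIn O x) : DecidableIn O fun a => (x a).Nodup := by
  refine (DecidableIn.forall_lt (P := fun a j => ∀ i < j, ¬ (x a)[i]? = (x a)[j]?)
    (f := fun a => (x a).length) ?_ (by fun_prop)).of_iff fun a => ?_
  · exact DecidableIn.forall_lt (P := fun (p : α × ℕ) i => ¬ (x p.1)[i]? = (x p.1)[p.2]?)
      (f := fun p => p.2) (decidableIn_eq (by fun_prop) (by fun_prop)).not (by fun_prop)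
  · rw [List.nodup_iff_getElem?_ne_getElem?]
    exact ⟨fun h j hj i hi => h i j hi hj, fun h i j hi hj => h j hj i hi⟩

theorem decidableIn_adm {α : Type*} [Primcodable α] {k : α → ℕ} {x : α → List ℕ}
    (hk : ComputableIn {charFn C} k) (hx : ComputableIn {charFn C} x) :
    DecidableIn {charFn C} fun a => S.Adm (k a) (x a) := by
  have := S.findA_comp
  refine (decidableIn_nodup hx).and ((decidableIn_le hk (by fun_prop)).and ?_)
  exact DecidableIn.listForall (P := fun a b => b ∈ x a)
    (DecidableIn.listMem (by fun_prop) (by fun_prop)) (by fun_prop)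

theorem decidableIn_bits {α : Type*} [Primcodable α] {q : α → ℕ} {x : α → List ℕ}
    (hq : ComputableIn {charFn C} q) (hx : ComputableIn {charFn C} x) :
    DecidableIn {charFn C} fun a => q a ∈ S.bits (x a) :=
  decidableIn_eq (by fun_prop) (by fun_prop)

theorem setJoin_left_reducible (X : Set ℕ) : SetReducible X (setJoin X C) := by
  rw [setReducible_iff]
  have h : DecidableIn {charFn (setJoin X C)} fun n => n ∈ setJoin X C :=
    setReducible_iff.1 (TuringReducible.refl _)
  exact (h.comp (f := fun n => 2 * n) (by fun_prop)).of_iff fun n => two_mul_mem_setJoin.symm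

theorem setJoin_right_reducible (X : Set ℕ) : SetReducible C (setJoin X C) := by
  rw [setReducible_iff]
  have h : DecidableIn {charFn (setJoin X C)} fun n => n ∈ setJoin X C :=
    setReducible_iff.1 (TuringReducible.refl _)
  exact (h.comp (f := fun n => 2 * n + 1) (by fun_prop)).of_iff
    fun n => two_mul_add_one_mem_setJoin.symm

theorem computableIn_of_reducible {α β : Type*} [Primcodable α] [Primcodable β] {X Y : Set ℕ}
    {f : α → β} (hf : ComputableIn {charFn X} f) (h : SetReducible X Y) :
    ComputableIn {charFn Y} f :=
  hf.subst fun g hg => by rw [hg]; exact h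

end System

theorem chi_congr {X Y : Set ℕ} {n m : ℕ} (h : n ∈ X ↔ m ∈ Y) : chi X n = chi Y m := chi_eq_chi.2 h

/-- A decidable family of sets has computable initial segments. -/
theorem computableIn_pre {α : Type*} [Primcodable α] {O : Set (ℕ →. ℕ)} {X : α → Set ℕ} {n : α → ℕ}
    (hX : DecidableIn O fun p : α × ℕ => p.2 ∈ X p.1) (hn : ComputableIn O n) :
    ComputableIn O fun a => pre (X a) (n a) := by
  classical
  refine computableIn_listMap (g := fun a => chi (X a)) (by fun_prop) ?_
  convert computableIn_ite hX (computableIn_const 1) (computableIn_const 0) using 2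
  simp only [chi]

end Limit

/-! ### Coding a c.e. set -/

section Coding

variable {C : Set ℕ} (S : System C)

open Classical in
/-- Requirement `i` changes the relation when `i` is enumerated into the c.e. set with index `e`.
Its memory is `1` until it has done so, and `0` afterwards. -/
noncomputable def codingStrategy (e : ℕ) : Strategy S ℕ where
  init := 1
  act i s ρ x := if ρ.2.2 = 1 ∧ i ∈ WStage C e s then some (S.move ρ.1 x s, 0) else none
  act_comp := by
    refine computableIn_ite ((decidableIn_eq (by fun_prop) (by fun_prop)).and
      (decidableIn_wStage (by fun_prop) (by fun_prop) (by fun_prop))) ?_ (by fun_prop)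
    fun_prop
  rank d := d
  Inv i k z d := (d = 1 ∧ S.Adm k z) ∨ (d = 0 ∧ i ∈ WSet C e)
  inv_init h := Or.inl ⟨rfl, h⟩
  act_spec := by
    intro i s k len d x x' d' hx hk hlen hinv hact
    split_ifs at hact with h
    simp only [Option.some.injEq, Prod.mk.injEq] at hact
    obtain ⟨rfl, rfl⟩ := hact
    simp only at h
    rcases hinv with ⟨-, hadm⟩ | ⟨h0, -⟩
    · have hadm' : S.Adm k x := ⟨hx, hk.trans hlen, fun a ha => by
        refine List.take_subset len x (hadm.2.2 a ?_)
        rwa [List.take_take, min_eq_left hk]⟩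
      exact ⟨hadm'.eqv_move s, by omega, Or.inr ⟨rfl, wStage_subset h.2⟩⟩
    · omega

end Coding

/-! ### Degrees in the coding construction -/

section Coding

variable {C : Set ℕ} {S : System C}

/-- The lists `x s` are the stages of a computation of a copy of the structure: they converge to
the bijection `G`, and facts once decided are preserved. -/
def System.Presents (S : System C) (x : ℕ → List ℕ) (G : ℕ → ℕ) : Prop :=
  ComputableIn {charFn C} x ∧ Strategy.Converges x G ∧
    ∀ s q b, q < s → S.fact q (x s) = some b → S.fact q (x (s + 1)) = some b

theorem Strategy.presents {δ : Type} [Primcodable δ] (T : Strategy S δ) {G : ℕ → ℕ}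
    (hG : Converges (fun s => (T.state s).1) G) : S.Presents (fun s => (T.state s).1) G :=
  ⟨computableIn_comp computableIn_fst T.computableIn_state, hG,
    fun _ _ _ hq h => T.fact_state_succ hq h⟩

/-- No requirement up to `i` that has a record at stage `s` waits for an element of the c.e. set. -/
def Settled (S : System C) (e s i : ℕ) : Prop :=
  ∀ j < i + 1, ∀ τ, ((codingStrategy S e).state s).2[j]? = some τ →
    τ.2.2 = 1 → j ∉ WSet C e

theorem act_coding_eq_none {e i s : ℕ} {ρ : ℕ × ℕ × ℕ} {x : List ℕ} :
    (codingStrategy S e).act i s ρ x = none ↔ ¬ (ρ.2.2 = 1 ∧ i ∈ WStage C e s) := by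
  simp [codingStrategy]

theorem quiet_of_settled {e s i : ℕ} {ρ : ℕ × ℕ × ℕ}
    (hi : ((codingStrategy S e).state s).2[i]? = some ρ) (h : Settled S e s i) :
    ∀ u, s ≤ u → ∀ j ≤ i, ∀ τ, ((codingStrategy S e).state u).2[j]? = some τ →
      (codingStrategy S e).act j u τ ((codingStrategy S e).state u).1 = none := by
  intro u
  induction u using Nat.strong_induction_on with
  | _ u ih =>
    intro hsu j hj τ hτ
    have hjl : j < ((codingStrategy S e).state s).2.length :=
      lt_of_le_of_lt hj (List.getElem?_eq_some_iff.1 hi).1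
    have hj' := List.getElem?_eq_getElem hjl
    have := ((codingStrategy S e).stable hsu hj' fun v h1 h2 k hk =>
      ih v h2 h1 k (hk.trans hj)).1
    rw [this] at hτ
    cases hτ
    rw [act_coding_eq_none]
    rintro ⟨h1, h2⟩
    exact h j (by omega) _ hj' h1 (wStage_subset h2)

theorem eventually_settled {e : ℕ} (i : ℕ) : ∀ᶠ s in atTop, Settled S e s i := by
  obtain ⟨G, hG, hlim⟩ := (codingStrategy S e).exists_limit
  have : ∀ j ∈ Finset.range (i + 1), ∀ᶠ s in atTop, ∀ τ,
      ((codingStrategy S e).state s).2[j]? = some τ → τ.2.2 = 1 → j ∉ WSet C e := by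
    intro j _
    obtain ⟨s₀, ρ, -, -, hρ⟩ := hlim j
    filter_upwards [eventually_ge_atTop s₀] with s hs τ hτ h1 hj
    rw [(hρ s hs).1] at hτ
    cases hτ
    obtain ⟨t, ht⟩ := Set.mem_iUnion.1 hj
    exact act_coding_eq_none.1 (hρ (max s₀ t) (le_max_left _ _)).2.1
      ⟨h1, wStage_mono (le_max_right _ _) ht⟩
  filter_upwards [(eventually_all_finset _).2 this] with s hs j hj
  exact hs j (Finset.mem_range.2 hj)

theorem decidableIn_getElem?_imp {α β : Type*} [Primcodable α] [Primcodable β] {O : Set (ℕ →. ℕ)}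
    {o : α → Option β} {P : α → β → Prop} (ho : ComputableIn O o)
    (hP : DecidableIn O fun p : α × β => P p.1 p.2) :
    DecidableIn O fun a => ∀ b, o a = some b → P a b := by
  obtain ⟨c, hc, hc'⟩ := hP
  refine (decidableIn_eq_true (f := fun a => (o a).elim true fun b => c (a, b))
    (computableIn_optionElim ho (by fun_prop) hc)).of_iff fun a => ?_
  cases o a with
  | none => simp
  | some b => simpa using hc' (a, b)

theorem decidableIn_getElem?_and {α β : Type*} [Primcodable α] [Primcodable β] {O : Set (ℕ →. ℕ)}
    {o : α → Option β} {P : α → β → Prop} (ho : ComputableIn O o)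
    (hP : DecidableIn O fun p : α × β => P p.1 p.2) :
    DecidableIn O fun a => ∃ b, o a = some b ∧ P a b := by
  refine (decidableIn_getElem?_imp (P := fun a b => ¬ P a b) ho hP.not).not.of_iff fun a => ?_
  push Not
  rfl

variable {e : ℕ} {G : ℕ → ℕ}

/-- The limit relation can be computed from the coded c.e. set, which tells when the part of the
list protected by a requirement has reached its final form. -/
theorem limitRel_reducible_of_coding
    (hG : Strategy.Converges (fun s => ((codingStrategy S e).state s).1) G) :
    DecidableIn {charFn (setJoin (WSet C e) C)} fun q => q ∈ S.limitRel G := by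
  set D := setJoin (WSet C e) C with hD
  have hCD : SetReducible C D := System.setJoin_right_reducible _
  have hW : DecidableIn {charFn D} fun n => n ∈ WSet C e :=
    setReducible_iff.1 (System.setJoin_left_reducible _)
  have hstate : ComputableIn {charFn D} (codingStrategy S e).state :=
    System.computableIn_of_reducible (codingStrategy S e).computableIn_state hCD
  have hrbit : ComputableIn {charFn D} fun p : ℕ × List ℕ => S.rbit p.1 p.2 :=
    System.computableIn_of_reducible S.rbit_comp hCD
  -- `P st q (s, i)`: at stage `s`, bit `q` is decided by the part of the list that requirement `i`
  -- protects, and no requirement up to `i` will act again.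
  let P : (ℕ → List ℕ × List (ℕ × ℕ × ℕ)) → ℕ → ℕ × ℕ → Prop := fun st q p =>
    (∃ ρ, (st p.1).2[p.2]? = some ρ ∧
      (S.rbit q ((st p.1).1.take ρ.2.1)).isSome = true) ∧
      ∀ j < p.2 + 1, ∀ τ, (st p.1).2[j]? = some τ → τ.2.2 = 1 → j ∉ WSet C e
  have hP : ∀ st, ComputableIn {charFn D} st →
      DecidableIn {charFn D} fun a : ℕ × ℕ × ℕ => P st a.1 a.2 := by
    intro st hst
    refine DecidableIn.and ?_ ?_
    · refine decidableIn_getElem?_and (o := fun a : ℕ × ℕ × ℕ =>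
        (st a.2.1).2[a.2.2]?)
        (P := fun a ρ => (S.rbit a.1 ((st a.2.1).1.take ρ.2.1)).isSome = true)
        (by fun_prop) (decidableIn_eq_true (computableIn_isSome ?_))
      exact computableIn_comp (f := fun p : ℕ × List ℕ => S.rbit p.1 p.2)
        (g := fun a : (ℕ × ℕ × ℕ) × ℕ × ℕ × ℕ => (a.1.1, (st a.1.2.1).1.take a.2.2.1))
        hrbit (by fun_prop)
    · refine DecidableIn.forall_lt (P := fun (a : ℕ × ℕ × ℕ) j => ∀ τ,
        (st a.2.1).2[j]? = some τ → τ.2.2 = 1 → j ∉ WSet C e)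
        (f := fun a => a.2.2 + 1) ?_ (by fun_prop)
      refine decidableIn_getElem?_imp (o := fun p : (ℕ × ℕ × ℕ) × ℕ =>
        (st p.1.2.1).2[p.2]?)
        (P := fun p τ => τ.2.2 = 1 → p.2 ∉ WSet C e) (by fun_prop) ?_
      refine DecidableIn.imp (decidableIn_eq (by fun_prop) (by fun_prop)) ?_
      exact (hW.comp (f := fun p : ((ℕ × ℕ × ℕ) × ℕ) × ℕ × ℕ × ℕ => p.1.2) (by fun_prop)).not
  obtain ⟨G', hG', hlim⟩ := (codingStrategy S e).exists_limit
  have hex : ∀ q, True → ∃ p, P (codingStrategy S e).state q p := by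
    intro q _
    obtain ⟨N, hN⟩ := S.rbit_total q
    obtain ⟨s₀, ρ, -, -, hρ⟩ := hlim N
    obtain ⟨s, hs, hset⟩ := ((eventually_ge_atTop s₀).and
      (eventually_settled (S := S) (e := e) N)).exists
    refine ⟨(s, N), ⟨ρ, (hρ s hs).1, hN _ ?_⟩, hset⟩
    have hgood := (codingStrategy S e).good_state s
    have h1 := (codingStrategy S e).length_of_good hgood (hρ s hs).1
    have h2 := (hgood.2.1 N ρ (hρ s hs).1).2.1
    simp only [List.length_take]
    omega
  obtain ⟨f, hf, hf'⟩ := DecidableIn.exists_selector (G := fun _ : ℕ => True)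
    ⟨fun _ => true, by fun_prop, by simp⟩ (hP _ hstate) hex
  refine (decidableIn_eq (f := fun q => S.rbit q ((codingStrategy S e).state (f q).1).1)
    (g := fun _ => some true) ?_ (by fun_prop)).of_iff fun q => ?_
  · exact computableIn_comp (f := fun p : ℕ × List ℕ => S.rbit p.1 p.2)
      (g := fun q => (q, ((codingStrategy S e).state (f q).1).1)) hrbit (by fun_prop)
  · obtain ⟨⟨ρ, hρ, hsome⟩, hset⟩ := hf' q trivial
    obtain ⟨b, hb⟩ := Option.isSome_iff_exists.1 hsome
    have hquiet := quiet_of_settled hρ hset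
    rw [System.rbit_of_take hb]
    rw [(codingStrategy S e).take_eq_of_quiet hG hρ hquiet] at hb
    rw [← System.rbit_limit hb]
    simp

/-- The coded c.e. set can be computed from the limit relation: when a requirement acts, the
relation changes on the part of the list it used to protect, and is not changed back. -/
theorem reducible_limitRel_of_coding
    (hG : Strategy.Converges (fun s => ((codingStrategy S e).state s).1) G) :
    DecidableIn {charFn (setJoin (S.limitRel G) C)} fun i => i ∈ WSet C e := by
  set D := setJoin (S.limitRel G) C with hD
  set T := codingStrategy S e with hT
  have hCD : SetReducible C D := System.setJoin_right_reducible _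
  have hX : DecidableIn {charFn D} fun n => n ∈ S.limitRel G :=
    setReducible_iff.1 (System.setJoin_left_reducible _)
  have hstate : ComputableIn {charFn D} T.state :=
    System.computableIn_of_reducible T.computableIn_state hCD
  have hrbit : ComputableIn {charFn D} fun p : ℕ × List ℕ => S.rbit p.1 p.2 :=
    System.computableIn_of_reducible S.rbit_comp hCD
  have hbound : ComputableIn {charFn D} S.bound :=
    System.computableIn_of_reducible S.bound_comp hCD
  -- `P st i s`: requirement `i` has a record at stage `s`, and on the parts of the list protected
  -- by the requirements up to `i` the relation agrees with the limit relation. At such a stage, `i`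
  -- is in the c.e. set if and only if requirement `i` has acted.
  let P : (ℕ → List ℕ × List (ℕ × ℕ × ℕ)) → ℕ → ℕ → Prop := fun st i s =>
    (st s).2[i]?.isSome = true ∧ ∀ j < i + 1, ∀ τ, (st s).2[j]? = some τ →
      ∀ q < S.bound τ.2.1, ∀ b, S.rbit q ((st s).1.take τ.2.1) = some b →
        (b = true ↔ q ∈ S.limitRel G)
  have hP : ∀ st, ComputableIn {charFn D} st →
      DecidableIn {charFn D} fun a : ℕ × ℕ => P st a.1 a.2 := by
    intro st hst
    refine (decidableIn_eq_true (by fun_prop)).and ?_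
    refine DecidableIn.forall_lt (P := fun (a : ℕ × ℕ) j => ∀ τ, (st a.2).2[j]? = some τ →
      ∀ q < S.bound τ.2.1, ∀ b, S.rbit q ((st a.2).1.take τ.2.1) = some b →
        (b = true ↔ q ∈ S.limitRel G)) (f := fun a => a.1 + 1) ?_ (by fun_prop)
    refine decidableIn_getElem?_imp (o := fun p : (ℕ × ℕ) × ℕ => (st p.1.2).2[p.2]?)
      (P := fun p τ => ∀ q < S.bound τ.2.1, ∀ b,
        S.rbit q ((st p.1.2).1.take τ.2.1) = some b → (b = true ↔ q ∈ S.limitRel G))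
      (by fun_prop) ?_
    refine DecidableIn.forall_lt (P := fun (p : ((ℕ × ℕ) × ℕ) × ℕ × ℕ × ℕ) q => ∀ b,
        S.rbit q ((st p.1.1.2).1.take p.2.2.1) = some b → (b = true ↔ q ∈ S.limitRel G))
        (f := fun p => S.bound p.2.2.1) ?_ (by fun_prop)
    refine decidableIn_getElem?_imp (o := fun p : (((ℕ × ℕ) × ℕ) × ℕ × ℕ × ℕ) × ℕ =>
        S.rbit p.2 ((st p.1.1.1.2).1.take p.1.2.2.1))
        (P := fun p b => b = true ↔ p.2 ∈ S.limitRel G) ?_ ?_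
    · exact computableIn_comp (f := fun p : ℕ × List ℕ => S.rbit p.1 p.2)
        (g := fun p : (((ℕ × ℕ) × ℕ) × ℕ × ℕ × ℕ) × ℕ => (p.2, (st p.1.1.1.2).1.take p.1.2.2.1))
        hrbit (by fun_prop)
    · have h1 : DecidableIn {charFn D} fun p : ((((ℕ × ℕ) × ℕ) × ℕ × ℕ × ℕ) × ℕ) × Bool =>
        p.2 = true := decidableIn_eq_true (by fun_prop)
      have h2 := hX.comp (f := fun p : ((((ℕ × ℕ) × ℕ) × ℕ × ℕ × ℕ) × ℕ) × Bool => p.1.2)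
        (by fun_prop)
      exact ((h1.imp h2).and (h2.imp h1)).of_iff fun p => iff_iff_implies_and_implies
  obtain ⟨G', hG', hlim⟩ := T.exists_limit
  have hGG : ∀ n, (List.range n).map G' = (List.range n).map G := by
    intro n
    obtain ⟨s₁, h₁⟩ := hG.2 n
    obtain ⟨s₂, h₂⟩ := hG'.2 n
    obtain ⟨w₁, e₁⟩ := h₁ (max s₁ s₂) (le_max_left _ _)
    obtain ⟨w₂, e₂⟩ := h₂ (max s₁ s₂) (le_max_right _ _)
    simp only at e₁ e₂
    rw [e₁] at e₂
    exact (List.append_inj_left e₂ (by simp)).symm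
  have hex : ∀ i, True → ∃ s, P T.state i s := by
    intro i _
    have : ∀ j ∈ Finset.range (i + 1), ∀ᶠ s in atTop, ∃ τ, (T.state s).2[j]? = some τ ∧
        (T.state s).1.take τ.2.1 = (List.range τ.2.1).map G := by
      intro j _
      obtain ⟨s₀, ρ, -, -, hρ⟩ := hlim j
      filter_upwards [eventually_ge_atTop s₀] with s hs
      refine ⟨ρ, (hρ s hs).1, ?_⟩
      obtain ⟨w, hw⟩ := (hρ s hs).2.2
      rw [hw, hGG]
      simp
    obtain ⟨s, hs⟩ := ((eventually_all_finset _).2 this).exists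
    refine ⟨s, ?_, fun j hj τ hτ q _ b hb => ?_⟩
    · obtain ⟨τ, hτ, -⟩ := hs i (Finset.self_mem_range_succ i)
      simp [hτ]
    · obtain ⟨τ', hτ', h⟩ := hs j (Finset.mem_range.2 hj)
      rw [hτ] at hτ'
      cases hτ'
      rw [h] at hb
      exact System.rbit_limit hb
  obtain ⟨f, hf, hf'⟩ := DecidableIn.exists_selector (G := fun _ : ℕ => True)
    ⟨fun _ => true, by fun_prop, by simp⟩ (hP _ hstate) hex
  refine (decidableIn_getElem?_and (o := fun i => (T.state (f i)).2[i]?)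
    (P := fun _ ρ => ¬ ρ.2.2 = 1) (by fun_prop)
    (decidableIn_eq (by fun_prop) (by fun_prop)).not).of_iff fun i => ?_
  obtain ⟨hsome, hagree⟩ := hf' i trivial
  set s := f i
  obtain ⟨ρ, hρ⟩ := Option.isSome_iff_exists.1 hsome
  have hil := (List.getElem?_eq_some_iff.1 hρ).1
  constructor
  swap
  · rintro ⟨ρ', hρ', hne⟩
    rcases ((T.good_state s).2.1 i ρ' hρ').2.2.2 with h | h
    · exact absurd h.1 hne
    · exact h.2
  intro hiW
  refine ⟨ρ, hρ, fun h1 => ?_⟩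
  -- Some requirement up to `i` acts after stage `s`. Let `j` be the least one, and `t` the first
  -- stage at which it acts.
  have hacts : ∃ j, j ≤ i ∧ ∃ t, s ≤ t ∧ ∃ τ, (T.state t).2[j]? = some τ ∧
      (T.act j t τ (T.state t).1).isSome := by
    by_contra hno
    push Not at hno
    have hquiet : ∀ u, s ≤ u → ∀ j ≤ i, ∀ τ, (T.state u).2[j]? = some τ →
        T.act j u τ (T.state u).1 = none := fun u hu j hj τ hτ => by
      simpa using hno j hj u hu τ hτ
    obtain ⟨t, ht⟩ := Set.mem_iUnion.1 hiW
    have h2 := (T.stable (le_max_left s t) hρ fun u hu _ => hquiet u hu).1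
    exact act_coding_eq_none.1 (hquiet _ (le_max_left s t) i le_rfl ρ h2)
      ⟨h1, wStage_mono (le_max_right s t) ht⟩
  classical
  obtain ⟨hji, hjt⟩ := Nat.find_spec hacts
  have hjmin := fun m (hm : m < Nat.find hacts) => Nat.find_min hacts hm
  set j := Nat.find hacts
  obtain ⟨hst, τ, hτt, hacttau⟩ := Nat.find_spec hjt
  have htmin := fun m (hm : m < Nat.find hjt) => Nat.find_min hjt hm
  set t := Nat.find hjt
  have hlow : ∀ u, s ≤ u → ∀ j' < j, ∀ τ', (T.state u).2[j']? = some τ' →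
      T.act j' u τ' (T.state u).1 = none := by
    intro u hu j' hj' τ' hτ'
    by_contra hne
    exact hjmin j' hj' ⟨by omega, u, hu, τ', hτ', Option.ne_none_iff_isSome.1 hne⟩
  have hjs := List.getElem?_eq_getElem (lt_of_le_of_lt hji hil)
  obtain ⟨h2, h3⟩ := T.stable hst hjs (fun u hu hut j' hj' τ' hτ' => by
    rcases hj'.lt_or_eq with h | rfl
    · exact hlow u hu j' h τ' hτ'
    · by_contra hne
      exact htmin u hut ⟨hu, τ', hτ', Option.ne_none_iff_isSome.1 hne⟩)
  rw [hτt] at h2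
  rw [← Option.some.inj h2] at h3 hjs
  obtain ⟨r, hr⟩ := Option.isSome_iff_exists.1 hacttau
  have hstep := T.step_of_act hτt hr (hlow t hst)
  rw [← Strategy.state_succ] at hstep
  have hgood := T.good_state t
  obtain ⟨g1, g2, -, g4⟩ := hgood.2.1 j τ hτt
  have hcond : τ.2.2 = 1 ∧ j ∈ WStage C e t := by
    by_contra hc
    rw [act_coding_eq_none.2 hc] at hr
    cases hr
  have hr' : r = (S.move τ.1 (T.state t).1 t, 0) := by
    have : T.act j t τ (T.state t).1 = some (S.move τ.1 (T.state t).1 t, 0) := by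
      rw [hT]
      simp only [codingStrategy]
      rw [if_pos hcond]
    rw [this] at hr
    exact (Option.some.inj hr).symm
  have hadm : S.Adm τ.1 ((T.state t).1.take τ.2.1) := by
    rcases g4 with h | h
    · exact h.2
    · omega
  have hfind : ∀ a ∈ S.findA ((T.state t).1.take τ.1), a ∈ (T.state t).1.take τ.2.1 := by
    intro a ha
    refine hadm.2.2 a ?_
    rwa [List.take_take, min_eq_left g1]
  obtain ⟨q, hq⟩ := S.rbit_move (s := t) hgood.1 (g1.trans g2)
    (fun a ha => List.take_subset _ _ (hfind a ha)) τ.2.1 g1 g2 hfind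
  have hlen : (S.move τ.1 (T.state t).1 t).length = (T.state t).1.length :=
    S.length_move hgood.1 (g1.trans g2) fun a ha => List.take_subset _ _ (hfind a ha)
  obtain ⟨b, hb, hb'⟩ := System.exists_of_rbit_ne (by simp [hlen]) hq
  have hx' : (T.state (t + 1)).1 = S.move τ.1 (T.state t).1 t := by rw [hstep, hr']
  have hj' : (T.state (t + 1)).2[j]? = some (τ.1, r.1.length, r.2) := by
    rw [hstep]
    simp [Strategy.getElem?_take_append (List.getElem?_eq_some_iff.1 hτt).1]
  -- Requirement `j` has no action left after stage `t`, so its change of the relation is final and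
  -- contradicts the agreement with the limit relation at stage `s`.
  have hquiet : ∀ u, t + 1 ≤ u → ∀ j' ≤ j, ∀ τ', (T.state u).2[j']? = some τ' →
      T.act j' u τ' (T.state u).1 = none := by
    intro u
    induction u using Nat.strong_induction_on with
    | _ u ihu =>
      intro hu j' hjj τ' hτ'
      rcases hjj.lt_or_eq with h | rfl
      · exact hlow u (by omega) j' h τ' hτ'
      · have := (T.stable hu hj' fun v h1 h2 => ihu v h2 h1).1
        rw [this] at hτ'
        cases hτ'
        refine act_coding_eq_none.2 fun h => ?_
        rw [hr'] at h
        simp at h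
  have hfin := T.take_eq_of_quiet hG hj' hquiet
  rw [hx', hr'] at hfin
  simp only [List.take_length] at hfin
  have hbG : S.rbit q ((List.range (S.move τ.1 (T.state t).1 t).length).map G) = some (!b) := by
    rw [← hfin]
    exact System.rbit_of_take hb'
  have hlimit := System.rbit_limit hbG
  have hqb : q < S.bound τ.2.1 := by
    cases b with
    | true =>
      have := S.rbit_bound hb
      rwa [List.length_take, min_eq_left g2] at this
    | false =>
      have := S.rbit_bound (x := (S.move τ.1 (T.state t).1 t).take τ.2.1) (by simpa using hb')
      rwa [List.length_take, hlen, min_eq_left g2] at this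
  have := hagree j (by omega) τ hjs q hqb b (by rw [← h3]; exact hb)
  rw [← hlimit] at this
  cases b <;> simp at this

/-- Every c.e. degree is the degree of the relation in some copy. -/
theorem System.exists_coding (S : System C) (e : ℕ) : ∃ x G, S.Presents x G ∧
    SetReducible (setJoin (S.limitRel G) C) (setJoin (WSet C e) C) ∧
    SetReducible (setJoin (WSet C e) C) (setJoin (S.limitRel G) C) := by
  obtain ⟨G, hG, -⟩ := (codingStrategy S e).exists_limit
  refine ⟨_, G, (codingStrategy S e).presents hG, ?_, ?_⟩ <;> rw [setReducible_iff]
  · exact decidableIn_setJoin (by fun_prop)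
      ((limitRel_reducible_of_coding hG).comp (f := fun j : ℕ => j / 2) (by fun_prop))
      ((setReducible_iff.1 (setJoin_right_reducible _)).comp (f := fun j : ℕ => j / 2)
        (by fun_prop))
  · exact decidableIn_setJoin (by fun_prop)
      ((reducible_limitRel_of_coding hG).comp (f := fun j : ℕ => j / 2) (by fun_prop))
      ((setReducible_iff.1 (setJoin_right_reducible _)).comp (f := fun j : ℕ => j / 2)
        (by fun_prop))

end Coding

/-! ### Avoiding the c.e. degrees -/

section Avoiding

variable {C : Set ℕ} (S : System C)

/-- The triple of indices coded by `i`: of a c.e. set, of a reduction to it, and of a reduction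
from it. -/
def idx (i : ℕ) : ℕ × ℕ × ℕ := (i.unpair.1, i.unpair.2.unpair.1, i.unpair.2.unpair.2)

/-- The evidence, available at stage `s` with the list `x`, that the c.e. set and the limit relation
compute each other: the first `n` elements of the c.e. set determine bit `q` of the relation, and
are in turn determined by the first `p` bits of the join of the relation with `C`. -/
def Evidence (i s : ℕ) (x : List ℕ) (q n p : ℕ) : Prop :=
  ev s (idx i).2.1 (pre (WStage C (idx i).1 s) n) (2 * q) = some (chi (S.bits x) q) ∧
    (∀ j < p, (S.rbit (j / 2) x).isSome = true) ∧
    ∀ y < n, ev s (idx i).2.2 (pre (setJoin (S.bits x) C) p) y =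
      some (chi (WStage C (idx i).1 s) y)

/-- The number `t` codes a bit `q`, which is to change if the list `x` is replaced by `y`, together
with evidence for it. -/
def GoodTriple (i s len : ℕ) (x y : List ℕ) (t : ℕ) : Prop :=
  S.rbit (idx t).1 (x.take len) ≠ S.rbit (idx t).1 (y.take len) ∧
    Evidence S i s x (idx t).1 (idx t).2.1 (idx t).2.2

open Classical in
/-- The least good triple, or `s` if there is none below `s`. -/
noncomputable def leastTriple (i s len : ℕ) (x y : List ℕ) : ℕ :=
  Nat.find (p := fun t => s ≤ t ∨ GoodTriple S i s len x y t) ⟨s, Or.inl le_rfl⟩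

/-- The input `(k, xold, s₀, x, s)` describes a change of `xold` at stage `s₀` that may be undone at
stage `s`, at which the list is `x`. -/
def Returnable (a : ℕ × List ℕ × ℕ × List ℕ × ℕ) : Prop :=
  S.Adm a.1 a.2.1 ∧ a.2.2.2.1.take a.2.1.length = S.move a.1 a.2.1 a.2.2.1 ∧
    a.2.1.length ≤ a.2.2.2.1.length ∧ a.2.2.2.1.Nodup

/-- The list `y` undoes the change described by `(k, xold, s₀, x, s)`. -/
def Undoes (a : ℕ × List ℕ × ℕ × List ℕ × ℕ) (y : List ℕ) : Prop :=
  S.Eqv a.2.2.2.2 a.1 a.2.2.2.1 y ∧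
    ∀ q < S.bound a.2.1.length, S.rbit q (y.take a.2.1.length) = S.rbit q a.2.1

theorem computableIn_idx {α : Type*} [Primcodable α] {O : Set (ℕ →. ℕ)} {f : α → ℕ}
    (hf : ComputableIn O f) : ComputableIn O fun a => idx (f a) := by
  unfold idx
  fun_prop

theorem decidableIn_evidence {α : Type*} [Primcodable α] {i s q n p : α → ℕ} {x : α → List ℕ}
    (hi : ComputableIn {charFn C} i) (hs : ComputableIn {charFn C} s)
    (hx : ComputableIn {charFn C} x) (hq : ComputableIn {charFn C} q)
    (hn : ComputableIn {charFn C} n) (hp : ComputableIn {charFn C} p) :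
    DecidableIn {charFn C} fun a => Evidence S (i a) (s a) (x a) (q a) (n a) (p a) := by
  classical
  have hidx := computableIn_idx hi
  have hchi : ComputableIn {charFn C} fun a => chi (S.bits (x a)) (q a) := by
    convert computableIn_ite (System.decidableIn_bits (S := S) hq hx) (computableIn_const 1)
      (computableIn_const 0) using 2
    simp only [chi]
  have hpre : ComputableIn {charFn C} fun a => pre (setJoin (S.bits (x a)) C) (p a) := by
    refine computableIn_pre (X := fun a => setJoin (S.bits (x a)) C) ?_ hp
    refine decidableIn_setJoin (X := fun p : α × ℕ => S.bits (x p.1)) (Y := fun _ => C)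
      (j := fun p => p.2) (by fun_prop)
      (System.decidableIn_bits (q := fun p : α × ℕ => p.2 / 2) (x := fun p => x p.1)
        (by fun_prop) (by fun_prop)) ?_
    exact (setReducible_iff.1 (TuringReducible.refl (charFn C))).comp
      (f := fun p : α × ℕ => p.2 / 2) (by fun_prop)
  refine DecidableIn.and ?_ (DecidableIn.and ?_ ?_)
  · exact decidableIn_eq (by fun_prop) (by fun_prop)
  · exact DecidableIn.forall_lt (P := fun a j => (S.rbit (j / 2) (x a)).isSome = true)
      (decidableIn_eq_true (by fun_prop)) hp
  · refine DecidableIn.forall_lt (P := fun a y =>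
      ev (s a) (idx (i a)).2.2 (pre (setJoin (S.bits (x a)) C) (p a)) y =
        some (chi (WStage C (idx (i a)).1 (s a)) y)) (decidableIn_eq ?_ ?_) hn
    · have hpre' : ComputableIn {charFn C} fun b : α × ℕ =>
          pre (setJoin (S.bits (x b.1)) C) (p b.1) :=
        computableIn_comp (f := fun a => pre (setJoin (S.bits (x a)) C) (p a)) (g := Prod.fst) hpre
          computableIn_fst
      exact computableIn_ev (s := fun b : α × ℕ => s b.1) (e := fun b => (idx (i b.1)).2.2)
        (x := fun b => b.2) (by fun_prop) (by fun_prop) hpre' (by fun_prop)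
    · refine computableIn_some ?_
      convert computableIn_ite (decidableIn_wStage (C := C) (e := fun p : α × ℕ => (idx (i p.1)).1)
        (s := fun p => s p.1) (x := fun p => p.2) (by fun_prop) (by fun_prop) (by fun_prop))
        (computableIn_const 1) (computableIn_const 0) using 2
      simp only [chi]

theorem computableIn_leastTriple {α : Type*} [Primcodable α] {i s len : α → ℕ} {x y : α → List ℕ}
    (hi : ComputableIn {charFn C} i) (hs : ComputableIn {charFn C} s)
    (hlen : ComputableIn {charFn C} len)
    (hx : ComputableIn {charFn C} x) (hy : ComputableIn {charFn C} y) :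
    ComputableIn {charFn C} fun a => leastTriple S (i a) (s a) (len a) (x a) (y a) := by
  classical
  have := DecidableIn.find (O := {charFn C}) (α := α)
    (P := fun a t => s a ≤ t ∨ GoodTriple S (i a) (s a) (len a) (x a) (y a) t) ?_
    (fun a => ⟨s a, Or.inl le_rfl⟩)
  · convert this using 2
    unfold leastTriple
    congr
  · have hidx : ComputableIn {charFn C} fun p : α × ℕ => idx p.2 :=
      computableIn_idx computableIn_snd
    refine (decidableIn_le (f := fun p : α × ℕ => s p.1) (g := fun p => p.2) (by fun_prop)
      (by fun_prop)).or (DecidableIn.and (decidableIn_eq (by fun_prop) (by fun_prop)).not ?_)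
    exact decidableIn_evidence S (i := fun p : α × ℕ => i p.1) (s := fun p => s p.1)
      (x := fun p => x p.1) (q := fun p => (idx p.2).1) (n := fun p => (idx p.2).2.1)
      (p := fun p => (idx p.2).2.2) (by fun_prop) (by fun_prop) (by fun_prop) (by fun_prop)
      (by fun_prop) (by fun_prop)

/-- Changes of the relation can be undone by a procedure computable from `C`. -/
theorem exists_undo : ∃ f : ℕ × List ℕ × ℕ × List ℕ × ℕ → List ℕ, ComputableIn {charFn C} f ∧
    ∀ a, Returnable S a → Undoes S a (f a) := by
  refine DecidableIn.exists_selector ?_ ?_ ?_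
  · refine DecidableIn.and (System.decidableIn_adm (by fun_prop) (by fun_prop))
      (DecidableIn.and (decidableIn_eq (by fun_prop) (by fun_prop))
        (DecidableIn.and (decidableIn_le (by fun_prop) (by fun_prop))
          (System.decidableIn_nodup (by fun_prop))))
  · have hb := S.bound_comp
    refine DecidableIn.and (DecidableIn.and (decidableIn_eq (by fun_prop) (by fun_prop))
      (DecidableIn.and (System.decidableIn_nodup (by fun_prop))
        (DecidableIn.and (decidableIn_eq (by fun_prop) (by fun_prop)) ?_))) ?_
    · exact DecidableIn.forall_lt
        (P := fun (p : (ℕ × List ℕ × ℕ × List ℕ × ℕ) × List ℕ) q =>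
          S.fact q p.2 = S.fact q p.1.2.2.2.1) (f := fun p => p.1.2.2.2.2)
        (decidableIn_eq (by fun_prop) (by fun_prop)) (by fun_prop)
    · exact DecidableIn.forall_lt
        (P := fun (p : (ℕ × List ℕ × ℕ × List ℕ × ℕ) × List ℕ) q =>
          S.rbit q (p.2.take p.1.2.1.length) = S.rbit q p.1.2.1)
        (f := fun p => S.bound p.1.2.1.length)
        (decidableIn_eq (by fun_prop) (by fun_prop)) (by fun_prop)
  · rintro ⟨k, z, s₀, x, s⟩ ⟨hadm, htake, hle, hnd⟩
    simp only at hadm htake hle hnd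
    have hx : x = S.move k z s₀ ++ x.drop z.length := by rw [← htake, List.take_append_drop]
    obtain ⟨y, h1, h2, h3, h4, h5⟩ := S.return_move (s := s₀) hadm.1 hadm.2.1 hadm.2.2
      (x.drop z.length) s (by rwa [← hx])
    rw [← hx] at h1 h3 h4
    exact ⟨y, ⟨h1, h2, h3, h4⟩, fun q _ => h5 q⟩

variable {S}

theorem Undoes.rbit_eq {a : ℕ × List ℕ × ℕ × List ℕ × ℕ} {y : List ℕ} (h : Undoes S a y)
    (ha : Returnable S a) (q : ℕ) : S.rbit q (y.take a.2.1.length) = S.rbit q a.2.1 := by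
  by_contra hne
  have hl : (y.take a.2.1.length).length = a.2.1.length := by
    have h1 := h.1.1
    have h2 := ha.2.2.1
    simp only [List.length_take]
    omega
  obtain ⟨b, hb, hb'⟩ := System.exists_of_rbit_ne hl hne
  refine hne (h.2 q ?_)
  cases b with
  | true => have := S.rbit_bound hb; rwa [hl] at this
  | false => exact S.rbit_bound (by simpa using hb')

/-- What requirement `i` knows after it has changed the relation at stage `s₀`, when the list was
`z₀`: the bit `q`, the number `n` of elements of the c.e. set, and the evidence. -/
def Memory (S : System C) (i : ℕ) (z₀ : List ℕ) (s₀ n q p : ℕ) : Prop :=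
  (S.rbit q z₀).isSome = true ∧ Evidence S i s₀ z₀ q n p

open Classical in
/-- Requirement `i` says that the limit relation, joined with `C`, does not compute and is not
computed by the c.e. set with index `(idx i).1` by means of the functionals with the other two
indices. It waits for evidence to the contrary, and then changes a bit. The functionals can only
cope if a new element enters the c.e. set below the use. If this happens, requirement `i` undoes the
change, and the reduction of the c.e. set to the relation fails for good. The first entry of the
memory counts the actions left. -/
noncomputable def avoidingStrategy (undo : ℕ × List ℕ × ℕ × List ℕ × ℕ → List ℕ)
    (hundo : ComputableIn {charFn C} undo) (hundo' : ∀ a, Returnable S a → Undoes S a (undo a)) :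
    Strategy S (ℕ × List ℕ × ℕ × ℕ) where
  init := (2, [], 0, 0)
  act i s ρ x :=
    if ρ.2.2.1 = 2 ∧ leastTriple S i s ρ.2.1 x (S.move ρ.1 x s) < s then
      some (S.move ρ.1 x s,
        (1, x, s, (idx (leastTriple S i s ρ.2.1 x (S.move ρ.1 x s))).2.1))
    else if (ρ.2.2.1 = 1 ∧ ρ.2.2.2.2.1 ≤ s) ∧ ¬ pre (WStage C (idx i).1 s) ρ.2.2.2.2.2 =
        pre (WStage C (idx i).1 ρ.2.2.2.2.1) ρ.2.2.2.2.2 then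
      some (undo (ρ.1, ρ.2.2.2.1, ρ.2.2.2.2.1, x, s), (0, ρ.2.2.2))
    else none
  act_comp := by
    have h1 : ComputableIn {charFn C}
        fun p : ℕ × ℕ × (ℕ × ℕ × ℕ × List ℕ × ℕ × ℕ) × List ℕ =>
          leastTriple S p.1 p.2.1 p.2.2.1.2.1 p.2.2.2 (S.move p.2.2.1.1 p.2.2.2 p.2.1) :=
      computableIn_leastTriple S (by fun_prop) (by fun_prop) (by fun_prop) (by fun_prop)
        (by fun_prop)
    have h2 := computableIn_idx h1
    have h3 : ComputableIn {charFn C}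
        fun p : ℕ × ℕ × (ℕ × ℕ × ℕ × List ℕ × ℕ × ℕ) × List ℕ => idx p.1 :=
      computableIn_idx (by fun_prop)
    refine computableIn_ite ((decidableIn_eq (by fun_prop) (by fun_prop)).and
      (decidableIn_lt h1 (by fun_prop))) (by fun_prop) ?_
    refine computableIn_ite (((decidableIn_eq (by fun_prop) (by fun_prop)).and
      (decidableIn_le (by fun_prop) (by fun_prop))).and
      (decidableIn_eq (by fun_prop) (by fun_prop)).not) ?_ (by fun_prop)
    refine computableIn_some (computableIn_pair ?_ (by fun_prop))
    exact computableIn_comp (f := undo)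
      (g := fun p : ℕ × ℕ × (ℕ × ℕ × ℕ × List ℕ × ℕ × ℕ) × List ℕ =>
        (p.2.2.1.1, p.2.2.1.2.2.2.1, p.2.2.1.2.2.2.2.1, p.2.2.2, p.2.1)) hundo (by fun_prop)
  rank d := d.1
  Inv i k z d :=
    (d.1 = 2 ∧ S.Adm k z) ∨
    (d.1 = 1 ∧ S.Adm k d.2.1 ∧ z = S.move k d.2.1 d.2.2.1 ∧
      ∃ q p b, Memory S i d.2.1 d.2.2.1 d.2.2.2 q p ∧ S.rbit q d.2.1 = some b ∧
        S.rbit q z = some (!b)) ∨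
    (d.1 = 0 ∧ (∀ q, S.rbit q (z.take d.2.1.length) = S.rbit q d.2.1) ∧
      (∃ q p, Memory S i d.2.1 d.2.2.1 d.2.2.2 q p) ∧
      ∃ t ≥ d.2.2.1, pre (WStage C (idx i).1 t) d.2.2.2 ≠ pre (WStage C (idx i).1 d.2.2.1) d.2.2.2)
  inv_init h := Or.inl ⟨rfl, h⟩
  act_spec := by
    rintro i s k len ⟨c, z₀, s₀, n⟩ x x' d' hx hk hlen hinv hact
    simp only at hact
    split_ifs at hact with h1 h2
    · simp only [Option.some.injEq, Prod.mk.injEq] at hact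
      obtain ⟨rfl, rfl⟩ := hact
      obtain ⟨rfl, hlt⟩ := h1
      rcases hinv with ⟨-, hadm⟩ | ⟨h, -⟩ | ⟨h, -⟩
      · have hadm' : S.Adm k x := ⟨hx, hk.trans hlen, fun a ha => by
          refine List.take_subset len x (hadm.2.2 a ?_)
          rwa [List.take_take, min_eq_left hk]⟩
        refine ⟨hadm'.eqv_move s, by simp, Or.inr (Or.inl ⟨rfl, hadm', rfl, ?_⟩)⟩
        have hgood : GoodTriple S i s len x (S.move k x s)
            (leastTriple S i s len x (S.move k x s)) := by
          have := Nat.find_spec (p := fun t => s ≤ t ∨ GoodTriple S i s len x (S.move k x s) t)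
            ⟨s, Or.inl le_rfl⟩
          rcases this with h | h
          · exact absurd hlt (by unfold leastTriple; omega)
          · exact h
        obtain ⟨hne, hev⟩ := hgood
        have hlm := (hadm'.eqv_move s).1
        obtain ⟨b, hb, hb'⟩ := System.exists_of_rbit_ne (by simp [hlm]) hne
        have hbx := System.rbit_of_take hb
        exact ⟨_, _, b, ⟨by simp [hbx], hev⟩, hbx, System.rbit_of_take hb'⟩
      · simp at h
      · simp at h
    · simp only [Option.some.injEq, Prod.mk.injEq] at hact
      obtain ⟨rfl, rfl⟩ := hact
      obtain ⟨⟨rfl, hs⟩, hne⟩ := h2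
      rcases hinv with ⟨h, -⟩ | ⟨-, hadm, hz, q, p, b, hmem, -⟩ | ⟨h, -⟩
      · simp at h
      · simp only at hadm hz hmem
        have hlm := (hadm.eqv_move s₀).1
        have hll : len = z₀.length := by
          have := congrArg List.length hz
          rw [hlm, List.length_take] at this
          omega
        have hret : Returnable S (k, z₀, s₀, x, s) :=
          ⟨hadm, by simp only; rw [← hz, hll], by simp only; omega, hx⟩
        have hun := hundo' _ hret
        exact ⟨hun.1, by simp, Or.inr (Or.inr ⟨rfl, hun.rbit_eq hret, ⟨q, p, hmem⟩, s, hs, hne⟩)⟩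
      · simp at h

theorem chi_setJoin_two_mul {X Y : Set ℕ} {q : ℕ} : chi (setJoin X Y) (2 * q) = chi X q :=
  chi_congr two_mul_mem_setJoin

theorem pre_bits_eq {z w : List ℕ} {N p : ℕ} {G : ℕ → ℕ} (hz : z = (List.range N).map G ++ w)
    (h : ∀ j < p, (S.rbit (j / 2) ((List.range N).map G)).isSome = true) :
    pre (setJoin (S.bits z) C) p = pre (setJoin (S.limitRel G) C) p := by
  refine pre_congr fun j hj => ?_
  rw [mem_setJoin, mem_setJoin, hz]
  split_ifs
  · exact System.mem_bits_iff_limit (h j hj)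
  · rfl

/-- If the limit relation had the degree of a c.e. set, evidence for this would turn up. -/
theorem eventually_evidence {e e₁ e₂ : ℕ} {G : ℕ → ℕ} {x : ℕ → List ℕ}
    (hG : Strategy.Converges x G)
    (h₁ : ∀ a, ∃ n₀, ∀ n ≥ n₀, ∃ s₀, ∀ s ≥ s₀, ev s e₁ (pre (WSet C e) n) a =
      some (chi (setJoin (S.limitRel G) C) a))
    (h₂ : ∀ a, ∃ n₀, ∀ n ≥ n₀, ∃ s₀, ∀ s ≥ s₀, ev s e₂ (pre (setJoin (S.limitRel G) C) n) a =
      some (chi (WSet C e) a)) (B : ℕ) :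
    ∃ n p, ∀ᶠ s in atTop, ∀ q < B,
      Evidence S (Nat.pair e (Nat.pair e₁ e₂)) s (x s) q n p := by
  have hev₁ : ∀ᶠ n in atTop, ∀ q ∈ Finset.range B, ∀ᶠ s in atTop,
      ev s e₁ (pre (WSet C e) n) (2 * q) = some (chi (setJoin (S.limitRel G) C) (2 * q)) := by
    refine (eventually_all_finset _).2 fun q _ => ?_
    obtain ⟨n₀, hn₀⟩ := h₁ (2 * q)
    filter_upwards [eventually_ge_atTop n₀] with n hn
    obtain ⟨s₀, hs₀⟩ := hn₀ n hn
    filter_upwards [eventually_ge_atTop s₀] with s hs using hs₀ s hs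
  obtain ⟨n, hn⟩ := hev₁.exists
  have hev₂ : ∀ᶠ p in atTop, ∀ a ∈ Finset.range n, ∀ᶠ s in atTop,
      ev s e₂ (pre (setJoin (S.limitRel G) C) p) a = some (chi (WSet C e) a) := by
    refine (eventually_all_finset _).2 fun a _ => ?_
    obtain ⟨n₀, hn₀⟩ := h₂ a
    filter_upwards [eventually_ge_atTop n₀] with n hn
    obtain ⟨s₀, hs₀⟩ := hn₀ n hn
    filter_upwards [eventually_ge_atTop s₀] with s hs using hs₀ s hs
  obtain ⟨p, hp⟩ := hev₂.exists
  have hdef : ∀ᶠ N in atTop, ∀ j ∈ Finset.range (max p (2 * B)),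
      (S.rbit (j / 2) ((List.range N).map G)).isSome = true := by
    refine (eventually_all_finset _).2 fun j _ => ?_
    obtain ⟨N, hN⟩ := S.rbit_total (j / 2)
    filter_upwards [eventually_ge_atTop N] with N' hN'
    exact hN _ (by simpa using hN')
  obtain ⟨N, hN⟩ := hdef.exists
  obtain ⟨s₁, hs₁⟩ := hG.2 N
  obtain ⟨s₂, hs₂⟩ := exists_pre_wStage_eq C e n
  refine ⟨n, p, ?_⟩
  filter_upwards [(eventually_all_finset _).2 hn, (eventually_all_finset _).2 hp,
    eventually_ge_atTop s₁, eventually_ge_atTop s₂] with s h3 h4 h5 h6 q hq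
  obtain ⟨w, hw⟩ := hs₁ s h5
  have hsome : ∀ j < max p (2 * B), (S.rbit (j / 2) ((List.range N).map G)).isSome = true :=
    fun j hj => hN j (Finset.mem_range.2 hj)
  refine ⟨?_, fun j hj => ?_, fun y hy => ?_⟩
  · simp only [idx, Nat.unpair_pair]
    rw [hs₂ s h6, h3 q (Finset.mem_range.2 hq), chi_setJoin_two_mul, hw]
    refine congrArg some (chi_congr (System.mem_bits_iff_limit ?_).symm)
    have := hsome (2 * q) (by omega)
    rwa [show 2 * q / 2 = q by omega] at this
  · obtain ⟨b, hb⟩ := Option.isSome_iff_exists.1 (hsome j (by omega))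
    rw [hw, S.rbit_append w hb]
    rfl
  · simp only [idx, Nat.unpair_pair]
    rw [pre_bits_eq hw fun j hj => hsome j (by omega), h4 y (Finset.mem_range.2 hy)]
    exact congrArg some (chi_congr (mem_iff_of_pre_eq (hs₂ s h6) hy).symm)

/-- There is a copy in which the relation does not have the degree of a c.e. set. -/
theorem System.exists_avoiding (S : System C) : ∃ x G, S.Presents x G ∧
    ∀ e, SetReducible (setJoin (S.limitRel G) C) (WSet C e) →
      ¬ SetReducible (WSet C e) (setJoin (S.limitRel G) C) := by
  obtain ⟨undo, hundo, hundo'⟩ := exists_undo S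
  set T := avoidingStrategy undo hundo hundo' with hT
  obtain ⟨G, hG, hlim⟩ := T.exists_limit
  refine ⟨_, G, T.presents hG, fun e hred₁ hred₂ => ?_⟩
  obtain ⟨e₁, h₁, h₁'⟩ := exists_index_of_setReducible hred₁
  obtain ⟨e₂, h₂, h₂'⟩ := exists_index_of_setReducible hred₂
  have hidx : idx (Nat.pair e (Nat.pair e₁ e₂)) = (e, e₁, e₂) := by simp [idx]
  obtain ⟨sfin, ⟨k, len, c, z₀, s₀, n⟩, hk, hinv, hfin⟩ := hlim (Nat.pair e (Nat.pair e₁ e₂))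
  simp only at hk hinv hfin
  have hact : ∀ t ≥ sfin, ¬ (c = 2 ∧ leastTriple S (Nat.pair e (Nat.pair e₁ e₂)) t len
      (T.state t).1 (S.move k (T.state t).1 t) < t) ∧
      ¬ ((c = 1 ∧ s₀ ≤ t) ∧ ¬ pre (WStage C e t) n = pre (WStage C e s₀) n) := by
    intro t ht
    have := (hfin t ht).2.1
    rw [hT] at this
    simp only [avoidingStrategy, hidx] at this
    split_ifs at this with g1 g2
    exact ⟨g1, g2⟩
  rcases hinv with ⟨hc, hadm⟩ | ⟨hc, hadm, hz, q, p, b, ⟨-, hev⟩, hb, hb'⟩ |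
    ⟨hc, hbits, ⟨q, p, -, hev⟩, t, ht, hne⟩
  · -- The relation has not been changed: evidence turns up, and the requirement acts again. The
    -- bound on `q` makes finitely many triples suffice, so that the search below `t` finds one.
    simp only at hc
    obtain ⟨n', p', hev⟩ := eventually_evidence hG h₁' h₂' (S.bound len)
    have hlarge : ∀ᶠ s in atTop, ∀ q ∈ Finset.range (S.bound len),
        Nat.pair q (Nat.pair n' p') < s :=
      (eventually_all_finset _).2 fun q _ => eventually_gt_atTop _
    obtain ⟨t, ⟨htev, htl⟩, htf⟩ := ((hev.and hlarge).and (eventually_ge_atTop sfin)).exists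
    refine (hact t htf).1 ⟨hc, ?_⟩
    obtain ⟨w, hw⟩ := (hfin t htf).2.2
    have htake : (T.state t).1.take len = (List.range len).map G := by rw [hw]; simp
    have hnd := (T.good_state t).1
    have hlen : len ≤ (T.state t).1.length := by rw [hw]; simp
    have hkt : (T.state t).1.take k = ((List.range len).map G).take k := by
      rw [← htake, List.take_take, min_eq_left hk]
    have hfind : ∀ a ∈ S.findA ((T.state t).1.take k), a ∈ (T.state t).1.take len := by
      intro a ha
      rw [hkt] at ha
      rw [htake]
      exact hadm.2.2 a ha
    have hfind' : ∀ a ∈ S.findA ((T.state t).1.take k), a ∈ (T.state t).1 :=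
      fun a ha => List.take_subset _ _ (hfind a ha)
    obtain ⟨q, hq⟩ := S.rbit_move (s := t) hnd (hk.trans hlen) hfind' len hk hlen hfind
    have hlm := S.length_move (s := t) hnd (hk.trans hlen) hfind'
    have hqb : q < S.bound len := by
      obtain ⟨b, hb, hb'⟩ := System.exists_of_rbit_ne (by simp [hlm]) hq
      cases b with
      | true =>
        have := S.rbit_bound hb
        rwa [List.length_take, min_eq_left hlen] at this
      | false =>
        have := S.rbit_bound (x := (S.move k (T.state t).1 t).take len) (by simpa using hb')
        rwa [List.length_take, hlm, min_eq_left hlen] at this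
    refine lt_of_le_of_lt ?_ (htl q (Finset.mem_range.2 hqb))
    classical
    unfold leastTriple
    refine Nat.find_min' _ (Or.inr ⟨?_, ?_⟩)
    · simpa [idx] using hq
    · simpa [idx] using htev q hqb
  · -- The change stands, so the c.e. set has not changed below `n`: the first functional still
    -- gives the old value of bit `q`.
    simp only at hc hadm hz hev hb hb'
    obtain ⟨hev, -, -⟩ := hev
    rw [hidx] at hev
    simp only at hev
    obtain ⟨s₁, hs₁⟩ := exists_pre_wStage_eq C e n
    have hpre : pre (WStage C e s₀) n = pre (WSet C e) n := by
      rw [← hs₁ (max (max sfin s₀) s₁) (by omega)]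
      by_contra hne
      exact (hact (max (max sfin s₀) s₁) (by omega)).2 ⟨⟨hc, by omega⟩, fun h => hne h.symm⟩
    rw [hpre] at hev
    have h3 := h₁ _ _ _ _ hev
    rw [chi_setJoin_two_mul, chi_eq_chi, System.mem_bits_iff hb, ← System.rbit_limit hb'] at h3
    cases b <;> simp at h3
  · -- The change is undone: from the old bits of the relation, the second functional computes the
    -- old initial segment of the c.e. set, to which this set can not return.
    simp only at hc hbits hev hne
    obtain ⟨-, hdef, hev⟩ := hev
    rw [hidx] at hev hne
    simp only at hev hne ht
    refine pre_wSet_ne ht hne (pre_congr fun y hy => ?_)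
    have hp : pre (setJoin (S.bits z₀) C) p = pre (setJoin (S.limitRel G) C) p := by
      refine pre_congr fun j hj => ?_
      rw [mem_setJoin, mem_setJoin]
      split_ifs
      · obtain ⟨b, hb⟩ := Option.isSome_iff_exists.1 (hdef j hj)
        rw [System.mem_bits_iff hb]
        rw [← hbits] at hb
        exact System.rbit_limit (System.rbit_of_take hb)
      · rfl
    have h3 := hev y hy
    rw [hp] at h3
    exact (chi_eq_chi.1 (h₂ _ _ _ _ h3)).symm

end Avoiding

/-! ### Facts and tuples of positions in finite lists -/

section Codes

/-- The value of the list `x` at the positions in `l`. -/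
def valuesAt (x l : List ℕ) : List ℕ := l.map fun i => x.getD i 0

theorem valuesAt_append {x l : List ℕ} (h : ∀ i ∈ l, i < x.length) (w : List ℕ) :
    valuesAt (x ++ w) l = valuesAt x l :=
  List.map_congr_left fun i hi => List.getD_append _ _ _ _ (h i hi)

theorem getD_map_range {G : ℕ → ℕ} {N i : ℕ} (h : i < N) :
    ((List.range N).map G).getD i 0 = G i := by
  simp [List.getD_eq_getElem?_getD, h]

theorem valuesAt_range {G : ℕ → ℕ} {N : ℕ} {l : List ℕ} (h : ∀ i ∈ l, i < N) :
    valuesAt ((List.range N).map G) l = l.map G :=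
  List.map_congr_left fun i hi => getD_map_range (h i hi)

variable {α β γ σ : Type*} [Primcodable α] [Primcodable β] [Primcodable γ] [Primcodable σ]
variable {O : Set (ℕ →. ℕ)}

@[fun_prop]
theorem computableIn_listGetD {f : α → List ℕ} {g : α → ℕ} (hf : ComputableIn O f)
    (hg : ComputableIn O g) : ComputableIn O fun a => (f a).getD (g a) 0 :=
  computableIn_of_primrec₂ (Primrec.list_getD 0) hf hg

@[fun_prop]
theorem computableIn_valuesAt {f g : α → List ℕ} (hf : ComputableIn O f) (hg : ComputableIn O g) :
    ComputableIn O fun a => valuesAt (f a) (g a) :=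
  computableIn_listMap (g := fun a i => (f a).getD i 0) hg (by fun_prop)

theorem computableIn_sumElim {o : α → β ⊕ γ} {f : α → β → σ} {g : α → γ → σ}
    (ho : ComputableIn O o) (hf : ComputableIn O fun p : α × β => f p.1 p.2)
    (hg : ComputableIn O fun p : α × γ => g p.1 p.2) :
    ComputableIn O fun a => Sum.elim (f a) (g a) (o a) := by
  have hl : Primrec (fun s : β ⊕ γ => (Sum.elim some (fun _ => none) s : Option β)) :=
    (Primrec.sumCasesOn (f := fun s : β ⊕ γ => s) (g := fun _ b => some b) (h := fun _ _ => none)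
      Primrec.id (Primrec.option_some.comp Primrec.snd) (Primrec.const _)).of_eq
      fun s => by cases s <;> rfl
  have hr : Primrec (fun s : β ⊕ γ => (Sum.elim (fun _ => none) some s : Option γ)) :=
    (Primrec.sumCasesOn (f := fun s : β ⊕ γ => s) (g := fun _ _ => none) (h := fun _ b => some b)
      Primrec.id (Primrec.const _) (Primrec.option_some.comp Primrec.snd)).of_eq
      fun s => by cases s <;> rfl
  have hfo : ComputableIn O fun a =>
      (Sum.elim some (fun _ => none) (o a) : Option β).elim none fun b => some (f a b) :=
    computableIn_optionElim (g := fun a b => some (f a b)) (computableIn_of_primrec hl ho)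
      (computableIn_const _) (computableIn_some hf)
  have hgo : ComputableIn O fun a =>
      (Sum.elim (fun _ => none) some (o a) : Option γ).elim none fun b => some (g a b) :=
    computableIn_optionElim (g := fun a b => some (g a b)) (computableIn_of_primrec hr ho)
      (computableIn_const _) (computableIn_some hg)
  have hor := computableIn_of_primrec₂ (Primrec.option_orElse (α := σ)) hfo hgo
  have : ComputableIn O fun a => some (Sum.elim (f a) (g a) (o a)) := by
    convert hor using 2 with a
    cases o a <;> rfl
  unfold ComputableIn RecursiveIn at this ⊢
  have hpred : Nat.RecursiveIn O fun n => Part.some (Nat.pred n) :=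
    Nat.Primrec.recursiveIn Nat.Primrec.pred
  refine (Nat.RecursiveIn.comp hpred this).of_eq fun n => ?_
  cases decode (α := α) n <;> simp

variable (L : FirstOrder.Language.{u, v})

/-- Codes of unnested atomic formulas about positions in a list: `f (x_{l₁}, …) = x_j` and
`r (x_{l₁}, …)`. -/
abbrev FactCode := ((Σ n, L.Functions n) × List ℕ × ℕ) ⊕ ((Σ n, L.Relations n) × List ℕ)

variable {L}

/-- The formula has the right number of arguments, and its positions are less than `N`. -/
def FactCode.Fits (N : ℕ) : FactCode L → Prop :=
  Sum.elim (fun c => c.2.1.length = c.1.1 ∧ (∀ i ∈ c.2.1, i < N) ∧ c.2.2 < N)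
    (fun c => c.2.length = c.1.1 ∧ ∀ i ∈ c.2, i < N)

open Classical in
/-- The truth value of an unnested atomic formula at a list of elements. -/
noncomputable def FactCode.value (A : L.Structure ℕ) (x : List ℕ) : FactCode L → Bool :=
  Sum.elim
    (fun c => decide (A.funMap c.1.2 (fun i => (valuesAt x c.2.1).getD i 0) = x.getD c.2.2 0))
    (fun c => decide (A.RelMap c.1.2 fun i => (valuesAt x c.2).getD i 0))

theorem FactCode.value_append {A : L.Structure ℕ} {c : FactCode L} {x : List ℕ}
    (h : c.Fits x.length) (w : List ℕ) : c.value A (x ++ w) = c.value A x := by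
  rcases c with ⟨f, l, j⟩ | ⟨r, l⟩
  · obtain ⟨-, h2, h3⟩ := h
    simp only [FactCode.value, Sum.elim_inl]
    rw [valuesAt_append h2, List.getD_append _ _ _ _ h3]
  · obtain ⟨-, h2⟩ := h
    simp only [FactCode.value, Sum.elim_inr]
    rw [valuesAt_append h2]

theorem FactCode.Fits.mono {c : FactCode L} {N N' : ℕ} (h : c.Fits N) (hN : N ≤ N') :
    c.Fits N' := by
  rcases c with ⟨f, l, j⟩ | ⟨r, l⟩
  · exact ⟨h.1, fun i hi => (h.2.1 i hi).trans_le hN, h.2.2.trans_le hN⟩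
  · exact ⟨h.1, fun i hi => (h.2 i hi).trans_le hN⟩

variable [Primcodable (Σ n, L.Functions n)] [Primcodable (Σ n, L.Relations n)]

open Classical in
/-- The truth value at `x` of the formula with number `q`, if defined. -/
noncomputable def factOf (A : L.Structure ℕ) (q : ℕ) (x : List ℕ) : Option Bool :=
  (decode (α := FactCode L) q).elim none fun c =>
    if c.Fits x.length then some (c.value A x) else none

theorem factOf_append {A : L.Structure ℕ} {q : ℕ} {x : List ℕ} {b : Bool} (w : List ℕ)
    (h : factOf A q x = some b) : factOf A q (x ++ w) = some b := by
  unfold factOf at h ⊢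
  cases hc : decode (α := FactCode L) q with
  | none => simp [hc] at h
  | some c =>
    simp only [hc, Option.elim_some] at h ⊢
    split_ifs at h with hf
    rw [if_pos (hf.mono (by simp)), FactCode.value_append hf, h]

theorem factOf_encode {A : L.Structure ℕ} {c : FactCode L} {x : List ℕ} (h : c.Fits x.length) :
    factOf A (encode c) x = some (c.value A x) := by
  simp [factOf, h]

/-- The arities of the symbols are computable from the oracles. -/
def AritiesIn (L : FirstOrder.Language.{u, v}) [Primcodable (Σ n, L.Functions n)]
    [Primcodable (Σ n, L.Relations n)] (O : Set (ℕ →. ℕ)) : Prop :=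
  ComputableIn O (fun f : Σ n, L.Functions n => f.1) ∧
    ComputableIn O (fun r : Σ n, L.Relations n => r.1)

theorem decidableIn_fits (hL : AritiesIn L O) {c : α → FactCode L} {n : α → ℕ}
    (hc : ComputableIn O c) (hn : ComputableIn O n) :
    DecidableIn O fun a => (c a).Fits (n a) := by
  classical
  obtain ⟨h1, h2⟩ := hL
  have key : ComputableIn O fun a => Sum.elim
      (fun c : (Σ n, L.Functions n) × List ℕ × ℕ =>
        decide (c.2.1.length = c.1.1 ∧ (∀ i ∈ c.2.1, i < n a) ∧ c.2.2 < n a))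
      (fun c : (Σ n, L.Relations n) × List ℕ =>
        decide (c.2.length = c.1.1 ∧ ∀ i ∈ c.2, i < n a)) (c a) := by
    refine computableIn_sumElim (f := fun a (c : (Σ n, L.Functions n) × List ℕ × ℕ) =>
        decide (c.2.1.length = c.1.1 ∧ (∀ i ∈ c.2.1, i < n a) ∧ c.2.2 < n a))
      (g := fun a (c : (Σ n, L.Relations n) × List ℕ) =>
        decide (c.2.length = c.1.1 ∧ ∀ i ∈ c.2, i < n a)) hc ?_ ?_
    · refine DecidableIn.decide (DecidableIn.and (decidableIn_eq (by fun_prop) ?_)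
        (DecidableIn.and (DecidableIn.listForall
          (P := fun (p : α × (Σ n, L.Functions n) × List ℕ × ℕ) i => i < n p.1)
          (decidableIn_lt (by fun_prop) (by fun_prop)) (by fun_prop))
          (decidableIn_lt (by fun_prop) (by fun_prop))))
      exact computableIn_comp (f := fun f : Σ n, L.Functions n => f.1)
        (g := fun p : α × (Σ n, L.Functions n) × List ℕ × ℕ => p.2.1) h1 (by fun_prop)
    · refine DecidableIn.decide (DecidableIn.and (decidableIn_eq (by fun_prop) ?_)
        (DecidableIn.listForall
          (P := fun (p : α × (Σ n, L.Relations n) × List ℕ) i => i < n p.1)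
          (decidableIn_lt (by fun_prop) (by fun_prop)) (by fun_prop)))
      exact computableIn_comp (f := fun f : Σ n, L.Relations n => f.1)
        (g := fun p : α × (Σ n, L.Relations n) × List ℕ => p.2.1) h2 (by fun_prop)
  refine (decidableIn_eq_true key).of_iff fun a => ?_
  rcases c a with c | c <;> simp [FactCode.Fits]

theorem computableIn_value {A : L.Structure ℕ} (hA : StructureComputableIn L O A)
    {c : α → FactCode L} {x : α → List ℕ} (hc : ComputableIn O c) (hx : ComputableIn O x) :
    ComputableIn O fun a => (c a).value A (x a) := by
  classical
  obtain ⟨h1, h2⟩ := hA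
  refine computableIn_sumElim
    (f := fun a (c : (Σ n, L.Functions n) × List ℕ × ℕ) => decide
      (A.funMap c.1.2 (fun i => (valuesAt (x a) c.2.1).getD i 0) = (x a).getD c.2.2 0))
    (g := fun a (c : (Σ n, L.Relations n) × List ℕ) => decide
      (A.RelMap c.1.2 fun i => (valuesAt (x a) c.2).getD i 0)) hc ?_ ?_
  · refine DecidableIn.decide (decidableIn_eq ?_ (by fun_prop))
    exact computableIn_comp (f := fun p : (Σ n, L.Functions n) × List ℕ =>
        A.funMap p.1.2 (fun i => p.2.getD i 0))
      (g := fun p : α × (Σ n, L.Functions n) × List ℕ × ℕ => (p.2.1, valuesAt (x p.1) p.2.2.1))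
      h1 (by fun_prop)
  · exact computableIn_comp (f := fun p : (Σ n, L.Relations n) × List ℕ =>
        decide (A.RelMap p.1.2 (fun i => p.2.getD i 0)))
      (g := fun p : α × (Σ n, L.Relations n) × List ℕ => (p.2.1, valuesAt (x p.1) p.2.2))
      h2 (by fun_prop)

theorem computableIn_factOf {A : L.Structure ℕ} (hL : AritiesIn L O)
    (hA : StructureComputableIn L O A) :
    ComputableIn O fun p : ℕ × List ℕ => factOf A p.1 p.2 := by
  classical
  refine computableIn_optionElim (o := fun p : ℕ × List ℕ => decode (α := FactCode L) p.1)
    (g := fun p c => if c.Fits p.2.length then some (c.value A p.2) else none)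
    (computableIn_of_primrec Primrec.decode (by fun_prop)) (by fun_prop) ?_
  exact computableIn_ite (decidableIn_fits hL (by fun_prop) (by fun_prop))
    (computableIn_some (computableIn_value hA (by fun_prop) (by fun_prop))) (by fun_prop)

end Codes

/-! ### Codes of tuples of positions -/

section Tuples

variable {m : ℕ}

/-- The list whose code is the code of the tuple `i`. -/
def tupleList (i : Fin m → ℕ) : List ℕ := List.ofFn fun j : Fin m => Nat.pair j (i j)

theorem encode_list_eq_of_map {α : Type*} [Encodable α] (l : List α) :
    encode l = encode (l.map encode) := by
  induction l with
  | nil => rfl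
  | cons a l ih => simp [ih]

/-- Tuples are encoded as dependent functions, that is, as lists of pairs of index and value. -/
theorem encode_eq_tupleList (i : Fin m → ℕ) : encode i = encode (tupleList i) := by
  have h : encode i =
      encode (List.Vector.ofFn fun j : Fin m => (⟨j, i j⟩ : Σ _ : Fin m, ℕ)).toList := rfl
  rw [h, List.Vector.toList_ofFn, encode_list_eq_of_map, tupleList, List.map_ofFn]
  rfl

/-- The tuple with code `q`. -/
def tupleOf (m q : ℕ) : Fin m → ℕ :=
  fun j => (Nat.unpair (((decode (α := List ℕ) q).getD []).getD j 0)).2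

theorem tupleOf_encode (i : Fin m → ℕ) : tupleOf m (encode (tupleList i)) = i := by
  funext j
  simp [tupleOf, tupleList]

open Classical in
/-- The truth value of `R` at the entries of `x` at the positions given by the tuple with code `q`,
if these occur in `x`; numbers that are not codes are given the value `false`. -/
noncomputable def relAt (R : Set (Fin m → ℕ)) (q : ℕ) (x : List ℕ) : Option Bool :=
  if encode (tupleList (tupleOf m q)) = q then
    if ∀ j, tupleOf m q j < x.length then
      some (decide ((fun j => x.getD (tupleOf m q j) 0) ∈ R))
    else none
  else some false

variable {R : Set (Fin m → ℕ)}

theorem relAt_append {q : ℕ} {x : List ℕ} {b : Bool} (w : List ℕ)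
    (h : relAt R q x = some b) : relAt R q (x ++ w) = some b := by
  unfold relAt at h ⊢
  by_cases h1 : encode (tupleList (tupleOf m q)) = q
  · by_cases h2 : ∀ j, tupleOf m q j < x.length
    · have h3 : ∀ j, tupleOf m q j < (x ++ w).length := fun j => (h2 j).trans_le (by simp)
      rw [if_pos h1, if_pos h2] at h
      rw [if_pos h1, if_pos h3, ← h]
      congr! 4 with j
      exact List.getD_append _ _ _ _ (h2 j)
    · rw [if_pos h1, if_neg h2] at h
      cases h
  · rw [if_neg h1] at h ⊢
    exact h

theorem relAt_isSome {q : ℕ} {x y : List ℕ} (h : x.length = y.length) :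
    (relAt R q x).isSome = (relAt R q y).isSome := by
  unfold relAt
  by_cases h2 : ∀ j, tupleOf m q j < y.length
  · by_cases h1 : encode (tupleList (tupleOf m q)) = q <;> simp [h, h1, h2]
  · by_cases h1 : encode (tupleList (tupleOf m q)) = q <;> simp [h, h1, h2]

theorem relAt_total (q : ℕ) : ∃ N, ∀ x : List ℕ, N ≤ x.length → (relAt R q x).isSome := by
  refine ⟨∑ j, (tupleOf m q j + 1), fun x hx => ?_⟩
  have : ∀ j, tupleOf m q j < x.length := fun j => lt_of_lt_of_le (Nat.lt_succ_self _)
    ((Finset.single_le_sum (f := fun j => tupleOf m q j + 1) (fun _ _ => Nat.zero_le _)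
      (Finset.mem_univ j)).trans hx)
  unfold relAt
  split_ifs <;> rfl

theorem relAt_encode {i : Fin m → ℕ} {x : List ℕ} (h : ∀ j, i j < x.length) :
    relAt R (encode (tupleList i)) x = some true ↔ (fun j => x.getD (i j) 0) ∈ R := by
  unfold relAt
  rw [tupleOf_encode, if_pos rfl, if_pos h]
  simp

theorem exists_of_relAt {q : ℕ} {x : List ℕ} (h : relAt R q x = some true) :
    ∃ i : Fin m → ℕ, encode (tupleList i) = q ∧ (∀ j, i j < x.length) ∧
      (fun j => x.getD (i j) 0) ∈ R := by
  unfold relAt at h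
  split_ifs at h with h1 h2
  · exact ⟨_, h1, h2, by simpa using h⟩
  · simp at h

theorem natPair_le_natPair {a b c d : ℕ} (h₁ : a ≤ c) (h₂ : b ≤ d) :
    Nat.pair a b ≤ Nat.pair c d := by
  have h3 : Nat.pair a b ≤ Nat.pair c b := by
    rcases h₁.lt_or_eq with h | rfl
    exacts [(Nat.pair_lt_pair_left _ h).le, le_rfl]
  have h4 : Nat.pair c b ≤ Nat.pair c d := by
    rcases h₂.lt_or_eq with h | rfl
    exacts [(Nat.pair_lt_pair_right _ h).le, le_rfl]
  exact h3.trans h4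

/-- A bound for the codes of the `m`-tuples of numbers less than `N`. -/
def tupleBound (m N : ℕ) : ℕ :=
  Nat.rec (motive := fun _ => ℕ) 0 (fun _ b => Nat.pair (Nat.pair m N) b + 1) m + 1

theorem encode_list_le {B : ℕ} {l : List ℕ} (h : ∀ a ∈ l, a ≤ B) :
    encode l ≤ Nat.rec (motive := fun _ => ℕ) 0 (fun _ b => Nat.pair B b + 1) l.length := by
  induction l with
  | nil => simp
  | cons a l ih =>
    simp only [List.forall_mem_cons] at h
    rw [encode_list_cons, List.length_cons]
    exact Nat.succ_le_succ (natPair_le_natPair h.1 (ih h.2))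

theorem relAt_bound {q : ℕ} {x : List ℕ} (h : relAt R q x = some true) :
    q < tupleBound m x.length := by
  obtain ⟨i, rfl, hi, -⟩ := exists_of_relAt h
  refine Nat.lt_succ_of_le ((encode_list_le (B := Nat.pair m x.length) ?_).trans (le_of_eq ?_))
  · intro a ha
    obtain ⟨j, rfl⟩ := (List.mem_ofFn' _ _).1 ha
    exact natPair_le_natPair j.2.le (hi j).le
  · simp [tupleList]

variable {α : Type*} [Primcodable α] {O : Set (ℕ →. ℕ)}

theorem computableIn_tupleBound : ComputableIn O (tupleBound m) := by
  have : ComputableIn O fun N : ℕ =>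
      Nat.rec (motive := fun _ => ℕ) 0 (fun _ b => Nat.pair (Nat.pair m N) b + 1) m :=
    computableIn_nat_rec (f := fun _ : ℕ => 0)
      (g := fun N (_ b : ℕ) => Nat.pair (Nat.pair m N) b + 1) (n := fun _ => m)
      (by fun_prop) (by fun_prop) (by fun_prop)
  exact computableIn_add this (by fun_prop)

theorem primrec_tupleOf : Primrec (tupleOf m) := by
  refine Primrec.fin_curry.2 ?_
  exact Primrec.snd.comp (Primrec.unpair.comp ((Primrec.list_getD 0).comp
    (Primrec.option_getD.comp (Primrec.decode.comp Primrec.fst) (Primrec.const []))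
    (Primrec.fin_val.comp Primrec.snd)))

theorem primrec_tupleList : Primrec (tupleList (m := m)) := by
  refine Primrec.list_ofFn fun j => Primrec₂.natPair.comp (Primrec.const _) ?_
  exact Primrec.fin_app.comp Primrec.id (Primrec.const j)

theorem computableIn_relAt (hR : DecidableIn O fun x : Fin m → ℕ => x ∈ R) :
    ComputableIn O fun p : ℕ × List ℕ => relAt R p.1 p.2 := by
  classical
  have ht : ComputableIn O fun p : ℕ × List ℕ => encode (tupleList (tupleOf m p.1)) :=
    computableIn_of_primrec (Primrec.encode.comp (primrec_tupleList.comp primrec_tupleOf))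
      (by fun_prop)
  have hl : ComputableIn O fun p : ℕ × List ℕ => List.ofFn (tupleOf m p.1) :=
    computableIn_of_primrec (Primrec.list_ofFn fun j =>
      Primrec.fin_app.comp primrec_tupleOf (Primrec.const j)) (by fun_prop)
  have hx : Primrec fun p : ℕ × List ℕ => fun j => p.2.getD (tupleOf m p.1 j) 0 := by
    refine Primrec.fin_curry.2 ((Primrec.list_getD 0).comp (Primrec.snd.comp Primrec.fst)
      (Primrec.fin_app.comp (primrec_tupleOf.comp (Primrec.fst.comp Primrec.fst)) Primrec.snd))
  have hR' : DecidableIn O fun p : ℕ × List ℕ =>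
      (fun j => p.2.getD (tupleOf m p.1 j) 0) ∈ R :=
    hR.comp (f := fun p : ℕ × List ℕ => fun j => p.2.getD (tupleOf m p.1 j) 0)
      (computableIn_of_primrec hx (computableIn_id))
  refine computableIn_ite (decidableIn_eq ht (by fun_prop)) (computableIn_ite ?_
    (computableIn_some hR'.decide) (by fun_prop)) (by fun_prop)
  refine (DecidableIn.listForall (P := fun (p : ℕ × List ℕ) i => i < p.2.length)
    (decidableIn_lt (by fun_prop) (by fun_prop)) hl).of_iff fun p => ?_
  simp

end Tuples

/-! ### The limit structure -/

section Limit

variable {L : FirstOrder.Language.{u, v}}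
  [Primcodable (Σ n, L.Functions n)] [Primcodable (Σ n, L.Relations n)]
  {A : L.Structure ℕ} {C : Set ℕ} {S : System C} {x : ℕ → List ℕ} {G : ℕ → ℕ}

theorem fits_of_factOf {c : FactCode L} {y : List ℕ} {b : Bool}
    (h : factOf A (encode c) y = some b) : c.Fits y.length := by
  by_contra hc
  simp [factOf, hc] at h

theorem System.Presents.exists_fact (hx : S.Presents x G) (hS : S.fact = factOf (L := L) A)
    {c : FactCode L} {N : ℕ} (hc : c.Fits N) :
    ∃ s, ∀ t ≥ s, S.fact (encode c) (x t) = some (c.value A ((List.range N).map G)) := by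
  obtain ⟨s, hs⟩ := hx.2.1.2 N
  refine ⟨s, fun t ht => ?_⟩
  obtain ⟨w, hw⟩ := hs t ht
  rw [hw, hS]
  exact factOf_append w (factOf_encode (by simpa using hc))

theorem System.Presents.fact_mono (hx : S.Presents x G) {q t t' : ℕ} {b : Bool} (hq : q < t)
    (h : S.fact q (x t) = some b) (ht : t ≤ t') : S.fact q (x t') = some b := by
  induction t', ht using Nat.le_induction with
  | base => exact h
  | succ n hn ih => exact hx.2.2 n q b (hq.trans_le hn) ih

/-- A fact that is decided once it is protected from injury is true in the limit. -/
theorem System.Presents.value_eq (hx : S.Presents x G) (hS : S.fact = factOf (L := L) A)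
    {c : FactCode L} {t : ℕ} {b : Bool} (ht : encode c < t)
    (h : S.fact (encode c) (x t) = some b) :
    c.value A ((List.range (x t).length).map G) = b := by
  obtain ⟨s, hs⟩ := hx.exists_fact hS (fits_of_factOf (hS ▸ h))
  have h1 := hs _ (le_max_left s t)
  rw [hx.fact_mono ht h (le_max_right s t)] at h1
  exact (Option.some.inj h1).symm

/-- The first `n` entries of `l`, missing entries being read as `0`. -/
def firstEntries (n : ℕ) (l : List ℕ) : List ℕ := (List.range n).map fun i => l.getD i 0

theorem getD_valuesAt_firstEntries {n N : ℕ} {l : List ℕ}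
    (h : ∀ i ∈ firstEntries n l, i < N) (i : Fin n) :
    (valuesAt ((List.range N).map G) (firstEntries n l)).getD i 0 = G (l.getD i 0) := by
  rw [valuesAt_range h]
  simp [firstEntries, List.getD_eq_getElem?_getD]

theorem exists_firstEntries_lt (n : ℕ) (l : List ℕ) :
    ∃ N, ∀ i ∈ firstEntries n l, i < N := by
  refine ⟨(firstEntries n l).sum + 1, fun i hi => Nat.lt_succ_of_le (List.le_sum_of_mem hi)⟩

theorem computableIn_firstEntries {α : Type*} [Primcodable α] {O : Set (ℕ →. ℕ)} {n : α → ℕ}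
    {l : α → List ℕ} (hn : ComputableIn O n) (hl : ComputableIn O l) :
    ComputableIn O fun a => firstEntries (n a) (l a) :=
  computableIn_listMap (g := fun a i => (l a).getD i 0) (by fun_prop) (by fun_prop)

/-- The pullback of `A` along a limit of `C`-computable approximations is computable from `C`. -/
theorem System.Presents.structureComputableIn (hx : S.Presents x G)
    (hS : S.fact = factOf (L := L) A) (hL : AritiesIn L {charFn C}) :
    StructureComputableIn L {charFn C}
      (@Equiv.inducedStructure L ℕ ℕ A (Equiv.ofBijective G hx.2.1.1).symm) := by
  classical
  have hf : ComputableIn {charFn C} fun p : ℕ × List ℕ => S.fact p.1 p.2 := S.fact_comp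
  have hxc : ComputableIn {charFn C} x := hx.1
  set E := Equiv.ofBijective G hx.2.1.1 with hE
  have hEG : ∀ n, E n = G n := fun n => rfl
  constructor
  · -- Search for a stage at which some equation `f (x̄) = x_j` is true and protected.
    have hr : ComputableIn {charFn C} fun p : (Σ n, L.Functions n) × List ℕ =>
        firstEntries p.1.1 p.2 := computableIn_firstEntries
      (computableIn_comp (f := fun f : Σ n, L.Functions n => f.1)
        (g := fun p : (Σ n, L.Functions n) × List ℕ => p.1) hL.1 (by fun_prop)) (by fun_prop)
    have hq : ComputableIn {charFn C} fun p : ((Σ n, L.Functions n) × List ℕ) × ℕ × ℕ =>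
        encode (Sum.inl (p.1.1, firstEntries p.1.1.1 p.1.2, p.2.2) : FactCode L) := by
      refine computableIn_encode (computableIn_of_primrec Primrec.sumInl
        (computableIn_pair (by fun_prop) (computableIn_pair ?_ (by fun_prop))))
      exact computableIn_comp
        (f := fun p : (Σ n, L.Functions n) × List ℕ => firstEntries p.1.1 p.2)
        (g := fun p : ((Σ n, L.Functions n) × List ℕ) × ℕ × ℕ => p.1) hr (by fun_prop)
    have hfq : ComputableIn {charFn C} fun p : ((Σ n, L.Functions n) × List ℕ) × ℕ × ℕ =>
        S.fact (encode (Sum.inl (p.1.1, firstEntries p.1.1.1 p.1.2, p.2.2) : FactCode L))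
          (x p.2.1) :=
      computableIn_comp (f := fun p : ℕ × List ℕ => S.fact p.1 p.2)
        (g := fun p : ((Σ n, L.Functions n) × List ℕ) × ℕ × ℕ =>
          (encode (Sum.inl (p.1.1, firstEntries p.1.1.1 p.1.2, p.2.2) : FactCode L), x p.2.1))
        hf (computableIn_pair hq (computableIn_comp (f := x)
          (g := fun p : ((Σ n, L.Functions n) × List ℕ) × ℕ × ℕ => p.2.1) hxc (by fun_prop)))
    obtain ⟨r, hr, hr'⟩ := DecidableIn.exists_selector (O := {charFn C})
      (G := fun _ : (Σ n, L.Functions n) × List ℕ => True)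
      (P := fun p (y : ℕ × ℕ) =>
        encode (Sum.inl (p.1, firstEntries p.1.1 p.2, y.2) : FactCode L) < y.1 ∧
        S.fact (encode (Sum.inl (p.1, firstEntries p.1.1 p.2, y.2) : FactCode L)) (x y.1)
          = some true)
      (DecidableIn.of_decide (by simpa using computableIn_const true))
      (DecidableIn.and (decidableIn_lt hq (by fun_prop)) (decidableIn_eq hfq (by fun_prop))) (by
        rintro ⟨⟨n, f⟩, l⟩ -
        set j := E.symm (A.funMap f fun i => G (l.getD i 0)) with hj
        obtain ⟨N, hN⟩ := exists_firstEntries_lt n l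
        have hfit : FactCode.Fits (L := L) (max N (j + 1))
            (Sum.inl (⟨n, f⟩, firstEntries n l, j)) :=
          ⟨by simp [firstEntries], fun i hi => (hN i hi).trans_le (le_max_left _ _),
            (Nat.lt_succ_self j).trans_le (le_max_right _ _)⟩
        obtain ⟨s, hs⟩ := hx.exists_fact hS hfit
        refine ⟨(max s (encode (Sum.inl (⟨n, f⟩, firstEntries n l, j) : FactCode L) + 1), j),
          lt_of_lt_of_le (Nat.lt_succ_self _) (le_max_right _ _), ?_⟩
        rw [hs _ (le_max_left _ _)]
        simp only [FactCode.value, Sum.elim_inl, Option.some.injEq, decide_eq_true_eq]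
        rw [getD_map_range hfit.2.2, ← hEG j, hj, Equiv.apply_symm_apply]
        congr 1
        funext i
        exact getD_valuesAt_firstEntries hfit.2.1 i)
    have h2 : ComputableIn {charFn C} fun p => (r p).2 := by fun_prop
    convert h2 using 2 with p
    obtain ⟨h3, h4⟩ := hr' p trivial
    have h5 := hx.value_eq hS h3 h4
    have hfit := fits_of_factOf (hS ▸ h4)
    simp only [FactCode.value, Sum.elim_inl, decide_eq_true_eq] at h5
    rw [getD_map_range hfit.2.2] at h5
    change E.symm (A.funMap p.1.2 fun i => G (p.2.getD i 0)) = _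
    rw [Equiv.symm_apply_eq, hEG, ← h5]
    congr 1
    funext i
    exact (getD_valuesAt_firstEntries hfit.2.1 i).symm
  · have hr : ComputableIn {charFn C} fun p : (Σ n, L.Relations n) × List ℕ =>
        firstEntries p.1.1 p.2 := computableIn_firstEntries
      (computableIn_comp (f := fun f : Σ n, L.Relations n => f.1)
        (g := fun p : (Σ n, L.Relations n) × List ℕ => p.1) hL.2 (by fun_prop)) (by fun_prop)
    have hq : ComputableIn {charFn C} fun p : ((Σ n, L.Relations n) × List ℕ) =>
        encode (Sum.inr (p.1, firstEntries p.1.1 p.2) : FactCode L) :=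
      computableIn_encode (computableIn_of_primrec Primrec.sumInr
        (computableIn_pair (by fun_prop) hr))
    have hq' : ComputableIn {charFn C} fun p : ((Σ n, L.Relations n) × List ℕ) × ℕ =>
        encode (Sum.inr (p.1.1, firstEntries p.1.1.1 p.1.2) : FactCode L) :=
      computableIn_comp (f := fun p : ((Σ n, L.Relations n) × List ℕ) =>
        encode (Sum.inr (p.1, firstEntries p.1.1 p.2) : FactCode L))
        (g := fun p : ((Σ n, L.Relations n) × List ℕ) × ℕ => p.1) hq (by fun_prop)
    have hfq : ComputableIn {charFn C} fun p : ((Σ n, L.Relations n) × List ℕ) × ℕ =>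
        S.fact (encode (Sum.inr (p.1.1, firstEntries p.1.1.1 p.1.2) : FactCode L)) (x p.2) :=
      computableIn_comp (f := fun p : ℕ × List ℕ => S.fact p.1 p.2)
        (g := fun p : ((Σ n, L.Relations n) × List ℕ) × ℕ =>
          (encode (Sum.inr (p.1.1, firstEntries p.1.1.1 p.1.2) : FactCode L), x p.2))
        hf (computableIn_pair hq' (computableIn_comp (f := x)
          (g := fun p : ((Σ n, L.Relations n) × List ℕ) × ℕ => p.2) hxc (by fun_prop)))
    obtain ⟨r, hr, hr'⟩ := DecidableIn.exists_selector (O := {charFn C})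
      (G := fun _ : (Σ n, L.Relations n) × List ℕ => True)
      (P := fun p (t : ℕ) =>
        encode (Sum.inr (p.1, firstEntries p.1.1 p.2) : FactCode L) < t ∧
        (S.fact (encode (Sum.inr (p.1, firstEntries p.1.1 p.2) : FactCode L)) (x t)).isSome)
      (DecidableIn.of_decide (by simpa using computableIn_const true))
      (DecidableIn.and (decidableIn_lt hq' (by fun_prop))
        (decidableIn_eq_true (computableIn_isSome hfq))) (by
        rintro ⟨⟨n, f⟩, l⟩ -
        obtain ⟨N, hN⟩ := exists_firstEntries_lt n l
        have hfit : FactCode.Fits (L := L) N (Sum.inr (⟨n, f⟩, firstEntries n l)) :=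
          ⟨by simp [firstEntries], hN⟩
        obtain ⟨s, hs⟩ := hx.exists_fact hS hfit
        refine ⟨max s (encode (Sum.inr (⟨n, f⟩, firstEntries n l) : FactCode L) + 1),
          lt_of_lt_of_le (Nat.lt_succ_self _) (le_max_right _ _), ?_⟩
        rw [hs _ (le_max_left _ _)]
        rfl)
    have h2 : ComputableIn {charFn C} fun p : (Σ n, L.Relations n) × List ℕ =>
        S.fact (encode (Sum.inr (p.1, firstEntries p.1.1 p.2) : FactCode L)) (x (r p)) :=
      computableIn_comp (f := fun p : ((Σ n, L.Relations n) × List ℕ) × ℕ =>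
        S.fact (encode (Sum.inr (p.1.1, firstEntries p.1.1.1 p.1.2) : FactCode L)) (x p.2))
        (g := fun p => (p, r p)) hfq (by fun_prop)
    have h3 := (decidableIn_eq h2 (computableIn_const (some true))).decide
    convert h3 using 3 with p
    obtain ⟨h3, h4⟩ := hr' p trivial
    obtain ⟨b, hb⟩ := Option.isSome_iff_exists.1 h4
    have h5 := hx.value_eq hS h3 hb
    have hfit := fits_of_factOf (hS ▸ hb)
    rw [hb, ← h5]
    simp only [FactCode.value, Sum.elim_inr, Option.some.injEq, decide_eq_true_eq]
    change A.RelMap p.1.2 (fun i => G (p.2.getD i 0)) ↔ _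
    rw [iff_iff_eq]
    congr 1
    funext i
    exact (getD_valuesAt_firstEntries hfit.2 i).symm

theorem System.limitRel_eq {m : ℕ} {R : Set (Fin m → ℕ)} (hS : S.rbit = relAt R)
    (hG : Function.Bijective G) :
    S.limitRel G = relCode (imageRel (Equiv.ofBijective G hG).symm R) := by
  set E := Equiv.ofBijective G hG with hE
  have hEG : ∀ n, E n = G n := fun n => rfl
  ext q
  simp only [System.limitRel, relCode, imageRel, Set.mem_ofPred_eq, Set.mem_image, hS]
  constructor
  · rintro ⟨N, hN⟩
    obtain ⟨i, rfl, hi, hR⟩ := exists_of_relAt hN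
    refine ⟨i, ⟨_, hR, ?_⟩, encode_eq_tupleList i⟩
    funext j
    simp only [Function.comp_apply, Equiv.symm_apply_eq, hEG]
    exact getD_map_range (by simpa using hi j)
  · rintro ⟨_, ⟨y, hy, rfl⟩, rfl⟩
    refine ⟨∑ j, (E.symm (y j) + 1), ?_⟩
    have : ∀ j, (E.symm ∘ y) j < ∑ j, (E.symm (y j) + 1) := fun j =>
      lt_of_lt_of_le (Nat.lt_succ_self _)
        (Finset.single_le_sum (f := fun j => E.symm (y j) + 1) (fun _ _ => Nat.zero_le _)
          (Finset.mem_univ j))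
    rw [encode_eq_tupleList, relAt_encode (by simpa using this)]
    convert hy using 1
    funext j
    rw [getD_map_range (this j), ← hEG, Function.comp_apply, Equiv.apply_symm_apply]

end Limit

/-! ### Diagrams of finite lists -/

section Diagrams

/-- Unnested atomic formulas about positions in a list: equations between positions, and the
formulas coded by `FactCode`. -/
abbrev Atom (L : FirstOrder.Language.{u, v}) := (ℕ × ℕ) ⊕ FactCode L

variable {L : FirstOrder.Language.{u, v}} {α : Type*} {n : ℕ}

/-- The formula given by an atom when the position `j` is the variable `v j`. -/
def Atom.formula (v : ℕ → α ⊕ Fin n) : Atom L → L.BoundedFormula α n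
  | Sum.inl p => (Language.Term.var (v p.1)).bdEqual (Language.Term.var (v p.2))
  | Sum.inr (Sum.inl c) =>
    (Language.Term.func c.1.2 fun i => Language.Term.var (v (c.2.1.getD i 0))).bdEqual
      (Language.Term.var (v c.2.2))
  | Sum.inr (Sum.inr c) => c.1.2.boundedFormula fun i => Language.Term.var (v (c.2.getD i 0))

/-- The atom is true when the position `j` has the value `ζ j`. -/
def Atom.Holds (A : L.Structure ℕ) (ζ : ℕ → ℕ) : Atom L → Prop
  | Sum.inl p => ζ p.1 = ζ p.2
  | Sum.inr (Sum.inl c) => A.funMap c.1.2 (fun i => ζ (c.2.1.getD i 0)) = ζ c.2.2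
  | Sum.inr (Sum.inr c) => A.RelMap c.1.2 fun i => ζ (c.2.getD i 0)

theorem Atom.isQF_formula (v : ℕ → α ⊕ Fin n) (a : Atom L) : (a.formula v).IsQF := by
  rcases a with p | c | c
  · exact (Language.BoundedFormula.IsAtomic.equal _ _).isQF
  · exact (Language.BoundedFormula.IsAtomic.equal _ _).isQF
  · exact (Language.BoundedFormula.IsAtomic.rel _ _).isQF

theorem Atom.realize_formula {A : L.Structure ℕ} {v : ℕ → α ⊕ Fin n} {a : Atom L} {J : α → ℕ}
    {xs : Fin n → ℕ} :
    (a.formula v).Realize J xs ↔ a.Holds A fun j => Sum.elim J xs (v j) := by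
  rcases a with p | c | c
  · simp [formula, Holds]
  · simp [formula, Holds]
  · simp [formula, Holds, Language.BoundedFormula.realize_rel]

/-- A literal: an atom or, if the Boolean is `false`, its negation. -/
def literal (v : ℕ → α ⊕ Fin n) (p : Bool × Atom L) : L.BoundedFormula α n :=
  if p.1 then p.2.formula v else (p.2.formula v).imp ⊥

/-- The conjunction of a list of literals, written with implications only. -/
def conj (v : ℕ → α ⊕ Fin n) (l : List (Bool × Atom L)) : L.BoundedFormula α n :=
  (l.foldr (fun p φ => (literal v p).imp φ) ⊥).imp ⊥

theorem isQF_conj (v : ℕ → α ⊕ Fin n) (l : List (Bool × Atom L)) : (conj v l).IsQF := by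
  refine Language.BoundedFormula.IsQF.imp ?_ Language.BoundedFormula.isQF_bot
  induction l with
  | nil => exact Language.BoundedFormula.isQF_bot
  | cons p l ih =>
    refine Language.BoundedFormula.IsQF.imp ?_ ih
    unfold literal
    split_ifs
    · exact p.2.isQF_formula v
    · exact (p.2.isQF_formula v).imp Language.BoundedFormula.isQF_bot

theorem realize_conj {A : L.Structure ℕ} {v : ℕ → α ⊕ Fin n} {l : List (Bool × Atom L)}
    {J : α → ℕ} {xs : Fin n → ℕ} :
    (conj v l).Realize J xs ↔
      ∀ p ∈ l, p.1 = true ↔ p.2.Holds A fun j => Sum.elim J xs (v j) := by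
  have hlit : ∀ p : Bool × Atom L, (literal v p).Realize J xs ↔
      (p.1 = true ↔ p.2.Holds A fun j => Sum.elim J xs (v j)) := by
    rintro ⟨b, a⟩
    cases b <;> simp [literal, Atom.realize_formula, Language.BoundedFormula.realize_imp]
  have : ∀ l : List (Bool × Atom L),
      (l.foldr (fun p φ => (literal v p).imp φ) ⊥ : L.BoundedFormula α n).Realize J xs ↔
      ¬ ∀ p ∈ l, p.1 = true ↔ p.2.Holds A fun j => Sum.elim J xs (v j) := by
    intro l
    induction l with
    | nil => simp
    | cons p l ih =>
      rw [List.foldr_cons, Language.BoundedFormula.realize_imp, ih, hlit, List.forall_mem_cons]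
      tauto
  rw [conj, Language.BoundedFormula.realize_imp, this]
  exact not_not

theorem FactCode.value_map_range {A : L.Structure ℕ} {c : FactCode L} {ζ : ℕ → ℕ} {N : ℕ}
    (h : c.Fits N) : c.value A ((List.range N).map ζ) = true ↔ Atom.Holds A ζ (Sum.inr c) := by
  have key : ∀ l : List ℕ, (∀ i ∈ l, i < N) → ∀ i : Fin l.length,
      (valuesAt ((List.range N).map ζ) l).getD i 0 = ζ (l.getD i 0) := by
    intro l hl i
    rw [valuesAt_range hl]
    simp [List.getD_eq_getElem?_getD]
  rcases c with ⟨⟨a, f⟩, l, j⟩ | ⟨⟨a, r⟩, l⟩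
  · obtain ⟨h1, h2, h3⟩ := h
    dsimp only at h1 h2 h3
    subst h1
    simp only [FactCode.value, Atom.Holds, Sum.elim_inl, decide_eq_true_eq]
    rw [getD_map_range h3]
    simp only [key l h2]
  · obtain ⟨h1, h2⟩ := h
    dsimp only at h1 h2
    subst h1
    simp only [FactCode.value, Atom.Holds, Sum.elim_inr, decide_eq_true_eq]
    simp only [key l h2]

variable [Primcodable (Σ n, L.Functions n)] [Primcodable (Σ n, L.Relations n)]

open Classical in
/-- The full equality type of the entries of `x` and `a`, and the truth values at `x` of the
formulas with numbers less than `s`. The positions from `x.length` onwards refer to `a`. -/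
noncomputable def diagram (A : L.Structure ℕ) (x a : List ℕ) (s : ℕ) : List (Bool × Atom L) :=
  ((List.range (x ++ a).length).flatMap fun i => (List.range (x ++ a).length).map fun j =>
    (decide ((x ++ a).getD i 0 = (x ++ a).getD j 0), Sum.inl (i, j))) ++
  (List.range s).flatMap fun q => (decode (α := FactCode L) q).elim [] fun c =>
    if c.Fits x.length then [(c.value A x, Sum.inr c)] else []

theorem forall_diagram_iff {A : L.Structure ℕ} {x a : List ℕ} {s : ℕ} {ζ : ℕ → ℕ} :
    (∀ p ∈ diagram A x a s, p.1 = true ↔ p.2.Holds A ζ) ↔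
      (∀ i < (x ++ a).length, ∀ j < (x ++ a).length,
        (x ++ a).getD i 0 = (x ++ a).getD j 0 ↔ ζ i = ζ j) ∧
      ∀ q < s, factOf A q ((List.range x.length).map ζ) = factOf A q x := by
  have key : ∀ c : FactCode L, c.Fits x.length →
      ((c.value A x = true ↔ Atom.Holds A ζ (Sum.inr c)) ↔
        c.value A ((List.range x.length).map ζ) = c.value A x) := by
    intro c hc
    rw [← FactCode.value_map_range hc]
    cases c.value A x <;> cases c.value A ((List.range x.length).map ζ) <;> simp
  unfold diagram
  simp only [List.forall_mem_append, List.forall_mem_flatMap, List.mem_range, List.forall_mem_map]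
  refine and_congr ?_ (forall₂_congr fun q _ => ?_)
  · simp [Atom.Holds]
  · unfold factOf
    cases hq : decode (α := FactCode L) q with
    | none => simp
    | some c =>
      by_cases hc : c.Fits x.length
      · simp [hc, key c hc]
      · simp [hc]

end Diagrams

/-! ### From d-free tuples to moves -/

section Moves

variable {k r n : ℕ}

/-- The variable standing for a position in `c̄ b̄ ā`, and `d` beyond the end. -/
def posVar (d : Fin k ⊕ Fin r ⊕ Fin n) (j : ℕ) : Fin k ⊕ Fin r ⊕ Fin n :=
  if h : j < k then Sum.inl ⟨j, h⟩ else
  if h : j - k < n then Sum.inr (Sum.inr ⟨j - k, h⟩) else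
  if h : j - k - n < r then Sum.inr (Sum.inl ⟨j - k - n, h⟩) else d

theorem join₃_posVar {d : Fin k ⊕ Fin r ⊕ Fin n} {c : Fin k → ℕ} {a : Fin r → ℕ} {b : Fin n → ℕ}
    {j : ℕ} (hj : j < (List.ofFn c ++ List.ofFn b ++ List.ofFn a).length) :
    join₃ c a b (posVar d j) = (List.ofFn c ++ List.ofFn b ++ List.ofFn a).getD j 0 := by
  rw [List.getD_eq_getElem _ _ hj]
  simp only [List.length_append, List.length_ofFn] at hj
  unfold posVar
  split_ifs with h1 h2 h3
  · rw [List.getElem_append_left (by simp; omega), List.getElem_append_left (by simpa)]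
    simp [join₃]
  · rw [List.getElem_append_left (by simp; omega), List.getElem_append_right (by simp; omega)]
    simp [join₃]
  · rw [List.getElem_append_right (by simp; omega)]
    simp [join₃, Nat.sub_sub]
  · omega

theorem map_range_join₃ {d : Fin k ⊕ Fin r ⊕ Fin n} {c : Fin k → ℕ} {a : Fin r → ℕ}
    {b : Fin n → ℕ} :
    (List.range (k + n)).map (fun j => join₃ c a b (posVar d j)) =
      List.ofFn c ++ List.ofFn b := by
  refine List.ext_getElem (by simp) fun j h1 h2 => ?_
  have h3 : j < (List.ofFn c ++ List.ofFn b ++ List.ofFn a).length := by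
    simp only [List.length_append, List.length_ofFn] at h2 ⊢
    omega
  rw [List.getElem_map, List.getElem_range, join₃_posVar h3, List.getD_eq_getElem _ _ h3,
    List.getElem_append_left h2]

theorem nodup_of_equality_type {x y : List ℕ} (hl : y.length ≤ x.length) (hx : x.Nodup)
    (h : ∀ i < y.length, ∀ j < y.length, x.getD i 0 = x.getD j 0 ↔ y.getD i 0 = y.getD j 0) :
    y.Nodup := by
  rw [List.nodup_iff_injective_get]
  intro i j hij
  have := (h i i.2 j j.2).2 (by
    rw [List.getD_eq_getElem _ _ i.2, List.getD_eq_getElem _ _ j.2]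
    exact hij)
  rw [List.getD_eq_getElem _ _ (i.2.trans_le hl), List.getD_eq_getElem _ _ (j.2.trans_le hl),
    hx.getElem_inj_iff] at this
  exact Fin.ext this

theorem relAt_congr {m : ℕ} {R : Set (Fin m → ℕ)} {x y : List ℕ} (hl : x.length = y.length)
    (h : ∀ i : Fin m → ℕ, (∀ j, i j < x.length) →
      ((fun j => x.getD (i j) 0) ∈ R ↔ (fun j => y.getD (i j) 0) ∈ R)) (q : ℕ) :
    relAt R q x = relAt R q y := by
  unfold relAt
  by_cases h2 : ∀ j, tupleOf m q j < x.length
  · have h3 := h2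
    rw [hl] at h3
    rw [if_pos h2, if_pos h3]
    congr! 3
    exact h _ h2
  · have h3 := h2
    rw [hl] at h3
    simp only [if_neg h2, if_neg h3]

theorem isExistential_exs {L : FirstOrder.Language.{u, v}} {α : Type*} {n : ℕ}
    {φ : L.BoundedFormula α n} (h : φ.IsExistential) :
    φ.exs.IsExistential := by
  induction n with
  | zero => exact h
  | succ n ih => exact ih (.ex h)

variable {L : FirstOrder.Language.{u, v}}
  [Primcodable (Σ n, L.Functions n)] [Primcodable (Σ n, L.Relations n)]

/-- The quantifier-free formula describing the equality type of `c̄ ā b̄` and the first `s` facts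
about `c̄ b̄`. -/
noncomputable def diagramFormula (A : L.Structure ℕ) (d : Fin k ⊕ Fin r ⊕ Fin n) (c : Fin k → ℕ)
    (a : Fin r → ℕ) (b : Fin n → ℕ) (s : ℕ) : Fml L k r n :=
  conj (fun j => Sum.inl (posVar d j)) (diagram A (List.ofFn c ++ List.ofFn b) (List.ofFn a) s)

variable {A : L.Structure ℕ} {d : Fin k ⊕ Fin r ⊕ Fin n} {c c' : Fin k → ℕ} {a a' : Fin r → ℕ}
  {b b' : Fin n → ℕ} {s t : ℕ}

theorem realize_diagramFormula :
    (diagramFormula A d c a b s).Realize (join₃ c' a' b') ↔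
      (∀ i < k + n + r, ∀ j < k + n + r,
        (List.ofFn c ++ List.ofFn b ++ List.ofFn a).getD i 0 =
          (List.ofFn c ++ List.ofFn b ++ List.ofFn a).getD j 0 ↔
        (List.ofFn c' ++ List.ofFn b' ++ List.ofFn a').getD i 0 =
          (List.ofFn c' ++ List.ofFn b' ++ List.ofFn a').getD j 0) ∧
      ∀ q < s, factOf A q (List.ofFn c' ++ List.ofFn b') =
        factOf A q (List.ofFn c ++ List.ofFn b) := by
  unfold diagramFormula Language.Formula.Realize
  rw [realize_conj, forall_diagram_iff]
  have hl : (List.ofFn c ++ List.ofFn b).length = k + n := by simp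
  have hl' : (List.ofFn c ++ List.ofFn b ++ List.ofFn a).length = k + n + r := by simp; omega
  have hl'' : (List.ofFn c' ++ List.ofFn b' ++ List.ofFn a').length = k + n + r := by
    simp; omega
  simp only [hl, hl', Sum.elim_inl, map_range_join₃]
  refine and_congr_left fun _ => forall₂_congr fun i hi => forall₂_congr fun j hj => ?_
  rw [join₃_posVar (hl''.symm ▸ hi), join₃_posVar (hl''.symm ▸ hj)]

/-- The existential formula stating that `c̄ b̄` can be extended to a tuple that has the equality
type of `c̄ b̄ w` and agrees with it on the first `t` facts. -/
noncomputable def extensionFormula (A : L.Structure ℕ) (d : Fin k ⊕ Fin r ⊕ Fin n)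
    (c : Fin k → ℕ) (b : Fin n → ℕ) (w : List ℕ) (t : ℕ) : Fml L k r n :=
  (conj (n := w.length) (fun j => if j < k + n then Sum.inl (posVar d j) else
    if h : j - (k + n) < w.length then Sum.inr ⟨j - (k + n), h⟩ else Sum.inl d)
    (diagram A (List.ofFn c ++ List.ofFn b ++ w) [] t)).exs

theorem isExistential_extensionFormula {w : List ℕ} :
    (extensionFormula (r := r) A d c b w t).IsExistential :=
  isExistential_exs (isQF_conj _ _).isExistential

theorem realize_extensionFormula {w : List ℕ} :
    (extensionFormula A d c b w t).Realize (join₃ c' a' b') ↔ ∃ w' : List ℕ,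
      w'.length = w.length ∧ (∀ i < k + n + w.length, ∀ j < k + n + w.length,
        (List.ofFn c ++ List.ofFn b ++ w).getD i 0 = (List.ofFn c ++ List.ofFn b ++ w).getD j 0 ↔
        (List.ofFn c' ++ List.ofFn b' ++ w').getD i 0 =
          (List.ofFn c' ++ List.ofFn b' ++ w').getD j 0) ∧
      ∀ q < t, factOf A q (List.ofFn c' ++ List.ofFn b' ++ w') =
        factOf A q (List.ofFn c ++ List.ofFn b ++ w) := by
  have hl : (List.ofFn c ++ List.ofFn b ++ w).length = k + n + w.length := by simp; omega
  have key : ∀ xs : Fin w.length → ℕ, ∀ j < k + n + w.length,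
      Sum.elim (join₃ c' a' b') xs (if j < k + n then Sum.inl (posVar d j) else
        if h : j - (k + n) < w.length then Sum.inr ⟨j - (k + n), h⟩ else Sum.inl d) =
      (List.ofFn c' ++ List.ofFn b' ++ List.ofFn xs).getD j 0 := by
    intro xs j hj
    have hl' : (List.ofFn c' ++ List.ofFn b').length = k + n := by simp
    split_ifs with h1 h2
    · rw [Sum.elim_inl, join₃_posVar (by simp; omega),
        List.getD_append (List.ofFn c' ++ List.ofFn b') (List.ofFn a') _ _ (by omega),
        List.getD_append (List.ofFn c' ++ List.ofFn b') (List.ofFn xs) _ _ (by omega)]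
    · rw [List.getD_append_right (List.ofFn c' ++ List.ofFn b') _ _ _ (by omega), hl', Sum.elim_inr,
        List.getD_eq_getElem _ _ (by simpa), List.getElem_ofFn]
    · omega
  have key' : ∀ xs : Fin w.length → ℕ, (List.range (k + n + w.length)).map (fun j =>
      Sum.elim (join₃ c' a' b') xs (if j < k + n then Sum.inl (posVar d j) else
        if h : j - (k + n) < w.length then Sum.inr ⟨j - (k + n), h⟩ else Sum.inl d)) =
      List.ofFn c' ++ List.ofFn b' ++ List.ofFn xs := by
    intro xs
    refine List.ext_getElem (by simp; omega) fun j h1 h2 => ?_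
    rw [List.getElem_map, List.getElem_range, key xs j (by simpa using h1),
      List.getD_eq_getElem _ _ h2]
  unfold extensionFormula
  rw [Language.BoundedFormula.realize_exs]
  simp only [realize_conj, forall_diagram_iff, hl, List.append_nil, key']
  constructor
  · rintro ⟨xs, h1, h2⟩
    refine ⟨List.ofFn xs, by simp, fun i hi j hj => ?_, h2⟩
    rw [h1 i hi j hj, key xs i hi, key xs j hj]
  · rintro ⟨w', h0, h1, h2⟩
    have hw : List.ofFn (fun i : Fin w.length => w'.getD i 0) = w' :=
      List.ext_getElem (by simp [h0]) fun j h1 h2 => by simp [h2]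
    refine ⟨fun i => w'.getD i 0, fun i hi j hj => ?_, ?_⟩
    · rw [h1 i hi j hj, key _ i hi, key _ j hj, hw]
    · rw [hw]
      exact h2

variable {m : ℕ} {R : Set (Fin m → ℕ)}

theorem Moves.nodup (h : Moves R c a b (diagramFormula A d c a b s) a' b')
    (hx : (List.ofFn c ++ List.ofFn b).Nodup) : (List.ofFn c ++ List.ofFn b').Nodup := by
  have h1 := (realize_diagramFormula.1 h.1).1
  refine nodup_of_equality_type (by simp) hx fun i hi j hj => ?_
  have hl : ∀ {i}, i < (List.ofFn c ++ List.ofFn b').length →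
      i < k + n + r ∧ i < (List.ofFn c ++ List.ofFn b).length := by
    intro i hi
    simp only [List.length_append, List.length_ofFn] at hi ⊢
    omega
  have := h1 i (hl hi).1 j (hl hj).1
  rwa [List.getD_append _ _ _ _ (hl hi).2, List.getD_append _ _ _ _ (hl hj).2,
    List.getD_append _ _ _ _ hi, List.getD_append _ _ _ _ hj] at this

/-- The relation changes on any part of the list in which the d-free tuple occurs. -/
theorem Moves.exists_relAt_ne (h : Moves R c a b (diagramFormula A d c a b s) a' b') {l : ℕ}
    (hk : k ≤ l) (hl : l ≤ k + n) (ha : ∀ i, a i ∈ (List.ofFn c ++ List.ofFn b).take l) :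
    ∃ q, relAt R q ((List.ofFn c ++ List.ofFn b).take l) ≠
      relAt R q ((List.ofFn c ++ List.ofFn b').take l) := by
  have h1 := (realize_diagramFormula.1 h.1).1
  set x := List.ofFn c ++ List.ofFn b with hx
  set x' := List.ofFn c ++ List.ofFn b' with hx'
  have hxl : x.length = k + n := by simp [hx]
  have hxl' : x'.length = k + n := by simp [hx']
  have htake : ∀ {y : List ℕ} {i}, i < l → (y.take l).getD i 0 = y.getD i 0 := by
    intro y i hi
    simp [List.getD_eq_getElem?_getD, hi]
  -- `ā` occupies positions of `c̄ b̄`, and by the equality type `ā'` the same ones of `c̄ b̄'`.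
  have hpos : ∀ i, ∃ p < l, x.getD p 0 = a i ∧ x'.getD p 0 = a' i := by
    intro i
    obtain ⟨p, hp, hpe⟩ := List.mem_iff_getElem.1 (ha i)
    have hpl : p < l := by
      rw [List.length_take] at hp
      omega
    have hpa : x.getD p 0 = a i := by
      rw [← htake hpl, List.getD_eq_getElem _ _ hp, hpe]
    refine ⟨p, hpl, hpa, ?_⟩
    have h2 := h1 p (by omega) (k + n + i) (by omega)
    rw [List.getD_append x _ _ p (by omega), List.getD_append x' _ _ p (by omega),
      List.getD_append_right x _ _ _ (by omega), List.getD_append_right x' _ _ _ (by omega),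
      hxl, hxl', Nat.add_sub_cancel_left, List.getD_eq_getElem (List.ofFn a) _ (by simp),
      List.getD_eq_getElem (List.ofFn a') _ (by simp), List.getElem_ofFn, List.getElem_ofFn] at h2
    exact h2.1 hpa
  choose p hp hpa hpa' using hpos
  by_contra! hne
  refine h.2.1 fun i => ?_
  have hq := hne (encode (tupleList fun j => Sum.elim (fun i : Fin k => (i : ℕ)) p (i j)))
  have hlt : ∀ j, Sum.elim (fun i : Fin k => (i : ℕ)) p (i j) < l := by
    intro j
    rcases i j with i | i
    · exact i.2.trans_le hk
    · exact hp i
  have e1 : (fun j => (x.take l).getD (Sum.elim (fun i : Fin k => (i : ℕ)) p (i j)) 0) =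
      join₂ c a ∘ i := by
    funext j
    rw [htake (hlt j)]
    rcases hi : i j with i' | i'
    · rw [Function.comp_apply, hi, Sum.elim_inl, hx, List.getD_append _ _ _ _ (by simp),
        List.getD_eq_getElem _ _ (by simp), List.getElem_ofFn]
      rfl
    · rw [Function.comp_apply, hi, Sum.elim_inr, hpa]
      rfl
  have e2 : (fun j => (x'.take l).getD (Sum.elim (fun i : Fin k => (i : ℕ)) p (i j)) 0) =
      join₂ c a' ∘ i := by
    funext j
    rw [htake (hlt j)]
    rcases hi : i j with i' | i'
    · rw [Function.comp_apply, hi, Sum.elim_inl, hx', List.getD_append _ _ _ _ (by simp),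
        List.getD_eq_getElem _ _ (by simp), List.getElem_ofFn]
      rfl
    · rw [Function.comp_apply, hi, Sum.elim_inr, hpa']
      rfl
  have r1 := relAt_encode (R := R) (x := x.take l)
    (i := fun j => Sum.elim (fun i : Fin k => (i : ℕ)) p (i j))
    (fun j => by rw [List.length_take]; have := hlt j; omega)
  have r2 := relAt_encode (R := R) (x := x'.take l)
    (i := fun j => Sum.elim (fun i : Fin k => (i : ℕ)) p (i j))
    (fun j => by rw [List.length_take]; have := hlt j; omega)
  rw [e1] at r1
  rw [e2] at r2
  rw [← r1, ← r2, hq]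

/-- The return move of d-freeness, applied to the existential formula that describes the current
list, undoes a change of the relation while preserving the facts decided since. -/
theorem Moves.exists_return (h : Moves R c a b (diagramFormula A d c a b s) a' b')
    (w : List ℕ) (t : ℕ) (hw : (List.ofFn c ++ List.ofFn b' ++ w).Nodup) :
    ∃ y : List ℕ, y.length = (List.ofFn c ++ List.ofFn b' ++ w).length ∧ y.Nodup ∧
      y.take k = List.ofFn c ∧
      (∀ q < t, factOf A q y = factOf A q (List.ofFn c ++ List.ofFn b' ++ w)) ∧
      ∀ q, relAt R q (y.take (k + n)) = relAt R q (List.ofFn c ++ List.ofFn b) := by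
  obtain ⟨a'', b'', hψ, hR⟩ := h.2.2 (extensionFormula A d c b' w t) isExistential_extensionFormula
    (realize_extensionFormula.2 ⟨w, rfl, fun _ _ _ _ => Iff.rfl, fun _ _ => rfl⟩)
  obtain ⟨w'', hl, h1, h2⟩ := realize_extensionFormula.1 hψ
  have htake : (List.ofFn c ++ List.ofFn b'' ++ w'').take (k + n) =
      List.ofFn c ++ List.ofFn b'' := by
    rw [List.take_append_of_le_length (by simp), List.take_of_length_le (by simp)]
  refine ⟨List.ofFn c ++ List.ofFn b'' ++ w'', by simp [hl], ?_, ?_, h2, fun q => ?_⟩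
  · refine nodup_of_equality_type (by simp [hl]) hw fun i hi j hj => h1 i ?_ j ?_
    · simp only [List.length_append, List.length_ofFn] at hi
      omega
    · simp only [List.length_append, List.length_ofFn] at hj
      omega
  · rw [List.append_assoc, List.take_append_of_le_length (by simp),
      List.take_of_length_le (by simp)]
  · rw [htake]
    refine relAt_congr (by simp) (fun i hi => ?_) q
    have hi' : ∀ j, i j < k + n := fun j => by simpa using hi j
    have key : ∀ (a : Fin r → ℕ) (b : Fin n → ℕ),
        (fun j => (List.ofFn c ++ List.ofFn b).getD (i j) 0) =
          join₃ c a b ∘ fun j => posVar d (i j) := by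
      intro a b
      funext j
      have := hi' j
      rw [Function.comp_apply, join₃_posVar (by simp; omega),
        List.getD_append (List.ofFn c ++ List.ofFn b) _ _ _ (by simpa using this)]
    rw [key a'' b'', key a b]
    exact hR _

end Moves

/-! ### The construction data of a structure with d-free tuples -/

section SystemOfMoves

/-- A d-free tuple over `c̄` is nonempty or `c̄` is, because otherwise `R` could not change. -/
theorem DFree.nonempty {L : FirstOrder.Language.{u, v}} {m : ℕ} {M : Type*} [L.Structure M]
    {R : Set (Fin m → M)} {k r : ℕ} {c : Fin k → M}
    {a : Fin r → M} (h : DFree L R c a) : Nonempty (Fin k ⊕ Fin r) := by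
  by_contra hn
  rw [not_nonempty_iff] at hn
  obtain ⟨a', b', -, h2, -⟩ := h 0 Fin.elim0 ⊤ (Language.BoundedFormula.isQF_bot.imp
    Language.BoundedFormula.isQF_bot).isExistential (by simp)
  exact h2 fun i => by rw [Subsingleton.elim (join₂ c a') (join₂ c a)]

variable {L : FirstOrder.Language.{u, v}}
  [Primcodable (Σ n, L.Functions n)] [Primcodable (Σ n, L.Relations n)]
  {A : L.Structure ℕ} {m : ℕ} {R : Set (Fin m → ℕ)}

/-- The first `k` entries of `x` as a tuple. -/
def headTuple (k : ℕ) (x : List ℕ) : Fin k → ℕ := fun i => x.getD i 0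

/-- The entries of `x` from position `k` onwards as a tuple. -/
def tailTuple (k : ℕ) (x : List ℕ) : Fin (x.length - k) → ℕ := fun i => x.getD (k + i) 0

theorem ofFn_headTuple {k : ℕ} {x : List ℕ} (h : k ≤ x.length) :
    List.ofFn (headTuple k x) = x.take k := by
  refine List.ext_getElem (by simp [h]) fun i h1 h2 => ?_
  have h3 : i < x.length := by simp at h1; omega
  simp [headTuple, h3]

theorem ofFn_tailTuple {k : ℕ} {x : List ℕ} : List.ofFn (tailTuple k x) = x.drop k := by
  refine List.ext_getElem (by simp) fun i h1 h2 => ?_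
  have h3 : k + i < x.length := by simp at h1; omega
  simp [tailTuple, h3]

/-- The list `y` is obtained from `x` by replacing `b̄` by `b̄'`, where `ā'`, `b̄'` answers the
diagram formula of `x` and the tuple `ā` given by the list `l`. -/
def IsMove (A : L.Structure ℕ) (R : Set (Fin m → ℕ)) (k : ℕ) (x : List ℕ) (s : ℕ) (l y : List ℕ) :
    Prop :=
  ∃ (r : ℕ) (a : Fin r → ℕ) (d : Fin k ⊕ Fin r ⊕ Fin (x.length - k)) (a' : Fin r → ℕ)
    (b' : Fin (x.length - k) → ℕ), l = List.ofFn a ∧ y = x.take k ++ List.ofFn b' ∧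
    Moves R (headTuple k x) a (tailTuple k x)
      (diagramFormula A d (headTuple k x) a (tailTuple k x) s) a' b'

theorem diagramFormula_realize_self {k : ℕ} {r n : ℕ} {c : Fin k → ℕ} {a : Fin r → ℕ}
    {b : Fin n → ℕ} {d : Fin k ⊕ Fin r ⊕ Fin n} {s : ℕ} :
    (diagramFormula A d c a b s).Realize (join₃ c a b) :=
  realize_diagramFormula.2 ⟨fun _ _ _ _ => Iff.rfl, fun _ _ => rfl⟩

section

variable {k s : ℕ} {x l y : List ℕ}

theorem IsMove.length (h : IsMove A R k x s l y) (hk : k ≤ x.length) : y.length = x.length := by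
  obtain ⟨r, a, d, a', b', -, rfl, -⟩ := h
  simp [hk]

theorem IsMove.take (h : IsMove A R k x s l y) (hk : k ≤ x.length) : y.take k = x.take k := by
  obtain ⟨r, a, d, a', b', -, rfl, -⟩ := h
  rw [List.take_append_of_le_length (by simp [hk]), List.take_take, min_self]

theorem IsMove.nodup (h : IsMove A R k x s l y) (hk : k ≤ x.length) (hx : x.Nodup) : y.Nodup := by
  obtain ⟨r, a, d, a', b', -, rfl, h⟩ := h
  have := h.nodup (by rwa [ofFn_headTuple hk, ofFn_tailTuple, List.take_append_drop])
  rwa [ofFn_headTuple hk] at this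

theorem IsMove.fact (h : IsMove A R k x s l y) (hk : k ≤ x.length) :
    ∀ q < s, factOf A q y = factOf A q x := by
  obtain ⟨r, a, d, a', b', -, rfl, h⟩ := h
  have := (realize_diagramFormula.1 h.1).2
  rwa [ofFn_headTuple hk, ofFn_tailTuple, List.take_append_drop] at this

theorem IsMove.rbit (h : IsMove A R k x s l y) {p : ℕ} (hk : k ≤ p) (hp : p ≤ x.length)
    (hl : ∀ a ∈ l, a ∈ x.take p) : ∃ q, relAt R q (x.take p) ≠ relAt R q (y.take p) := by
  obtain ⟨r, a, d, a', b', rfl, rfl, h⟩ := h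
  have hk' := hk.trans hp
  have := h.exists_relAt_ne hk (by omega) (fun i => by
    rw [ofFn_headTuple hk', ofFn_tailTuple, List.take_append_drop]
    exact hl _ ((List.mem_ofFn' _ _).2 ⟨i, rfl⟩))
  rwa [ofFn_headTuple hk', ofFn_tailTuple, List.take_append_drop] at this

theorem IsMove.return (h : IsMove A R k x s l y) (hk : k ≤ x.length) (w : List ℕ) (t : ℕ)
    (hw : (y ++ w).Nodup) : ∃ z : List ℕ, z.length = (y ++ w).length ∧ z.Nodup ∧
      z.take k = (y ++ w).take k ∧ (∀ q < t, factOf A q z = factOf A q (y ++ w)) ∧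
      ∀ q, relAt R q (z.take x.length) = relAt R q x := by
  obtain ⟨r, a, d, a', b', rfl, rfl, h⟩ := h
  rw [← ofFn_headTuple hk] at hw ⊢
  obtain ⟨z, h1, h2, h3, h4, h5⟩ := h.exists_return w t hw
  refine ⟨z, h1, h2, ?_, h4, fun q => ?_⟩
  · rw [h3, List.append_assoc, List.take_append_of_le_length (by simp),
      List.take_of_length_le (by simp)]
  · have := h5 q
    rwa [ofFn_headTuple hk, ofFn_tailTuple, List.take_append_drop, Nat.add_sub_cancel' hk] at this

end

variable {C : Set ℕ}

/-- The construction data of a structure and a relation computable from `C`, with a `C`-computable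
choice of d-free tuples and of answers to diagram formulas. -/
noncomputable def System.ofMoves (hL : AritiesIn L {charFn C})
    (hA : StructureComputableIn L {charFn C} A)
    (hR : DecidableIn {charFn C} fun x : Fin m → ℕ => x ∈ R) (findA : List ℕ → List ℕ)
    (hfind : ComputableIn {charFn C} findA) (move : ℕ → List ℕ → ℕ → List ℕ)
    (hmove : ComputableIn {charFn C} fun p : ℕ × List ℕ × ℕ => move p.1 p.2.1 p.2.2)
    (h : ∀ k x s, x.Nodup → k ≤ x.length → (∀ a ∈ findA (x.take k), a ∈ x) →
      IsMove A R k x s (findA (x.take k)) (move k x s)) : System C where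
  fact := factOf A
  rbit := relAt R
  bound := tupleBound m
  findA := findA
  move := move
  fact_comp := computableIn_factOf hL hA
  rbit_comp := computableIn_relAt hR
  bound_comp := computableIn_tupleBound
  findA_comp := hfind
  move_comp := hmove
  fact_append := factOf_append
  rbit_append := relAt_append
  rbit_isSome := relAt_isSome
  rbit_total := relAt_total
  rbit_bound := relAt_bound
  length_move := fun hx hk ha => (h _ _ _ hx hk ha).length hk
  nodup_move := fun hx hk ha => (h _ _ _ hx hk ha).nodup hk hx
  take_move := fun hx hk ha => (h _ _ _ hx hk ha).take hk
  fact_move := fun hx hk ha => (h _ _ _ hx hk ha).fact hk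
  rbit_move := fun hx hk ha _ h1 h2 h3 => (h _ _ _ hx hk ha).rbit h1 h2 h3
  return_move := fun hx hk ha w t hw => (h _ _ _ hx hk ha).return hk w t hw

/-- The limit of a construction for `A` and `R` is a copy of `A`, computable from `C`, and the limit
relation codes the image of `R`. -/
theorem System.exists_copy (hL : AritiesIn L {charFn C}) {S : System C}
    (hf : S.fact = factOf (L := L) A) (hr : S.rbit = relAt R) {x : ℕ → List ℕ} {G : ℕ → ℕ}
    (hx : S.Presents x G) :
    ∃ (B : L.Structure ℕ) (F : @FirstOrder.Language.Equiv L ℕ ℕ A B),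
      StructureComputableIn L {charFn C} B ∧ S.limitRel G = relCode (imageRel F R) :=
  ⟨_, @Equiv.inducedStructureEquiv L ℕ ℕ A _, hx.structureComputableIn hf hL,
    S.limitRel_eq hr hx.2.1.1⟩

end SystemOfMoves

/-! ### Gödel numbers of diagram formulas -/

section GoedelNumbers

variable {L : FirstOrder.Language.{u, v}} [Primcodable (Σ n, L.Functions n)]

/-- The number of the variable with number `q` as a symbol of a formula. -/
def termCode (q : ℕ) : ℕ := 2 * Nat.pair 0 (encode [4 * q])

variable {V : Type*} [Encodable V] {v : ℕ → V}

theorem encode_term_var {q : ℕ} :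
    2 * Nat.pair 0 (encode (Language.Term.var (Sum.inl (v q)) : L.Term (V ⊕ Fin 0))) =
      termCode (encode (v q)) := by
  have : encode (Language.Term.var (Sum.inl (v q)) : L.Term (V ⊕ Fin 0)) =
    encode (Language.Term.var (Sum.inl (v q)) : L.Term (V ⊕ Fin 0)).listEncode := rfl
  rw [this, encode_list_eq_of_map]
  simp only [Language.Term.listEncode, List.map_cons, List.map_nil, encode_inl, termCode,
    ← mul_assoc, Nat.reduceMul]

theorem map_finRange {n : ℕ} {l : List ℕ} {β : Type*} (f : ℕ → β) :
    (List.finRange n).map (fun i : Fin n => f (l.getD i 0)) = (firstEntries n l).map f := by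
  refine List.ext_getElem (by simp [firstEntries]) fun i h1 h2 => by simp [firstEntries]

theorem encode_term_func {f : Σ n, L.Functions n} {l : List ℕ} :
    encode (Language.Term.func f.2 (fun i => Language.Term.var (Sum.inl (v (l.getD i 0)))) :
        L.Term (V ⊕ Fin 0)) =
      encode ((2 * encode f + 1) :: (firstEntries f.1 l).map fun i => 4 * encode (v i)) := by
  have : encode (Language.Term.func f.2 (fun i => Language.Term.var (Sum.inl (v (l.getD i 0)))) :
        L.Term (V ⊕ Fin 0)) =
    encode (Language.Term.func f.2 (fun i => Language.Term.var (Sum.inl (v (l.getD i 0)))) :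
        L.Term (V ⊕ Fin 0)).listEncode := rfl
  rw [this, encode_list_eq_of_map]
  simp only [Language.Term.listEncode, List.map_cons, encode_inr, List.map_flatMap, List.map_nil,
    encode_inl, ← mul_assoc, Nat.reduceMul]
  rw [← map_finRange (fun i => 4 * encode (v i)), ← List.map_eq_flatMap]

variable [Primcodable (Σ n, L.Relations n)]

/-- The numbers of the symbols of the formula of an atom, if `e j` is the number of the variable
for the position `j`. The entry `3` after a relation symbol encodes that no variable is bound. -/
def Atom.code (e : ℕ → ℕ) : Atom L → List ℕ :=
  Sum.elim (fun p => [termCode (e p.1), termCode (e p.2)]) <|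
    Sum.elim (fun c => [2 * Nat.pair 0 (encode ((2 * encode c.1 + 1) ::
      (firstEntries c.1.1 c.2.1).map fun i => 4 * e i)), termCode (e c.2.2)])
    (fun c => (4 * encode c.1 + 1) :: 3 :: (firstEntries c.1.1 c.2).map fun i => termCode (e i))

/-- The numbers of the symbols of a literal. The symbol of implication has number `3`, and that of
falsity has number `11`; a negation is an implication of falsity. -/
def literalCode (e : ℕ → ℕ) (p : Bool × Atom L) : List ℕ :=
  bif p.1 then p.2.code e else 3 :: (p.2.code e ++ [11])

/-- The Gödel number of a conjunction of literals, built as the negation of the iterated implication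
from the literals to falsity. -/
def conjCode (e : ℕ → ℕ) (l : List (Bool × Atom L)) : ℕ :=
  encode (3 :: (l.flatMap (fun p => 3 :: literalCode e p) ++ [11, 11]))

theorem map_encode_atom {a : Atom L} :
    (a.formula (n := 0) fun j => Sum.inl (v j)).listEncode.map encode =
      a.code fun j => encode (v j) := by
  rcases a with p | c | c
  · simp only [Atom.formula, Language.Term.bdEqual, Language.BoundedFormula.listEncode,
      List.map_cons, List.map_nil, encode_inl, encode_sigma_val, Atom.code, Sum.elim_inl]
    rw [← encode_term_var (L := L), ← encode_term_var (L := L)]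
    rfl
  · simp only [Atom.formula, Language.Term.bdEqual, Language.BoundedFormula.listEncode,
      List.map_cons, List.map_nil, encode_inl, encode_sigma_val, Atom.code, Sum.elim_inl,
      Sum.elim_inr]
    rw [← encode_term_var (L := L), ← encode_term_func]
    rfl
  · simp only [Atom.formula, Language.Relations.boundedFormula,
      Language.BoundedFormula.listEncode, List.map_append, List.map_map, Function.comp_def,
      List.map_cons, List.map_nil, encode_inl, encode_inr, encode_sigma_val, Atom.code,
      Sum.elim_inr, ← mul_assoc, Nat.reduceMul]
    rw [← map_finRange (fun i => termCode (encode (v i)))]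
    simp only [← encode_term_var (L := L)]
    rfl

theorem map_encode_literal {p : Bool × Atom L} :
    (literal (n := 0) (fun j => Sum.inl (v j)) p).listEncode.map encode =
      literalCode (fun j => encode (v j)) p := by
  obtain ⟨b, a⟩ := p
  cases b
  · have : (literal (n := 0) (fun j => Sum.inl (v j)) (false, a)).listEncode =
      (Sum.inr (Sum.inr 0) :: (a.formula (n := 0) fun j => Sum.inl (v j)).listEncode) ++
        [Sum.inr (Sum.inr 2)] := rfl
    rw [this]
    simp only [List.map_append, List.map_cons, map_encode_atom]
    rfl
  · exact map_encode_atom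

theorem encode_conj {l : List (Bool × Atom L)} :
    encode (conj (n := 0) (fun j => Sum.inl (v j)) l).listEncode =
      conjCode (fun j => encode (v j)) l := by
  have key : (l.foldr (fun p φ => (literal (fun j => Sum.inl (v j)) p).imp φ)
      (⊥ : L.BoundedFormula V 0)).listEncode.map encode =
      l.flatMap (fun p => 3 :: literalCode (fun j => encode (v j)) p) ++ [11] := by
    induction l with
    | nil => rfl
    | cons p l ih =>
      rw [List.foldr_cons, Language.BoundedFormula.listEncode, List.map_append, ih,
        List.map_cons, map_encode_literal, List.flatMap_cons, List.append_assoc]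
      rfl
  rw [encode_list_eq_of_map, conj, Language.BoundedFormula.listEncode, List.map_append,
    List.map_cons, key, conjCode]
  rw [List.cons_append, List.append_assoc]
  rfl

variable {α β γ : Type*} [Primcodable α] [Primcodable β] [Primcodable γ] {O : Set (ℕ →. ℕ)}

theorem computableIn_listFlatMap {f : α → List β} {g : α → β → List γ} (hf : ComputableIn O f)
    (hg : ComputableIn O fun p : α × β => g p.1 p.2) :
    ComputableIn O fun a => (f a).flatMap (g a) :=
  computableIn_of_primrec Primrec.list_flatten (computableIn_listMap hf hg)

@[fun_prop]
theorem computableIn_termCode {f : α → ℕ} (hf : ComputableIn O f) :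
    ComputableIn O fun a => termCode (f a) := by
  unfold termCode
  fun_prop

theorem computableIn_atomCode (hL : AritiesIn L O) {e : α → ℕ → ℕ} {a : α → Atom L}
    (he : ComputableIn O fun p : α × ℕ => e p.1 p.2) (ha : ComputableIn O a) :
    ComputableIn O fun x => (a x).code (e x) := by
  have he' : ∀ {f : α × ℕ × ℕ → ℕ}, ComputableIn O f →
      ComputableIn O fun p : α × ℕ × ℕ => e p.1 (f p) := fun {f} hf =>
    computableIn_comp (f := fun p : α × ℕ => e p.1 p.2) (g := fun p : α × ℕ × ℕ => (p.1, f p)) he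
      (by fun_prop)
  refine computableIn_sumElim (o := a) (f := fun x (p : ℕ × ℕ) =>
      [termCode (e x p.1), termCode (e x p.2)])
    (g := fun x => Sum.elim (fun c => [2 * Nat.pair 0 (encode ((2 * encode c.1 + 1) ::
      (firstEntries c.1.1 c.2.1).map fun i => 4 * e x i)), termCode (e x c.2.2)])
    (fun c => (4 * encode c.1 + 1) :: 3 :: (firstEntries c.1.1 c.2).map fun i =>
      termCode (e x i))) ha ?_ ?_
  · have h1 := he' (f := fun p : α × ℕ × ℕ => p.2.1) (by fun_prop)
    have h2 := he' (f := fun p : α × ℕ × ℕ => p.2.2) (by fun_prop)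
    fun_prop
  · refine computableIn_sumElim (o := fun p : α × FactCode L => p.2)
      (f := fun p (c : (Σ n, L.Functions n) × List ℕ × ℕ) =>
        [2 * Nat.pair 0 (encode ((2 * encode c.1 + 1) ::
          (firstEntries c.1.1 c.2.1).map fun i => 4 * e p.1 i)), termCode (e p.1 c.2.2)])
      (g := fun p (c : (Σ n, L.Relations n) × List ℕ) => (4 * encode c.1 + 1) :: 3 ::
        (firstEntries c.1.1 c.2).map fun i => termCode (e p.1 i)) (by fun_prop) ?_ ?_
    · have h1 : ComputableIn O
          fun p : (α × FactCode L) × (Σ n, L.Functions n) × List ℕ × ℕ => p.2.1.1 :=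
        computableIn_comp (f := fun f : Σ n, L.Functions n => f.1)
          (g := fun p : (α × FactCode L) × (Σ n, L.Functions n) × List ℕ × ℕ => p.2.1) hL.1
          (by fun_prop)
      have h2 : ComputableIn O
          fun p : (α × FactCode L) × (Σ n, L.Functions n) × List ℕ × ℕ =>
            (firstEntries p.2.1.1 p.2.2.1).map fun i => 4 * e p.1.1 i := by
        refine computableIn_listMap
          (g := fun (p : (α × FactCode L) × (Σ n, L.Functions n) × List ℕ × ℕ) i => 4 * e p.1.1 i)
          (computableIn_firstEntries h1 (by fun_prop)) ?_
        have := computableIn_comp (f := fun p : α × ℕ => e p.1 p.2)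
          (g := fun p : ((α × FactCode L) × (Σ n, L.Functions n) × List ℕ × ℕ) × ℕ =>
            (p.1.1.1, p.2)) he (by fun_prop)
        fun_prop
      have h3 := computableIn_comp (f := fun p : α × ℕ => e p.1 p.2)
        (g := fun p : (α × FactCode L) × (Σ n, L.Functions n) × List ℕ × ℕ => (p.1.1, p.2.2.2))
        he (by fun_prop)
      fun_prop
    · have h1 : ComputableIn O
          fun p : (α × FactCode L) × (Σ n, L.Relations n) × List ℕ => p.2.1.1 :=
        computableIn_comp (f := fun f : Σ n, L.Relations n => f.1)
          (g := fun p : (α × FactCode L) × (Σ n, L.Relations n) × List ℕ => p.2.1) hL.2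
          (by fun_prop)
      have h2 : ComputableIn O
          fun p : (α × FactCode L) × (Σ n, L.Relations n) × List ℕ =>
            (firstEntries p.2.1.1 p.2.2).map fun i => termCode (e p.1.1 i) := by
        refine computableIn_listMap
          (g := fun (p : (α × FactCode L) × (Σ n, L.Relations n) × List ℕ) i =>
            termCode (e p.1.1 i))
          (computableIn_firstEntries h1 (by fun_prop)) ?_
        have := computableIn_comp (f := fun p : α × ℕ => e p.1 p.2)
          (g := fun p : ((α × FactCode L) × (Σ n, L.Relations n) × List ℕ) × ℕ =>
            (p.1.1.1, p.2)) he (by fun_prop)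
        fun_prop
      fun_prop

theorem computableIn_conjCode (hL : AritiesIn L O) {e : α → ℕ → ℕ}
    {l : α → List (Bool × Atom L)} (he : ComputableIn O fun p : α × ℕ => e p.1 p.2)
    (hl : ComputableIn O l) : ComputableIn O fun x => conjCode (e x) (l x) := by
  have h1 : ComputableIn O fun p : α × Bool × Atom L => p.2.2.code (e p.1) :=
    computableIn_atomCode (e := fun p : α × Bool × Atom L => e p.1) hL
      (computableIn_comp (f := fun p : α × ℕ => e p.1 p.2)
        (g := fun p : (α × Bool × Atom L) × ℕ => (p.1.1, p.2)) he (by fun_prop)) (by fun_prop)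
  have h2 : ComputableIn O fun p : α × Bool × Atom L => literalCode (e p.1) p.2 :=
    computableIn_cond (by fun_prop) h1 (by fun_prop)
  have h3 : ComputableIn O fun x => (l x).flatMap fun p => 3 :: literalCode (e x) p :=
    computableIn_listFlatMap (g := fun x p => 3 :: literalCode (e x) p) hl (by fun_prop)
  unfold conjCode
  fun_prop

theorem computableIn_diagram {A : L.Structure ℕ} (hL : AritiesIn L O)
    (hA : StructureComputableIn L O A) {x a : α → List ℕ} {s : α → ℕ} (hx : ComputableIn O x)
    (ha : ComputableIn O a) (hs : ComputableIn O s) :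
    ComputableIn O fun y => diagram A (x y) (a y) (s y) := by
  classical
  refine computableIn_append ?_ ?_
  · refine computableIn_listFlatMap (g := fun y i => (List.range (x y ++ a y).length).map fun j =>
      ((decide ((x y ++ a y).getD i 0 = (x y ++ a y).getD j 0), Sum.inl (i, j)) :
        Bool × Atom L)) (by fun_prop) ?_
    refine computableIn_listMap (g := fun (p : α × ℕ) j =>
      ((decide ((x p.1 ++ a p.1).getD p.2 0 = (x p.1 ++ a p.1).getD j 0), Sum.inl (p.2, j)) :
        Bool × Atom L)) (by fun_prop) (computableIn_pair ?_ ?_)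
    · exact (decidableIn_eq (by fun_prop) (by fun_prop)).decide
    · exact computableIn_of_primrec Primrec.sumInl (by fun_prop)
  · refine computableIn_listFlatMap (g := fun y q => (decode (α := FactCode L) q).elim [] fun c =>
      if c.Fits (x y).length then [(c.value A (x y), Sum.inr c)] else []) (by fun_prop) ?_
    refine computableIn_optionElim (o := fun p : α × ℕ => decode (α := FactCode L) p.2)
      (g := fun p c => if c.Fits (x p.1).length then [(c.value A (x p.1), Sum.inr c)] else [])
      (computableIn_of_primrec Primrec.decode (by fun_prop)) (by fun_prop) ?_
    refine computableIn_ite (decidableIn_fits hL (by fun_prop) (by fun_prop))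
      (computableIn_cons (computableIn_pair ?_ ?_) (by fun_prop)) (by fun_prop)
    · exact computableIn_value hA (by fun_prop) (by fun_prop)
    · exact computableIn_of_primrec Primrec.sumInr (by fun_prop)

/-- The number of the variable `posVar d j`, if `q` is the number of `d`. -/
def posCode (k r n q j : ℕ) : ℕ :=
  if j < k then 2 * j else if j - k < n then 4 * (j - k) + 3 else
    if j - k - n < r then 4 * (j - k - n) + 1 else q

theorem encode_posVar {k r n : ℕ} {d : Fin k ⊕ Fin r ⊕ Fin n} {j : ℕ} :
    encode (posVar d j) = posCode k r n (encode d) j := by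
  have he : ∀ {n : ℕ} (i : Fin n), encode i = (i : ℕ) := fun i => rfl
  unfold posVar posCode
  split_ifs
  · simp [he]
  · simp only [encode_inr, he]
    omega
  · simp only [encode_inr, encode_inl, he]
    omega
  · rfl

/-- The Gödel number of a diagram formula is given by list operations on the numbers of symbols. -/
theorem goedel_diagramFormula {A : L.Structure ℕ} {k r n : ℕ} {d : Fin k ⊕ Fin r ⊕ Fin n}
    {c : Fin k → ℕ} {a : Fin r → ℕ} {b : Fin n → ℕ} {s : ℕ} :
    goedel (diagramFormula A d c a b s) = conjCode (posCode k r n (encode d))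
      (diagram A (List.ofFn c ++ List.ofFn b) (List.ofFn a) s) := by
  unfold goedel diagramFormula
  rw [encode_conj]
  simp only [encode_posVar]

end GoedelNumbers

/-! ### Degrees -/

section Degrees

theorem setDegree_eq_iff {X Y : Set ℕ} :
    setDegree X = setDegree Y ↔ SetReducible X Y ∧ SetReducible Y X := by
  exact ⟨fun h => Quotient.exact h, fun h => Quotient.sound h⟩

theorem setReducible_setJoin_empty (X : Set ℕ) : SetReducible (setJoin X ∅) X := by
  rw [setReducible_iff]
  have h : DecidableIn {charFn X} fun n => n ∈ X := setReducible_iff.1 (TuringReducible.refl _)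
  exact decidableIn_setJoin (X := fun _ => X) (Y := fun _ => ∅) (by fun_prop)
    (h.comp (f := fun j : ℕ => j / 2) (by fun_prop))
    (DecidableIn.of_decide (by simpa using computableIn_const false))

/-- Projections of decidable predicates are c.e., by unbounded search. -/
theorem ceIn_of_exists {O : Set (ℕ →. ℕ)} {P : ℕ → ℕ → Prop}
    (hP : DecidableIn O fun p : ℕ × ℕ => P p.1 p.2) : CEIn O {n | ∃ s, P n s} := by
  obtain ⟨b, hb, hb'⟩ := hP
  have hb0 : ComputableIn O fun q : ℕ × ℕ => bif b q then 0 else 1 :=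
    computableIn_of_primrec (f := fun b : Bool => bif b then 0 else 1) (Primrec.dom_bool _) hb
  rw [computableIn_iff_nat] at hb0
  have hz : Nat.RecursiveIn O fun _ => Part.some 0 := Nat.RecursiveIn.zero
  refine (hz.comp (Nat.RecursiveIn.rfind hb0)).of_eq fun n => ?_
  by_cases h : ∃ s, P n s
  · obtain ⟨s, hs⟩ := h
    have hd : (Nat.rfind fun m => (fun m => decide (m = 0)) <$> (Part.bind
        (decode (α := ℕ × ℕ) (Nat.pair n m)) fun a => Part.some (encode (bif b a then 0 else 1)) :
          Part ℕ)).Dom := by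
      refine Nat.rfind_dom.2 ⟨s, ?_, fun _ => ?_⟩
      · simp [(hb' (n, s)).1 hs]
      · simp
    obtain ⟨y, hy⟩ := Part.dom_iff_mem.1 hd
    have hmem : ∃ s, P n s := ⟨s, hs⟩
    rw [Part.eq_some_iff.2 hy]
    simp [Part.assert_pos hmem]
  · have hd : (Nat.rfind fun m => (fun m => decide (m = 0)) <$> (Part.bind
        (decode (α := ℕ × ℕ) (Nat.pair n m)) fun a => Part.some (encode (bif b a then 0 else 1)) :
          Part ℕ)) = Part.none := by
      refine Part.eq_none_iff.2 fun m hm => h ⟨m, (hb' (n, m)).2 ?_⟩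
      have := (Nat.mem_rfind.1 hm).1
      by_contra hbm
      rw [Bool.not_eq_true] at hbm
      simp [hbm] at this
    rw [hd]
    simp [Part.assert_neg h]

theorem ceIn_setJoin {C W : Set ℕ} (h : CEIn {charFn C} W) : CEIn {charFn C} (setJoin W C) := by
  obtain ⟨e, rfl⟩ := exists_wSet_eq h
  have hC : DecidableIn {charFn C} fun n => n ∈ C := setReducible_iff.1 (TuringReducible.refl _)
  have h2 : DecidableIn {charFn C} fun p : ℕ × ℕ => p.1 ∈ setJoin (WStage C e p.2) C :=
    decidableIn_setJoin (X := fun p : ℕ × ℕ => WStage C e p.2) (Y := fun _ => C) (by fun_prop)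
      (decidableIn_wStage (by fun_prop) (by fun_prop) (by fun_prop))
      (hC.comp (f := fun p : ℕ × ℕ => p.1 / 2) (by fun_prop))
  convert ceIn_of_exists (P := fun n s => n ∈ setJoin (WStage C e s) C) h2 using 1
  ext n
  simp only [mem_setJoin, WSet, Set.mem_iUnion, Set.mem_ofPred_eq]
  split_ifs <;> simp

/-- The property `P` holds on a cone: for all oracles above some oracle. -/
def OnCone (P : Set ℕ → Prop) : Prop := ∃ X, ∀ C, SetReducible X C → P C

theorem OnCone.and {P Q : Set ℕ → Prop} (hP : OnCone P) (hQ : OnCone Q) :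
    OnCone fun C => P C ∧ Q C := by
  obtain ⟨X, hX⟩ := hP
  obtain ⟨Y, hY⟩ := hQ
  exact ⟨setJoin X Y, fun C h => ⟨hX C ((System.setJoin_left_reducible X).trans h),
    hY C ((System.setJoin_right_reducible X).trans h)⟩⟩

/-- Every function is computable from the oracles above its graph. -/
theorem onCone_computableIn {α β : Type*} [Primcodable α] [Primcodable β] [Inhabited β]
    (f : α → β) : OnCone fun C => ComputableIn {charFn C} f := by
  set X : Set ℕ := {p | ∃ a, p = Nat.pair (encode a) (encode (f a))} with hX
  refine ⟨X, fun C hC => ?_⟩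
  obtain ⟨g, hg, hg'⟩ := DecidableIn.exists_selector (O := {charFn C}) (G := fun _ : α => True)
    (P := fun a b => Nat.pair (encode a) (encode b) ∈ X)
    (DecidableIn.of_decide (by simpa using computableIn_const true))
    ((setReducible_iff.1 hC).comp (f := fun p : α × β => Nat.pair (encode p.1) (encode p.2))
      (by fun_prop)) fun a _ => ⟨f a, a, rfl⟩
  convert hg using 1
  funext a
  obtain ⟨a', ha⟩ := hg' a trivial
  obtain ⟨h1, h2⟩ := Nat.pair_eq_pair.1 ha
  rw [encode_injective h2, encode_injective h1]

end Degrees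

/-! ### Effectively d-free relations -/

section Effective

theorem computableIn_empty_iff {α β : Type*} [Primcodable α] [Primcodable β] {f : α → β} :
    ComputableIn {charFn ∅} f ↔ Computable f := by
  refine ⟨fun h => ?_, fun h => h.computableIn⟩
  refine RecursiveIn.partrec_of_oracle (O := {charFn ∅}) (fun g hg => ?_) h
  rw [hg]
  have : charFn ∅ = fun _ => Part.some 0 := by
    funext n
    simp [charFn]
  rw [this]
  exact (Computable.const 0).partrec

/-- The number of a variable of the formulas with `k > 0` variables in the first block or,
if `k = 0`, of those with variables in the last block. -/
def defaultCode (k : ℕ) : ℕ := if k = 0 then 3 else 0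

theorem exists_encode_eq_defaultCode {k r n : ℕ} (h : 0 < k ∨ 0 < n) :
    ∃ d : Fin k ⊕ Fin r ⊕ Fin n, encode d = defaultCode k := by
  unfold defaultCode
  split_ifs with hk
  · exact ⟨Sum.inr (Sum.inr ⟨0, h.resolve_left (by omega)⟩), rfl⟩
  · exact ⟨Sum.inl ⟨0, by omega⟩, rfl⟩

theorem DFree.exists_default {L : FirstOrder.Language.{u, v}} [L.Structure ℕ] {m : ℕ}
    {R : Set (Fin m → ℕ)} {k r : ℕ} {x : List ℕ} {a : Fin r → ℕ}
    (h : DFree L R (headTuple k x) a) (ha : ∀ i, a i ∈ x) :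
    ∃ d : Fin k ⊕ Fin r ⊕ Fin (x.length - k), encode d = defaultCode k := by
  refine exists_encode_eq_defaultCode ?_
  by_contra! h0
  obtain ⟨rfl | hk, hn⟩ : (k = 0 ∨ False) ∧ x.length - k = 0 := by omega
  · rcases h.nonempty with ⟨i | i⟩
    · exact i.elim0
    · have := List.length_pos_of_mem (ha i)
      omega
  · exact hk

variable {L : FirstOrder.Language.{u, v}}
  [Primcodable (Σ n, L.Functions n)] [Primcodable (Σ n, L.Relations n)]
  {A : L.Structure ℕ} {m : ℕ} {R : Set (Fin m → ℕ)}

/-- The list `x` contains the tuple chosen for its first `k` entries. -/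
def Admissible (findA : List ℕ → List ℕ) (k : ℕ) (x : List ℕ) : Prop :=
  x.Nodup ∧ k ≤ x.length ∧ ∀ a ∈ findA (x.take k), a ∈ x

theorem decidableIn_admissible {O : Set (ℕ →. ℕ)} {findA : List ℕ → List ℕ}
    (h : ComputableIn O findA) :
    DecidableIn O fun p : ℕ × List ℕ × ℕ => Admissible findA p.1 p.2.1 := by
  refine (System.decidableIn_nodup (by fun_prop)).and
    ((decidableIn_le (by fun_prop) (by fun_prop)).and ?_)
  exact DecidableIn.listForall (P := fun (p : ℕ × List ℕ × ℕ) b => b ∈ p.2.1)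
    (DecidableIn.listMem (by fun_prop) (by fun_prop)) (by fun_prop)

/-- The Gödel number of the diagram formula of `x` and the tuple chosen for its first `k` entries,
on input `(k, x, s)`. -/
noncomputable def diagramCode (A : L.Structure ℕ) (findA : List ℕ → List ℕ)
    (p : ℕ × List ℕ × ℕ) : ℕ :=
  conjCode (posCode p.1 (findA (p.2.1.take p.1)).length (p.2.1.length - p.1) (defaultCode p.1))
    (diagram A p.2.1 (findA (p.2.1.take p.1)) p.2.2)

theorem computableIn_diagramCode {O : Set (ℕ →. ℕ)} {findA : List ℕ → List ℕ}
    (hL : AritiesIn L O) (hA : StructureComputableIn L O A) (h : ComputableIn O findA) :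
    ComputableIn O (diagramCode A findA) := by
  have hd : ComputableIn O defaultCode :=
    computableIn_ite (decidableIn_eq (by fun_prop) (by fun_prop)) (by fun_prop) (by fun_prop)
  refine computableIn_conjCode hL ?_ (computableIn_diagram hL hA (by fun_prop) (by fun_prop)
    (by fun_prop))
  refine computableIn_ite (decidableIn_lt (by fun_prop) (by fun_prop)) (by fun_prop)
    (computableIn_ite (decidableIn_lt (by fun_prop) (by fun_prop)) (by fun_prop)
      (computableIn_ite (decidableIn_lt (by fun_prop) (by fun_prop)) (by fun_prop) (by fun_prop)))

/-- For an effectively d-free relation the moves can be computed, as the Gödel numbers of diagram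
formulas can. -/
theorem EffectivelyDFree.exists_move (hL : ComputableLanguage L) (hA : ComputableStructure L A)
    (h : @EffectivelyDFree L _ _ A m R) :
    ∃ (findA : List ℕ → List ℕ) (move : ℕ → List ℕ → ℕ → List ℕ), Computable findA ∧
      (Computable fun p : ℕ × List ℕ × ℕ => move p.1 p.2.1 p.2.2) ∧
      ∀ k x s, x.Nodup → k ≤ x.length → (∀ a ∈ findA (x.take k), a ∈ x) →
        IsMove A R k x s (findA (x.take k)) (move k x s) := by
  obtain ⟨findA, findMove, _, hfind, hmove, _, hspec⟩ := h
  have hL' : AritiesIn L {charFn ∅} :=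
    ⟨computableIn_empty_iff.2 hL.1, computableIn_empty_iff.2 hL.2⟩
  have hA' : StructureComputableIn L {charFn ∅} A :=
    ⟨RecursiveIn.mono (Set.empty_subset _) hA.1, RecursiveIn.mono (Set.empty_subset _) hA.2⟩
  have hfind' : ComputableIn {charFn ∅} findA := computableIn_empty_iff.2 hfind
  obtain ⟨adm, hadm, hadm'⟩ := decidableIn_admissible hfind'
  have key : ∀ k x s, Admissible findA k x → ∃ y : List ℕ × List ℕ,
      y ∈ findMove (x.take k, x.drop k, diagramCode A findA (k, x, s)) ∧
        IsMove A R k x s (findA (x.take k)) (x.take k ++ y.2) := by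
    rintro k x s ⟨hx, hk, ha⟩
    obtain ⟨r, a, hra, hfree, ha'⟩ := hspec k (headTuple k x)
    rw [ofFn_headTuple hk] at hra
    obtain ⟨d, hd⟩ := hfree.exists_default fun i =>
      ha _ (hra ▸ (List.mem_ofFn' _ _).2 ⟨i, rfl⟩)
    obtain ⟨a', b', h1, h2, -⟩ := ha' _ (tailTuple k x)
      (diagramFormula A d (headTuple k x) a (tailTuple k x) s)
      (isQF_conj _ _).isExistential diagramFormula_realize_self
    rw [goedel_diagramFormula, hd, ofFn_headTuple hk, ofFn_tailTuple, List.take_append_drop] at h1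
    refine ⟨(List.ofFn a', List.ofFn b'), ?_, r, a, d, a', b', hra, rfl, h2⟩
    simpa only [diagramCode, hra, List.length_ofFn] using h1
  set g : ℕ × List ℕ × ℕ →. List ℕ := fun p => bif adm p then
    (findMove (p.2.1.take p.1, p.2.1.drop p.1, diagramCode A findA p)).map
      (fun y => p.2.1.take p.1 ++ y.2) else Part.some [] with hg
  have hgp : Partrec g := by
    have hin : Computable fun p : ℕ × List ℕ × ℕ =>
        (p.2.1.take p.1, p.2.1.drop p.1, diagramCode A findA p) := by
      have := computableIn_diagramCode hL' hA' hfind'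
      exact computableIn_empty_iff.1 (by fun_prop)
    refine Partrec.cond (computableIn_empty_iff.1 hadm) ((hmove.comp hin).map ?_)
      (Computable.const []).partrec
    have : ComputableIn {charFn ∅} fun q : (ℕ × List ℕ × ℕ) × List ℕ × List ℕ =>
      q.1.2.1.take q.1.1 ++ q.2.2 := by fun_prop
    exact computableIn_empty_iff.1 this
  have htot : ∀ p, ∃ y, y ∈ g p ∧ (Admissible findA p.1 p.2.1 →
      IsMove A R p.1 p.2.1 p.2.2 (findA (p.2.1.take p.1)) y) := by
    rintro ⟨k, x, s⟩
    by_cases hp : Admissible findA k x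
    · obtain ⟨y, hy, hy'⟩ := key k x s hp
      refine ⟨x.take k ++ y.2, ?_, fun _ => hy'⟩
      simp only [hg, (hadm' (k, x, s)).1 hp, cond_true]
      exact Part.mem_map _ hy
    · refine ⟨[], ?_, fun h => absurd h hp⟩
      have : adm (k, x, s) = false := by
        rw [← Bool.not_eq_true, ← hadm' (k, x, s)]
        exact hp
      simp [hg, this]
  choose move hm hm' using htot
  refine ⟨findA, fun k x s => move (k, x, s), hfind, ?_, fun k x s h1 h2 h3 =>
    hm' (k, x, s) ⟨h1, h2, h3⟩⟩
  exact hgp.of_eq fun p => Part.eq_some_iff.2 (hm p)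

/-- The avoiding construction without oracle yields a computable copy. -/
theorem exists_copy_not_ofCEDegree (hL : ComputableLanguage L) (hA : ComputableStructure L A)
    (hR : ComputablePred fun x : Fin m → ℕ => x ∈ R) (h : @EffectivelyDFree L _ _ A m R) :
    ∃ (B : L.Structure ℕ) (F : @FirstOrder.Language.Equiv L ℕ ℕ A B),
      ComputableStructure L B ∧ ¬ OfCEDegree (relCode (imageRel F R)) := by
  obtain ⟨findA, move, hfind, hmove, hspec⟩ := h.exists_move hL hA
  have hL' : AritiesIn L {charFn ∅} :=
    ⟨computableIn_empty_iff.2 hL.1, computableIn_empty_iff.2 hL.2⟩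
  have hA' : StructureComputableIn L {charFn ∅} A :=
    ⟨RecursiveIn.mono (Set.empty_subset _) hA.1, RecursiveIn.mono (Set.empty_subset _) hA.2⟩
  have hR' : DecidableIn {charFn ∅} fun x : Fin m → ℕ => x ∈ R := by
    obtain ⟨_, hR⟩ := hR
    exact DecidableIn.of_decide (computableIn_empty_iff.2 hR)
  set S : System ∅ := System.ofMoves hL' hA' hR' findA (computableIn_empty_iff.2 hfind) move
    (computableIn_empty_iff.2 hmove) hspec
  obtain ⟨x, G, hG, havoid⟩ := S.exists_avoiding
  obtain ⟨B, F, hB, hF⟩ := System.exists_copy hL' (S := S) rfl rfl hG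
  refine ⟨B, F, ?_, ?_⟩
  · have h1 := computableIn_empty_iff.1 hB.1
    have h2 := computableIn_empty_iff.1 hB.2
    exact ⟨h1.computableIn, h2.computableIn⟩
  · rintro ⟨W, hW, hdeg⟩
    rw [setDegree_eq_iff, ← hF] at hdeg
    obtain ⟨e, rfl⟩ := exists_wSet_eq (C := ∅) (W := W) (Partrec.recursiveIn hW)
    exact havoid e ((setReducible_setJoin_empty _).trans hdeg.1)
      (hdeg.2.trans (System.setJoin_left_reducible _))

end Effective

/-! ### Degree spectra on a cone -/

section Cone

variable {L : FirstOrder.Language.{u, v}} {m : ℕ}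

section Transport

variable {M : Type*} {N : Type*}

theorem sameOn_imageRel (e : M ≃ N) {R : Set (Fin m → M)} {ι : Type*} {x y : ι → M} :
    SameOn (imageRel e R) (e ∘ x) (e ∘ y) ↔ SameOn R x y := by
  have h : ∀ z : Fin m → M, e ∘ z ∈ imageRel e R ↔ z ∈ R := by
    intro z
    constructor
    · rintro ⟨z', hz', he⟩
      rwa [← e.injective.comp_left he]
    · exact fun hz => ⟨z, hz, rfl⟩
  unfold SameOn
  simp only [Function.comp_assoc, h]

theorem comp_join₃ (e : M → N) {k r n : ℕ} (c : Fin k → M) (a : Fin r → M) (b : Fin n → M) :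
    e ∘ join₃ c a b = join₃ (e ∘ c) (e ∘ a) (e ∘ b) := by
  simp [join₃, Sum.comp_elim]

theorem comp_join₂ (e : M → N) {k r : ℕ} (c : Fin k → M) (a : Fin r → M) :
    e ∘ join₂ c a = join₂ (e ∘ c) (e ∘ a) := by
  simp [join₂, Sum.comp_elim]

variable [L.Structure M] [L.Structure N]

/-- D-freeness is invariant under isomorphisms. -/
theorem DFree.image {R : Set (Fin m → M)} {k r : ℕ} {c : Fin k → M} {a : Fin r → M}
    (h : DFree L R c a) (e : M ≃[L] N) : DFree L (imageRel e R) (e ∘ c) (e ∘ a) := by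
  have hreal : ∀ {n} (φ : Fml L k r n) (a : Fin r → M) (b : Fin n → M),
      φ.Realize (join₃ (e ∘ c) (e ∘ a) (e ∘ b)) ↔ φ.Realize (join₃ c a b) := by
    intro n φ a b
    rw [← comp_join₃]
    exact Language.StrongHomClass.realize_formula e φ
  have hb : ∀ {n} (b : Fin n → N), e ∘ (e.symm ∘ b) = b := by
    intro n b
    funext i
    simp
  intro n b φ hφ hr
  rw [← hb b, hreal] at hr
  obtain ⟨a', b', h1, h2, h3⟩ := h n (e.symm ∘ b) φ hφ hr
  refine ⟨e ∘ a', e ∘ b', (hreal _ _ _).2 h1, ?_, fun ψ hψ hr => ?_⟩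
  · rw [← comp_join₂, ← comp_join₂]
    exact fun h => h2 ((sameOn_imageRel e.toEquiv).1 h)
  · obtain ⟨a'', b'', h4, h5⟩ := h3 ψ hψ ((hreal _ _ _).1 hr)
    refine ⟨e ∘ a'', e ∘ b'', (hreal _ _ _).2 h4, ?_⟩
    rw [← hb b, ← comp_join₃, ← comp_join₃]
    exact (sameOn_imageRel e.toEquiv).2 h5

end Transport

theorem exists_formula_equations {V : Type*} (l : List (V × V)) : ∃ φ : L.Formula V,
    Language.BoundedFormula.IsQF φ ∧ ∀ {M : Type w} [L.Structure M] (J : V → M),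
      φ.Realize J ↔ ∀ p ∈ l, J p.1 = J p.2 := by
  induction l with
  | nil => exact ⟨⊤, Language.BoundedFormula.isQF_bot.imp Language.BoundedFormula.isQF_bot,
      fun J => by simp⟩
  | cons p l ih =>
    obtain ⟨φ, h1, h2⟩ := ih
    refine ⟨(Language.Term.var p.1).equal (Language.Term.var p.2) ⊓ φ,
      (Language.BoundedFormula.IsAtomic.equal _ _).isQF.inf h1, fun J => ?_⟩
    rw [Language.Formula.realize_inf, h2]
    simp

/-- No tuple is d-free over a tuple that contains it. -/
theorem DFree.exists_notMem_range {M : Type w} [L.Structure M] {R : Set (Fin m → M)} {k r : ℕ}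
    {c : Fin k → M} {a : Fin r → M} (h : DFree L R c a) : ∃ i, a i ∉ Set.range c := by
  by_contra! hc
  choose j hj using hc
  obtain ⟨φ, hφ, hr⟩ := exists_formula_equations (L := L)
    (List.ofFn fun i : Fin r => ((Sum.inr (Sum.inl i), Sum.inl (j i)) :
      (Fin k ⊕ Fin r ⊕ Fin 0) × (Fin k ⊕ Fin r ⊕ Fin 0)))
  simp only [List.forall_mem_ofFn_iff] at hr
  obtain ⟨a', b', h1, h2, -⟩ := h 0 Fin.elim0 φ hφ.isExistential
    ((hr _).2 fun i => by simp [join₃, hj])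
  have : a' = a := funext fun i => by
    have := (hr _).1 h1 i
    simpa [join₃, hj] using this
  exact h2 (this ▸ fun _ => Iff.rfl)

/-- A finite structure is listed by a tuple, and nothing is d-free over that tuple. -/
theorem infinite_of_dFree {M : Type w} [L.Structure M] {R : Set (Fin m → M)}
    (h : ∀ (k : ℕ) (c : Fin k → M), ∃ (r : ℕ) (a : Fin r → M), DFree L R c a) : Infinite M := by
  by_contra hM
  rw [not_infinite_iff_finite] at hM
  obtain ⟨n, ⟨e⟩⟩ := Finite.exists_equiv_fin M
  obtain ⟨r, a, ha⟩ := h n e.symm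
  obtain ⟨i, hi⟩ := ha.exists_notMem_range
  exact hi (e.symm.surjective _)

variable [Primcodable (Σ n, L.Functions n)] [Primcodable (Σ n, L.Relations n)]

theorem DFree.exists_isMove {A : L.Structure ℕ} {R : Set (Fin m → ℕ)} {k r : ℕ} {x : List ℕ}
    {a : Fin r → ℕ} (h : DFree L R (headTuple k x) a) (ha : ∀ i, a i ∈ x) (s : ℕ) :
    ∃ y, IsMove A R k x s (List.ofFn a) y := by
  obtain ⟨d, -⟩ := h.exists_default ha
  obtain ⟨a', b', h⟩ := h _ (tailTuple k x)
    (diagramFormula A d (headTuple k x) a (tailTuple k x) s)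
    (isQF_conj _ _).isExistential diagramFormula_realize_self
  exact ⟨_, r, a, d, a', b', rfl, rfl, h⟩

theorem exists_move {A : L.Structure ℕ} {R : Set (Fin m → ℕ)}
    (h : ∀ (k : ℕ) (c : Fin k → ℕ), ∃ (r : ℕ) (a : Fin r → ℕ), DFree L R c a) :
    ∃ (findA : List ℕ → List ℕ) (move : ℕ → List ℕ → ℕ → List ℕ),
      ∀ k x s, x.Nodup → k ≤ x.length → (∀ a ∈ findA (x.take k), a ∈ x) →
        IsMove A R k x s (findA (x.take k)) (move k x s) := by
  choose r a ha using h
  set findA : List ℕ → List ℕ := fun l =>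
    List.ofFn (a (List.equivSigmaTuple l).1 (List.equivSigmaTuple l).2) with hfind
  have hfindA : ∀ {k} (c : Fin k → ℕ), findA (List.ofFn c) = List.ofFn (a k c) := by
    intro k c
    have : List.equivSigmaTuple (List.ofFn c) = ⟨k, c⟩ :=
      List.equivSigmaTuple.apply_symm_apply ⟨k, c⟩
    change (fun p : Σ n, Fin n → ℕ => List.ofFn (a p.1 p.2))
      (List.equivSigmaTuple (List.ofFn c)) = _
    rw [this]
  have key : ∀ k x s, ∃ y, x.Nodup → k ≤ x.length → (∀ a ∈ findA (x.take k), a ∈ x) →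
      IsMove A R k x s (findA (x.take k)) y := by
    intro k x s
    by_cases hadm : k ≤ x.length ∧ ∀ a ∈ findA (x.take k), a ∈ x
    · obtain ⟨hk, hmem⟩ := hadm
      rw [← ofFn_headTuple hk, hfindA] at hmem ⊢
      obtain ⟨y, hy⟩ := (ha k (headTuple k x)).exists_isMove (A := A)
        (fun i => hmem _ ((List.mem_ofFn' _ _).2 ⟨i, rfl⟩)) s
      exact ⟨y, fun _ _ _ => hy⟩
    · exact ⟨[], fun _ h1 h2 => absurd ⟨h1, h2⟩ hadm⟩
  choose move hmove using key
  exact ⟨findA, move, hmove⟩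

/-- An oracle that encodes the structure, the relation, the d-free tuples and the answers to diagram
formulas can run the constructions. -/
theorem onCone_system {A : L.Structure ℕ} {R : Set (Fin m → ℕ)}
    (h : ∀ (k : ℕ) (c : Fin k → ℕ), ∃ (r : ℕ) (a : Fin r → ℕ), DFree L R c a) :
    OnCone fun C => AritiesIn L {charFn C} ∧
      ∃ S : System C, S.fact = factOf (L := L) A ∧ S.rbit = relAt R := by
  classical
  obtain ⟨findA, move, hmove⟩ := exists_move (A := A) h
  obtain ⟨X, hX⟩ := (((onCone_computableIn fun f : Σ n, L.Functions n => f.1).and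
    (onCone_computableIn fun r : Σ n, L.Relations n => r.1)).and
    ((onCone_computableIn fun p : (Σ n, L.Functions n) × List ℕ =>
      A.funMap p.1.2 (fun i => p.2.getD i 0)).and
    (onCone_computableIn fun p : (Σ n, L.Relations n) × List ℕ =>
      decide (A.RelMap p.1.2 (fun i => p.2.getD i 0))))).and
    ((onCone_computableIn fun x : Fin m → ℕ => decide (x ∈ R)).and
    ((onCone_computableIn findA).and
    (onCone_computableIn fun p : ℕ × List ℕ × ℕ => move p.1 p.2.1 p.2.2)))
  refine ⟨X, fun C hC => ?_⟩
  obtain ⟨⟨hL, hA⟩, hR, hfind, hmove'⟩ := hX C hC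
  exact ⟨hL, System.ofMoves hL (A := A) ⟨hA.1, by convert hA.2⟩ (DecidableIn.of_decide hR) findA
    hfind move hmove' hmove, rfl, rfl⟩

theorem degreeSpectrumBelow_image {M : Type w} [L.Structure M] (R : Set (Fin m → M)) (e : M ≃ ℕ)
    {C : Set ℕ} {d : TuringDegree}
    (h : ∃ (B : L.Structure ℕ) (F : @FirstOrder.Language.Equiv L ℕ ℕ e.inducedStructure B),
      StructureComputableIn L {charFn C} B ∧
        d = setDegree (setJoin (relCode (imageRel F (imageRel e R))) C)) :
    d ∈ degreeSpectrumBelow (L := L) R C := by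
  obtain ⟨B, F, hB, rfl⟩ := h
  let A : L.Structure ℕ := e.inducedStructure
  refine ⟨B, @FirstOrder.Language.Equiv.comp L M ℕ _ A ℕ B F (Equiv.inducedStructureEquiv e),
    hB, ?_⟩
  congr 3
  simp only [imageRel, Set.image_image]
  rfl

/-- Above a suitable oracle, every relatively c.e. degree is realized by the coding construction,
and the avoiding construction yields a further degree. -/
theorem spectrumOnCone_of_dFree {M : Type w} [Countable M] [L.Structure M] (R : Set (Fin m → M))
    (h : ∀ (k : ℕ) (c : Fin k → M), ∃ (r : ℕ) (a : Fin r → M), DFree L R c a) :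
    SpectrumOnConeStrictlyContainsCE (L := L) R := by
  have := infinite_of_dFree h
  obtain ⟨e⟩ : Nonempty (M ≃ ℕ) := nonempty_equiv_of_countable
  let A : L.Structure ℕ := e.inducedStructure
  have hA : ∀ (k : ℕ) (c : Fin k → ℕ), ∃ (r : ℕ) (a : Fin r → ℕ), DFree L (imageRel e R) c a := by
    intro k c
    obtain ⟨r, a, ha⟩ := h k (e.symm ∘ c)
    refine ⟨r, e ∘ a, ?_⟩
    have := ha.image (Equiv.inducedStructureEquiv e)
    have hc : c = e ∘ e.symm ∘ c := by
      funext i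
      simp
    rw [hc]
    exact this
  obtain ⟨X, hX⟩ := onCone_system (A := A) hA
  refine ⟨X, fun C hC => ?_⟩
  obtain ⟨hL, S, hf, hr⟩ := hX C hC
  rw [Set.ssubset_iff_exists]
  constructor
  · rintro d ⟨W, hW, rfl⟩
    obtain ⟨i, rfl⟩ := exists_wSet_eq hW
    obtain ⟨x, G, hG, h1, h2⟩ := S.exists_coding i
    obtain ⟨B, F, hB, hF⟩ := System.exists_copy hL hf hr hG
    exact degreeSpectrumBelow_image R e ⟨B, F, hB, by
      rw [← hF]
      exact setDegree_eq_iff.2 ⟨h2, h1⟩⟩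
  · obtain ⟨x, G, hG, havoid⟩ := S.exists_avoiding
    obtain ⟨B, F, hB, hF⟩ := System.exists_copy hL hf hr hG
    refine ⟨setDegree (setJoin (S.limitRel G) C),
      degreeSpectrumBelow_image R e ⟨B, F, hB, by rw [← hF]⟩, ?_⟩
    rintro ⟨W, hW, hdeg⟩
    obtain ⟨i, hi⟩ := exists_wSet_eq (ceIn_setJoin hW)
    rw [hi, setDegree_eq_iff] at hdeg
    exact havoid i hdeg.1 hdeg.2

end Cone

end DegreeSpectra

theorem mainTheorem3 (L : FirstOrder.Language.{u, v})
    [Primcodable (Σ n, L.Functions n)] [Primcodable (Σ n, L.Relations n)] (m : ℕ) :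
    (∀ (A : L.Structure ℕ) (R : Set (Fin m → ℕ)),
      DegreeSpectra.ComputableLanguage L →
      DegreeSpectra.ComputableStructure L A →
      ComputablePred (fun x : Fin m → ℕ => x ∈ R) →
      DegreeSpectra.EffectivelyDFree L R →
      ∃ (B : L.Structure ℕ) (F : @FirstOrder.Language.Equiv L ℕ ℕ A B),
        DegreeSpectra.ComputableStructure L B ∧
          ¬ DegreeSpectra.OfCEDegree
            (DegreeSpectra.relCode (DegreeSpectra.imageRel F R))) ∧
    (∀ (M : Type w) [Countable M] [L.Structure M] (R : Set (Fin m → M)),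
      (∀ (k : ℕ) (c : Fin k → M), ∃ (r : ℕ) (a : Fin r → M), DegreeSpectra.DFree L R c a) →
      DegreeSpectra.SpectrumOnConeStrictlyContainsCE (L := L) R) := by
  exact ⟨fun A R hL hA hR h => DegreeSpectra.exists_copy_not_ofCEDegree hL hA hR h,
    fun M _ _ R h => DegreeSpectra.spectrumOnCone_of_dFree R h⟩
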